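/- **Asymptotic notation.** For a function $\alpha(r)$, $r\to0^+$, write $\alpha=o_2(r^p)$ if $\alpha=o(r^p)$, $\alpha'=o(r^{p-1})$ and $\alpha''=o(r^{p-2})$. For a manifold $L$ let $C_\varepsilon(L)=[0,\varepsilon)\times L/(\{0\}\times L)$ be the open cone of height $\varepsilon>0$. **IACS manifolds.** A $\mathcal C_0$-manifold is a smooth Riemannian manifold, possibly with smooth boundary. For $m\ge1$, a $\mathcal C_m$-manifold is a second countable Hausdorff space $M$ with an open subset (the smooth stratum) that is a smooth manifold, possibly with smooth boundary, equipped with a Riemannian metric $g$; the complement of the smooth stratum is the singular stratum. Every point of the singular stratum lies in some stratum $\mathcal C_k$, $1\le k\le m$, which means that it is a vertex $(b,0)$ of a $\mathcal C_k$-neighborhood $U\cong\mathbb R^h\times C_\varepsilon(L)$. Here $L$ is a compact $\mathcal C_{k-1}$-manifold without boundary (the link), $h$ and $\dim L$ may vary with the neighborhood, and the homeomorphism restricts to a diffeomorphism between the smooth stratum of $U$ and $\mathbb R^h\times(0,\varepsilon)\times\{\text{smooth stratum of }L\}$. In particular, the singularities lie away from the boundary. It is required that: 1. on overlaps of $\mathcal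 C_k$-neighborhoods (for the same $k$, with bases of the same dimension) the transition functions have the form $(b,r,x)\mapsto(\psi(b),\varphi(b,r),f(b,x))$, with $\psi$ smooth, $\varphi$ smooth for $r>0$, and $\varphi(b,r)=a(b)r+o_2(r)$, $a(b)>0$, at points $(b,0)$ of the overlap; 2. the bases carry Riemannian metrics $g_B$ for which the maps $\psi$ are isometric at the $b$ with $(b,0)$ in the overlap (so that they define a metric on the stratum $\mathcal C_k$); 3. in each neighborhood $$g=g_B\oplus\beta'(b,r)^2\,dr^2\oplus\beta(b,r)^2\,g_L(b)+o_2(r^2),$$ where $\beta$ is real-valued, smooth for $r>0$, with $\beta(b,r)=a(b)r+o_2(r)$, $a(b)>0$ (locally uniformly in $b$), $\beta'=\partial_r\beta$, and $(g_L(b))_b$ is a family of metrics on $L$ such that $\mathbb R^h\times L$ with the metric $g_B\oplus g_L$ is a $\mathcal C_{k-1}$-manifold. The error term $o_2(r^2)$ is a symmetric bilinear form whose components in frames independent of $r$ that are orthonormal for $g_B\oplus dr^2\oplus g_L(b)$ are $o_2(r^2)$ as functions of $r$, uniformly on the link and locally uniformly in $b$. An IACS manifold is a $\mathcal C_m$-manifold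 for some $m\ge0$. (For $m=1$ these are the manifolds with fiberwise asymptotically conical singularities, FACS.) Its links are the manifolds $L$ above together with, recursively, those of the $\mathcal C_{k-1}$-manifolds $L$ and $\mathbb R^h\times L$. **Function spaces.** Let $M$ be a compact IACS manifold of dimension $n\ge1$, and let $E$ be a smooth Hermitian vector bundle of finite rank over its smooth stratum, with a smooth Hermitian connection $\nabla$. Let $C_c^\infty(M,E)$ be the space of smooth compactly supported sections of $E$ that vanish near the singular stratum (they need not vanish on the boundary). Let $\|\varphi\|_{L^2}^2=\int|\varphi|^2\,d\mathrm{vol}_g$, let $\|\nabla\varphi\|_{L^2}^2=\int|\nabla\varphi|^2\,d\mathrm{vol}_g$ with the norm on $T^*M\otimes E$ induced by $g$, and let $L^2(M,E)$ be the Hilbert space of square integrable sections, i.e. the completion of $C_c^\infty(M,E)$ in $\|\cdot\|_{L^2}$. Let $H^1(M,E)$ be the completion of $C_c^\infty(M,E)$ with respect to $\|\varphi\|_{H^1}=(\|\varphi\|_{L^2}^2+\|\nabla\varphi\|_{L^2}^2)^{1/2}$. **Proposition.** If all links of $M$ have dimension at least $2$, then the inclusion $H^1(M,E)\to L^2(M,E)$,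 i.e. the continuous extension of the identity of $C_c^\infty(M,E)$, is a compact operator. -/

import Mathlib

open Set Filter Topology MeasureTheory Bundle Manifold ContDiff

universe u

set_option linter.unusedSectionVars false

noncomputable section

/-- A smooth Riemannian metric on a manifold `R` (with model `I`). -/
abbrev RiemMetric {E : Type} [NormedAddCommGroup E] [NormedSpace ℝ E] {H : Type}
    [TopologicalSpace H] (I : ModelWithCorners ℝ E H) (R : Type*) [TopologicalSpace R]
    [ChartedSpace H R] [IsManifold I ∞ R] : Type _ :=
  ContMDiffRiemannianMetric I ∞ E (fun p : R => TangentSpace I p)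

/-- The topological data of a stratified space: a second countable Hausdorff space `pts` whose
smooth stratum `reg` is a smooth manifold, embedded as an open subset. The complement of
`range incl` is the singular set. With the model `𝓡∂ n` the smooth stratum may have a (smooth)
boundary. -/
structure SingularSpace {E : Type} [NormedAddCommGroup E] [NormedSpace ℝ E] {H : Type}
    [TopologicalSpace H] (I : ModelWithCorners ℝ E H) : Type (u + 1) where
  pts : Type u
  reg : Type u
  [topPts : TopologicalSpace pts]
  [t2Pts : T2Space pts]
  [countablePts : SecondCountableTopology pts]
  [topReg : TopologicalSpace reg]
  [chartedReg : ChartedSpace H reg]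
  [manifoldReg : IsManifold I ∞ reg]
  incl : reg → pts
  isOpenEmbedding_incl : IsOpenEmbedding incl

attribute [instance] SingularSpace.topPts SingularSpace.t2Pts SingularSpace.countablePts
  SingularSpace.topReg SingularSpace.chartedReg SingularSpace.manifoldReg

/-- The product `ℝʰ × L`, with smooth stratum `ℝʰ × L.reg`. -/
abbrev SingularSpace.prodEuclidean (h : ℕ) {E : Type} [NormedAddCommGroup E] [NormedSpace ℝ E]
    {H : Type} [TopologicalSpace H] {I : ModelWithCorners ℝ E H} (L : SingularSpace.{u} I) :
    SingularSpace.{u} ((𝓘(ℝ, EuclideanSpace ℝ (Fin h))).prod I) where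
  pts := EuclideanSpace ℝ (Fin h) × L.pts
  reg := EuclideanSpace ℝ (Fin h) × L.reg
  incl := Prod.map id L.incl
  isOpenEmbedding_incl := IsOpenEmbedding.id.prodMap L.isOpenEmbedding_incl

/-- The relation on `[0, ε) × L` that identifies all points of `{0} × L`. -/
def coneSetoid (ε : ℝ) (L : Type u) : Setoid (Ico (0 : ℝ) ε × L) where
  r p q := p = q ∨ ((p.1 : ℝ) = 0 ∧ (q.1 : ℝ) = 0)
  iseqv :=
    { refl := fun _ => Or.inl rfl
      symm := by
        rintro p q (h | h)
        · exact Or.inl h.symm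
        · exact Or.inr h.symm
      trans := by
        rintro p q s (h | h) (h' | h')
        · exact Or.inl (h.trans h')
        · exact Or.inr (h ▸ h')
        · exact Or.inr (h' ▸ h)
        · exact Or.inr ⟨h.1, h'.2⟩ }

/-- The truncated open cone `[0, ε) × L / {0} × L`. -/
def Cone (ε : ℝ) (L : Type u) : Type u := Quotient (coneSetoid ε L)

/-- The cone carries the quotient topology. -/
instance (ε : ℝ) (L : Type u) [TopologicalSpace L] : TopologicalSpace (Cone ε L) :=
  inferInstanceAs (TopologicalSpace (Quotient (coneSetoid ε L)))

/-- The point of the cone with radius `r` and direction `x`. -/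
def Cone.mk {ε : ℝ} {L : Type u} (r : Ico (0 : ℝ) ε) (x : L) : Cone ε L :=
  Quotient.mk (coneSetoid ε L) (r, x)

/-- A conical chart: a homeomorphism from an open set `U ⊆ S` onto `ℝʰ × C(L)`, where `C(L)` is
the open cone of height `ε` on the link `L`, which restricts to a diffeomorphism from the smooth
part of `U` onto `ℝʰ × (0, ε) × L.reg`. -/
structure ConicalChart {E : Type} [NormedAddCommGroup E] [NormedSpace ℝ E] {H : Type}
    [TopologicalSpace H] {I : ModelWithCorners ℝ E H} (S : SingularSpace.{u} I) where
  h : ℕ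
  l : ℕ
  ε : ℝ
  ε_pos : 0 < ε
  L : SingularSpace.{u} (𝓡 l)
  homeo : OpenPartialHomeomorph S.pts (EuclideanSpace ℝ (Fin h) × Cone ε L.pts)
  homeo_target : homeo.target = univ
  diffeo : PartialDiffeomorph I ((𝓘(ℝ, EuclideanSpace ℝ (Fin h))).prod (𝓘(ℝ, ℝ).prod (𝓡 l)))
    S.reg (EuclideanSpace ℝ (Fin h) × ℝ × L.reg) ∞
  diffeo_source : diffeo.source = S.incl ⁻¹' homeo.source
  diffeo_target : diffeo.target = univ ×ˢ Ioo 0 ε ×ˢ univ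
  compat : ∀ (b : EuclideanSpace ℝ (Fin h)) (r : ℝ) (hr : r ∈ Ioo 0 ε) (x : L.reg),
    S.incl (diffeo.invFun (b, r, x)) = homeo.symm (b, Cone.mk ⟨r, hr.1.le, hr.2⟩ (L.incl x))

/-- `α = o₂(r^p)` as `r → 0⁺`, uniformly in `t ∈ s` relative to the weight `N`: one has
`α = o(r^p)`, `α' = o(r^(p-1))` and `α'' = o(r^(p-2))`, the derivatives being taken in `r`. -/
def IsLittleO₂ {T : Type*} (p : ℕ) (s : Set T) (N : T → ℝ) (α : T → ℝ → ℝ) : Prop :=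
  ∀ η > 0, ∃ δ > 0, ∀ t ∈ s, ∀ r ∈ Ioo 0 δ, ∀ j ≤ 2,
    r ^ j * |iteratedDeriv j (α t) r| ≤ η * r ^ p * N t

namespace ConicalChart

variable {E : Type} [NormedAddCommGroup E] [NormedSpace ℝ E] {H : Type}
    [TopologicalSpace H] {I : ModelWithCorners ℝ E H} {S : SingularSpace.{u} I}

/-- The point of the chart domain with coordinates `(b, r, x)`. -/
def point (c : ConicalChart S) (b : EuclideanSpace ℝ (Fin c.h)) (r : Ico (0 : ℝ) c.ε)
    (x : c.L.pts) : S.pts :=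
  c.homeo.symm (b, Cone.mk r x)

/-- The vertex of the cone over `b` (it does not depend on the direction `x`). -/
def vertex (c : ConicalChart S) (b : EuclideanSpace ℝ (Fin c.h)) (x : c.L.pts) : S.pts :=
  c.point b ⟨0, le_rfl, c.ε_pos⟩ x

/-- A Riemannian metric on the base `ℝʰ` of the chart. -/
abbrev BaseMetric (c : ConicalChart S) : Type :=
  RiemMetric 𝓘(ℝ, EuclideanSpace ℝ (Fin c.h)) (EuclideanSpace ℝ (Fin c.h))

/-- The transition map between two conical charts has the form
`(b, r, x) ↦ (ψ b, φ (b, r), f (b, x))` with `ψ` and `φ` smooth (the latter for `r > 0`),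
`φ (b, r) = a b * r + o₂(r)` with `a b > 0`, and `ψ` isometric for the given base metrics, so that
these are the coordinate expressions of one metric on the stratum. -/
def HasConicalTransition (c c' : ConicalChart S) (gB : c.BaseMetric) (gB' : c'.BaseMetric) :
    Prop :=
  ∃ (ψ : EuclideanSpace ℝ (Fin c.h) → EuclideanSpace ℝ (Fin c'.h))
    (φ : EuclideanSpace ℝ (Fin c.h) → ℝ → ℝ)
    (f : EuclideanSpace ℝ (Fin c.h) → c.L.pts → c'.L.pts)
    (a : EuclideanSpace ℝ (Fin c.h) → ℝ),
    (∀ b r x, c.point b r x ∈ c'.homeo.source →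
      ∃ hφ : φ b r ∈ Ico 0 c'.ε, c.point b r x = c'.point (ψ b) ⟨φ b r, hφ⟩ (f b x)) ∧
    ContDiffOn ℝ ∞ ψ {b | ∃ r x, c.point b r x ∈ c'.homeo.source} ∧
    ContDiffOn ℝ ∞ (Function.uncurry φ)
      {q | ∃ r x, c.point q.1 r x ∈ c'.homeo.source ∧ (r : ℝ) = q.2 ∧ 0 < q.2} ∧
    ∀ b, (∃ x, c.vertex b x ∈ c'.homeo.source) →
      0 < a b ∧
      IsLittleO₂ 1 {b} 1 (fun b r => φ b r - a b * r) ∧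
      ∀ v : EuclideanSpace ℝ (Fin c.h),
        gB'.inner (ψ b) (fderiv ℝ ψ b v) (fderiv ℝ ψ b v) = gB.inner b v v

/-- `G` is the metric `g_B ⊕ g_L(b)` on `ℝʰ × L`. -/
def IsProductMetric {E : Type} [NormedAddCommGroup E] [NormedSpace ℝ E] {H : Type}
    [TopologicalSpace H] {I : ModelWithCorners ℝ E H} {h : ℕ} {L : SingularSpace.{u} I}
    (G : RiemMetric ((𝓘(ℝ, EuclideanSpace ℝ (Fin h))).prod I) (L.prodEuclidean h).reg)
    (gB : RiemMetric 𝓘(ℝ, EuclideanSpace ℝ (Fin h)) (EuclideanSpace ℝ (Fin h)))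
    (gL : EuclideanSpace ℝ (Fin h) → RiemMetric I L.reg) : Prop :=
  ∀ (b : EuclideanSpace ℝ (Fin h)) (x : L.reg) (v : EuclideanSpace ℝ (Fin h)) (w : E),
    G.inner (b, x) (v, w) (v, w) = gB.inner b v v + (gL b).inner x w w

/-- The difference of (the pullback to the chart of) `g` and
`g_B + β'(b, r)² dr² + β(b, r)² g_L(b)`, as a quadratic form, at the point `(b, r, x)` and the
tangent vector `v + s ∂_r + w`. -/
def metricError (c : ConicalChart S) (g : RiemMetric I S.reg) (gB : c.BaseMetric)
    (gL : EuclideanSpace ℝ (Fin c.h) → RiemMetric (𝓡 c.l) c.L.reg)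
    (β : EuclideanSpace ℝ (Fin c.h) → ℝ → ℝ)
    (b : EuclideanSpace ℝ (Fin c.h)) (x : c.L.reg)
    (v : EuclideanSpace ℝ (Fin c.h)) (s : ℝ) (w : EuclideanSpace ℝ (Fin c.l)) (r : ℝ) : ℝ :=
  let D := mfderiv ((𝓘(ℝ, EuclideanSpace ℝ (Fin c.h))).prod (𝓘(ℝ, ℝ).prod (𝓡 c.l))) I
    c.diffeo.invFun (b, r, x) (v, s, w)
  g.inner (c.diffeo.invFun (b, r, x)) D D
    - (gB.inner b v v + deriv (β b) r ^ 2 * s ^ 2 + β b r ^ 2 * (gL b).inner x w w)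

/-- In the chart, `g = g_B ⊕ β'(b, r)² dr² ⊕ β(b, r)² g_L(b) + o₂(r²)` and
`β(b, r) = a(b) r + o₂(r)` with `a > 0`. The error is a symmetric form whose value on vectors
`v + s ∂_r + w` that do not depend on `r` is `o₂(r²)` relative to the product metric
`g_B + dr² + g_L(b)`, uniformly on the link and locally uniformly on the base. -/
def IsAsymptoticallyConical (c : ConicalChart S) (g : RiemMetric I S.reg) (gB : c.BaseMetric)
    (gL : EuclideanSpace ℝ (Fin c.h) → RiemMetric (𝓡 c.l) c.L.reg) : Prop :=
  ∃ (β : EuclideanSpace ℝ (Fin c.h) → ℝ → ℝ) (a : EuclideanSpace ℝ (Fin c.h) → ℝ),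
    ContDiffOn ℝ ∞ (Function.uncurry β) (univ ×ˢ Ioo 0 c.ε) ∧
    (∀ b, 0 < a b) ∧
    ∀ K : Set (EuclideanSpace ℝ (Fin c.h)), IsCompact K →
      IsLittleO₂ 1 K 1 (fun b r => β b r - a b * r) ∧
      IsLittleO₂ 2
        {t : EuclideanSpace ℝ (Fin c.h) × c.L.reg × EuclideanSpace ℝ (Fin c.h) × ℝ ×
          EuclideanSpace ℝ (Fin c.l) | t.1 ∈ K}
        (fun ⟨b, x, v, s, w⟩ => gB.inner b v v + s ^ 2 + (gL b).inner x w w)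
        (fun ⟨b, x, v, s, w⟩ => c.metricError g gB gL β b x v s w)

end ConicalChart

/-- `(S, g)` is an iterated asymptotically conical singular (IACS) manifold of depth at most `m`,
all of whose links, and links of links and so on, have dimension at least `d`.

Every singular point is the vertex of a conical chart `c i` around the stratum with label `k i < m`,
whose link `L` is compact and, like the product `ℝʰ × L` with metric `g_B ⊕ g_L(b)`, IACS of depth
at most `k i`. Charts around the same stratum have conical transition maps. The metric is
asymptotically conical in each chart. For `m = 0` there are no charts and `S` is a smooth
Riemannian manifold; for `m = 1` the links are closed manifolds. -/
inductive IsIACS (d : ℕ) : ∀ {E : Type} [NormedAddCommGroup E] [NormedSpace ℝ E] {H : Type}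
    [TopologicalSpace H] {I : ModelWithCorners ℝ E H} (_ : ℕ) (S : SingularSpace.{u} I)
    (_ : RiemMetric I S.reg), Prop
  | mk {E : Type} [NormedAddCommGroup E] [NormedSpace ℝ E] {H : Type} [TopologicalSpace H]
      {I : ModelWithCorners ℝ E H} (m : ℕ) (S : SingularSpace.{u} I) (g : RiemMetric I S.reg)
      {ι : Type u} (c : ι → ConicalChart S) (k : ι → ℕ)
      (depth_lt : ∀ i, k i < m)
      (cover : ∀ p ∉ range S.incl, ∃ i b x, p = (c i).vertex b x)
      (link_dim : ∀ i, d ≤ (c i).l)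
      (link_compact : ∀ i, CompactSpace (c i).L.pts)
      (gB : ∀ i, (c i).BaseMetric)
      (transition : ∀ i j, k i = k j → (c i).h = (c j).h →
        (c i).HasConicalTransition (c j) (gB i) (gB j))
      (g₀ : ∀ i, RiemMetric (𝓡 (c i).l) (c i).L.reg)
      (link : ∀ i, IsIACS d (k i) (c i).L (g₀ i))
      (gL : ∀ i, EuclideanSpace ℝ (Fin (c i).h) → RiemMetric (𝓡 (c i).l) (c i).L.reg)
      (G : ∀ i, RiemMetric ((𝓘(ℝ, EuclideanSpace ℝ (Fin (c i).h))).prod (𝓡 (c i).l))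
        ((c i).L.prodEuclidean (c i).h).reg)
      (G_eq : ∀ i, ConicalChart.IsProductMetric (G i) (gB i) (gL i))
      (product : ∀ i, IsIACS d (k i) ((c i).L.prodEuclidean (c i).h) (G i))
      (metric : ∀ i, (c i).IsAsymptoticallyConical g (gB i) (gL i)) :
      IsIACS d m S g

section FunctionSpaces

variable {n : ℕ} {H : Type} [TopologicalSpace H]
  {I : ModelWithCorners ℝ (EuclideanSpace ℝ (Fin n)) H}
  {R : Type*} [TopologicalSpace R] [ChartedSpace H R] [IsManifold I ∞ R]

variable (I) in
/-- The coordinate vector field `∂ᵢ` of the chart around `p₀`, at the point `p`. -/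
def coordVector (p₀ p : R) (i : Fin n) :
    TangentSpace I p :=
  (trivializationAt (EuclideanSpace ℝ (Fin n)) (TangentSpace I) p₀).symm p
    (EuclideanSpace.single i 1)

/-- The Gram matrix of the coordinate vector fields. -/
def gramMatrix (g : RiemMetric I R) (p₀ p : R) : Matrix (Fin n) (Fin n) ℝ :=
  Matrix.of fun i j => g.inner p (coordVector I p₀ p i) (coordVector I p₀ p j)

/-- The density `√det g` of the Riemannian volume in the chart around `p₀`. -/
def volumeDensity (g : RiemMetric I R) (p₀ p : R) : ℝ :=
  √(gramMatrix g p₀ p).det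

theorem tangent_symm_eq (p₀ p₁ p : R) (h₀ : p ∈ (extChartAt I p₀).source)
    (h₁ : p ∈ (extChartAt I p₁).source) (v : EuclideanSpace ℝ (Fin n)) :
    (trivializationAt (EuclideanSpace ℝ (Fin n)) (TangentSpace I) p₀).symm p v =
    (trivializationAt (EuclideanSpace ℝ (Fin n)) (TangentSpace I) p₁).symm p
      (tangentCoordChange I p₀ p₁ p v) := by
  have b₀ : p ∈ (trivializationAt (EuclideanSpace ℝ (Fin n)) (TangentSpace I) p₀).baseSet := by
    simpa using h₀
  have b₁ : p ∈ (trivializationAt (EuclideanSpace ℝ (Fin n)) (TangentSpace I) p₁).baseSet := by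
    simpa using h₁
  rw [extChartAt_source] at h₀ h₁
  have e0 := TangentBundle.symmL_trivializationAt_eq_core (I := I) h₀
  have e1 := TangentBundle.symmL_trivializationAt_eq_core (I := I) h₁
  have a0 := congrArg (fun T => T v) e0
  have a1 := congrArg (fun T => T (tangentCoordChange I p₀ p₁ p v)) e1
  rw [Trivialization.symmL_apply _ b₀] at a0
  rw [Trivialization.symmL_apply _ b₁] at a1
  rw [a0, a1]
  symm
  apply (tangentBundleCore I R).coordChange_comp
  simp [h₀, h₁]

theorem volumeDensity_eq (g : RiemMetric I R) (p₀ p₁ p : R) (h₀ : p ∈ (extChartAt I p₀).source)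
    (h₁ : p ∈ (extChartAt I p₁).source) :
    volumeDensity g p₀ p = |(tangentCoordChange I p₀ p₁ p).det| * volumeDensity g p₁ p := by
  set A := LinearMap.toMatrix (EuclideanSpace.basisFun (Fin n) ℝ).toBasis
    (EuclideanSpace.basisFun (Fin n) ℝ).toBasis (tangentCoordChange I p₀ p₁ p).toLinearMap with hA
  have hdet : (tangentCoordChange I p₀ p₁ p).det = A.det := by
    rw [hA, LinearMap.det_toMatrix]
  have hc : ∀ j, coordVector I p₀ p j = ∑ i, A i j • coordVector I p₁ p i := by
    intro j
    unfold coordVector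
    rw [tangent_symm_eq p₀ p₁ p h₀ h₁]
    have : tangentCoordChange I p₀ p₁ p (EuclideanSpace.single j 1) =
        ∑ i, A i j • EuclideanSpace.single i (1 : ℝ) := by
      have := (EuclideanSpace.basisFun (Fin n) ℝ).toBasis.sum_repr
        (tangentCoordChange I p₀ p₁ p (EuclideanSpace.single j 1))
      rw [← this]
      simp [hA, LinearMap.toMatrix_apply]
    rw [this]
    have h₁' : p ∈ (trivializationAt (EuclideanSpace ℝ (Fin n)) (TangentSpace I) p₁).baseSet := by
      simpa using h₁
    simp only [← Trivialization.symmₗ_apply (R := ℝ) _ h₁', map_sum, map_smul]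
  have hG : (Matrix.of fun i j => g.inner p (coordVector I p₀ p i) (coordVector I p₀ p j)) =
      A.transpose * (Matrix.of fun i j =>
        g.inner p (coordVector I p₁ p i) (coordVector I p₁ p j)) * A := by
    ext i j
    simp only [Matrix.of_apply, Matrix.mul_apply, Matrix.transpose_apply]
    rw [hc i, hc j]
    simp only [map_sum, map_smul, sum_apply, smul_apply,
      smul_eq_mul, Finset.mul_sum, Finset.sum_mul]
    refine Finset.sum_congr rfl fun a _ => Finset.sum_congr rfl fun b _ => ?_
    ring
  unfold volumeDensity gramMatrix
  rw [hG, Matrix.det_mul, Matrix.det_mul, Matrix.det_transpose, hdet]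
  rw [show A.det * (Matrix.of fun i j =>
        g.inner p (coordVector I p₁ p i) (coordVector I p₁ p j)).det * A.det = A.det ^ 2 *
      (Matrix.of fun i j =>
        g.inner p (coordVector I p₁ p i) (coordVector I p₁ p j)).det by ring,
    Real.sqrt_mul (sq_nonneg _), Real.sqrt_sq_eq_abs]

theorem contMDiffOn_coordVector (p₀ : R) (i : Fin n) :
    ContMDiffOn I (I.prod 𝓘(ℝ, EuclideanSpace ℝ (Fin n))) ∞
      (fun p => (⟨p, coordVector I p₀ p i⟩ : TangentBundle I R)) (extChartAt I p₀).source := by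
  have hb : (trivializationAt (EuclideanSpace ℝ (Fin n)) (TangentSpace I) p₀).baseSet =
      (extChartAt I p₀).source := by
    rw [extChartAt_source]; rfl
  rw [← hb, Trivialization.contMDiffOn_section_baseSet_iff]
  refine (contMDiffOn_const (c := EuclideanSpace.single i (1 : ℝ))).congr fun p hp => ?_
  rw [coordVector, Trivialization.apply_mk_symm _ hp]

theorem continuousOn_metric (g : RiemMetric I R) {X Y : ∀ p : R, TangentSpace I p} {s : Set R}
    (hX : ContMDiffOn I (I.prod 𝓘(ℝ, EuclideanSpace ℝ (Fin n))) ∞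
      (fun p => (⟨p, X p⟩ : TangentBundle I R)) s)
    (hY : ContMDiffOn I (I.prod 𝓘(ℝ, EuclideanSpace ℝ (Fin n))) ∞
      (fun p => (⟨p, Y p⟩ : TangentBundle I R)) s) :
    ContinuousOn (fun p => g.inner p (X p) (Y p)) s := by
  let : RiemannianBundle (fun p : R => TangentSpace I p) := ⟨g.toRiemannianMetric⟩
  exact (ContMDiffOn.inner_bundle (F := EuclideanSpace ℝ (Fin n)) (IB := I) (n := ∞) hX hY).continuousOn

theorem continuousOn_gramMatrix (g : RiemMetric I R) (p₀ : R) :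
    ContinuousOn (gramMatrix g p₀) (extChartAt I p₀).source := by
  refine continuousOn_pi.2 fun i => continuousOn_pi.2 fun j => ?_
  exact continuousOn_metric g (contMDiffOn_coordVector p₀ i) (contMDiffOn_coordVector p₀ j)

theorem continuousOn_volumeDensity (g : RiemMetric I R) (p₀ : R) :
    ContinuousOn (volumeDensity g p₀) (extChartAt I p₀).source := by
  refine Real.continuous_sqrt.comp_continuousOn ?_
  exact (Continuous.matrix_det continuous_id).comp_continuousOn (continuousOn_gramMatrix g p₀)

variable [MeasurableSpace R] [BorelSpace R]

/-- The measure `√det g · Lebesgue` on the domain of the chart around `p₀`. -/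
def chartVolume (g : RiemMetric I R) (p₀ : R) : Measure R :=
  Measure.map (extChartAt I p₀).symm
    ((volume.restrict (extChartAt I p₀).target).withDensity
      fun y => ENNReal.ofReal (volumeDensity g p₀ ((extChartAt I p₀).symm y)))

/-- The Riemannian volume measure: the supremum of the chart measures `√det g · Lebesgue`. It
agrees with each of them on the domain of the chart, see `riemVolume_restrict`. -/
def riemVolume (g : RiemMetric I R) : Measure R := ⨆ p₀ : R, chartVolume g p₀

theorem measurableSet_extChartAt_target (p₀ : R) : MeasurableSet (extChartAt I p₀).target := by
  rw [extChartAt_target]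
  exact (((chartAt H p₀).open_target.preimage I.continuous_symm).measurableSet).inter
    I.isClosed_range.measurableSet

theorem aemeasurable_extChartAt_symm (g : RiemMetric I R) (p₀ : R) :
    AEMeasurable (extChartAt I p₀).symm
      ((volume.restrict (extChartAt I p₀).target).withDensity
      fun y => ENNReal.ofReal (volumeDensity g p₀ ((extChartAt I p₀).symm y))) :=
  ((continuousOn_extChartAt_symm p₀).aemeasurable
    (measurableSet_extChartAt_target p₀)).mono_ac (withDensity_absolutelyContinuous _ _)

theorem measurableSet_extChartAt_image (p₀ : R) {A : Set R} (hA : MeasurableSet A)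
    (hs : A ⊆ (extChartAt I p₀).source) : MeasurableSet (extChartAt I p₀ '' A) := by
  have himg : extChartAt I p₀ '' A = (extChartAt I p₀).target ∩ (extChartAt I p₀).symm ⁻¹' A := by
    rw [PartialEquiv.image_eq_target_inter_inv_preimage _ hs]
  rw [himg]
  obtain ⟨B, hB, hB'⟩ : ∃ B, MeasurableSet B ∧ (extChartAt I p₀).target ∩ (extChartAt I p₀).symm ⁻¹' A
      = (extChartAt I p₀).target ∩ B := by
    have h := (continuousOn_extChartAt_symm (I := I) p₀).domRestrict.measurable hA
    obtain ⟨B, hB, hB'⟩ := h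
    refine ⟨B, hB, ?_⟩
    ext y
    constructor
    · rintro ⟨hy, hy'⟩
      refine ⟨hy, ?_⟩
      have : (⟨y, hy⟩ : (extChartAt I p₀).target) ∈ Subtype.val ⁻¹' B := by
        rw [hB']; exact hy'
      exact this
    · rintro ⟨hy, hy'⟩
      refine ⟨hy, ?_⟩
      have : (⟨y, hy⟩ : (extChartAt I p₀).target) ∈ Subtype.val ⁻¹' B := hy'
      rw [hB'] at this
      exact this
  rw [hB']
  exact (measurableSet_extChartAt_target p₀).inter hB

theorem chartVolume_apply (g : RiemMetric I R) (p₀ : R) {A : Set R} (hA : MeasurableSet A)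
    (hs : A ⊆ (extChartAt I p₀).source) :
    chartVolume g p₀ A = ∫⁻ y in extChartAt I p₀ '' A,
      ENNReal.ofReal (volumeDensity g p₀ ((extChartAt I p₀).symm y)) := by
  have himg : extChartAt I p₀ '' A = (extChartAt I p₀).target ∩ (extChartAt I p₀).symm ⁻¹' A := by
    rw [PartialEquiv.image_eq_target_inter_inv_preimage _ hs]
  have hmeas := measurableSet_extChartAt_image (I := I) p₀ hA hs
  rw [chartVolume, Measure.map_apply_of_aemeasurable (aemeasurable_extChartAt_symm g p₀) hA]
  have hT := measurableSet_extChartAt_target (I := I) p₀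
  set μ := (volume.restrict (extChartAt I p₀).target).withDensity
      fun y => ENNReal.ofReal (volumeDensity g p₀ ((extChartAt I p₀).symm y)) with hμ
  have h0 : μ ((extChartAt I p₀).target)ᶜ = 0 := by
    rw [hμ, withDensity_apply _ hT.compl, Measure.restrict_restrict hT.compl]
    simp
  have h1 : μ ((extChartAt I p₀).symm ⁻¹' A) = μ (extChartAt I p₀ '' A) := by
    rw [himg, inter_comm]
    exact (measure_inter_conull h0).symm
  rw [h1, hμ, withDensity_apply _ hmeas, Measure.restrict_restrict hmeas,
    inter_eq_left.2 (by rw [himg]; exact inter_subset_left)]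

theorem chartVolume_eq (g : RiemMetric I R) (p₀ p₁ : R) {A : Set R} (hA : MeasurableSet A)
    (h₀ : A ⊆ (extChartAt I p₀).source) (h₁ : A ⊆ (extChartAt I p₁).source) :
    chartVolume g p₀ A = chartVolume g p₁ A := by
  have hB := measurableSet_extChartAt_image (I := I) p₀ hA h₀
  have himg : extChartAt I p₁ '' A =
      (extChartAt I p₁ ∘ (extChartAt I p₀).symm) '' (extChartAt I p₀ '' A) := by
    rw [image_image]
    refine image_congr fun p hp => ?_
    rw [Function.comp_apply, (extChartAt I p₀).left_inv (h₀ hp)]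
  rw [chartVolume_apply g p₀ hA h₀, chartVolume_apply g p₁ hA h₁, himg]
  rw [lintegral_image_eq_lintegral_abs_det_fderiv_mul volume hB
    (f' := fun y => tangentCoordChange I p₀ p₁ ((extChartAt I p₀).symm y))]
  · refine setLIntegral_congr_fun hB ?_
    rintro _ ⟨p, hp, rfl⟩
    simp only [Function.comp_apply, (extChartAt I p₀).left_inv (h₀ hp),
      (extChartAt I p₁).left_inv (h₁ hp)]
    rw [volumeDensity_eq g p₀ p₁ p (h₀ hp) (h₁ hp), ENNReal.ofReal_mul (abs_nonneg _)]
  · rintro _ ⟨p, hp, rfl⟩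
    rw [(extChartAt I p₀).left_inv (h₀ hp)]
    refine (hasFDerivWithinAt_tangentCoordChange ⟨h₀ hp, h₁ hp⟩).mono ?_
    rintro _ ⟨q, hq, rfl⟩
    exact extChartAt_target_subset_range p₀ ((extChartAt I p₀).map_source (h₀ hq))
  · rintro _ ⟨p, hp, rfl⟩ _ ⟨q, hq, rfl⟩ h
    simp only [Function.comp_apply, (extChartAt I p₀).left_inv (h₀ hp),
      (extChartAt I p₀).left_inv (h₀ hq)] at h
    rw [(extChartAt I p₁).injOn (h₁ hp) (h₁ hq) h]

theorem chartVolume_le (g : RiemMetric I R) (p₀ p₁ : R) :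
    (chartVolume g p₁).restrict (extChartAt I p₀).source ≤ chartVolume g p₀ := by
  have hm : ∀ p : R, MeasurableSet (extChartAt I p).source := fun p =>
    (isOpen_extChartAt_source p).measurableSet
  refine Measure.le_iff.2 fun A hA => ?_
  rw [Measure.restrict_apply hA]
  have hB := hA.inter (hm p₀)
  have h2 : chartVolume g p₁ (A ∩ (extChartAt I p₀).source) =
      chartVolume g p₁ (A ∩ (extChartAt I p₀).source ∩ (extChartAt I p₁).source) := by
    refine (measure_inter_conull ?_).symm
    rw [chartVolume, Measure.map_apply_of_aemeasurable (aemeasurable_extChartAt_symm g p₁)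
      (hm p₁).compl]
    have hT := measurableSet_extChartAt_target (I := I) p₁
    refine measure_mono_null (t := (extChartAt I p₁).targetᶜ) ?_ ?_
    · intro y hy hy'
      exact hy ((extChartAt I p₁).map_target hy')
    · rw [withDensity_apply _ hT.compl, Measure.restrict_restrict hT.compl]
      simp
  rw [h2, chartVolume_eq g p₁ p₀ (hB.inter (hm p₁)) inter_subset_right
    (inter_subset_left.trans inter_subset_right)]
  exact measure_mono (inter_subset_left.trans inter_subset_left)

/-- In a chart domain, the Riemannian volume is `√det g · Lebesgue`. -/
theorem riemVolume_restrict (g : RiemMetric I R) (p₀ : R) :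
    (riemVolume g).restrict (extChartAt I p₀).source =
      (chartVolume g p₀).restrict (extChartAt I p₀).source := by
  set s := (extChartAt I p₀).source with hs
  have hm : MeasurableSet s := (isOpen_extChartAt_source p₀).measurableSet
  apply le_antisymm
  · have h : riemVolume g ≤ chartVolume g p₀ + (⊤ : Measure R).restrict sᶜ := by
      refine iSup_le fun p₁ => ?_
      rw [← Measure.restrict_add_restrict_compl (μ := chartVolume g p₁) hm]
      exact add_le_add (chartVolume_le g p₀ p₁) (Measure.restrict_mono le_rfl le_top)
    refine (Measure.restrict_mono le_rfl h).trans ?_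
    rw [Measure.restrict_add, Measure.restrict_restrict hm]
    simp
  · exact Measure.restrict_mono le_rfl (le_iSup (fun p => chartVolume g p) p₀)

instance isLocallyFiniteMeasure_riemVolume (g : RiemMetric I R) :
    IsLocallyFiniteMeasure (riemVolume g) := by
  refine ⟨fun p₀ => ?_⟩
  have hs : IsOpen (extChartAt I p₀).source := isOpen_extChartAt_source p₀
  have h0 : p₀ ∈ (extChartAt I p₀).source := mem_extChartAt_source p₀
  have hd := (continuousOn_volumeDensity g p₀).continuousAt (hs.mem_nhds h0)
  have hev := (hd.eventually_lt continuousAt_const (lt_add_one (volumeDensity g p₀ p₀))).and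
    (((continuousAt_extChartAt p₀).eventually
      (Metric.ball_mem_nhds (extChartAt I p₀ p₀) one_pos)).and (hs.mem_nhds h0))
  obtain ⟨W, hW, hWo, hpW⟩ := mem_nhds_iff.1 hev
  refine ⟨W, hWo.mem_nhds hpW, ?_⟩
  have hWs : W ⊆ (extChartAt I p₀).source := fun p hp => (hW hp).2.2
  have h1 : riemVolume g W = chartVolume g p₀ W := by
    have := congrArg (fun μ => μ W) (riemVolume_restrict g p₀)
    simpa only [Measure.restrict_apply hWo.measurableSet, inter_eq_left.2 hWs] using this
  rw [h1, chartVolume_apply g p₀ hWo.measurableSet hWs]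
  calc _ ≤ ∫⁻ y in extChartAt I p₀ '' W, ENNReal.ofReal (volumeDensity g p₀ p₀ + 1) := by
        refine setLIntegral_mono_ae' (measurableSet_extChartAt_image p₀ hWo.measurableSet hWs) ?_
        refine Eventually.of_forall ?_
        rintro _ ⟨p, hp, rfl⟩
        rw [(extChartAt I p₀).left_inv (hWs hp)]
        exact ENNReal.ofReal_le_ofReal (hW hp).1.le
    _ ≤ ENNReal.ofReal (volumeDensity g p₀ p₀ + 1) *
        volume (Metric.ball (extChartAt I p₀ p₀) 1) := by
        rw [setLIntegral_const]
        gcongr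
        rintro _ ⟨p, hp, rfl⟩
        exact (hW hp).2.1
    _ < ⊤ := ENNReal.mul_lt_top ENNReal.ofReal_lt_top measure_ball_lt_top

end FunctionSpaces


section Hermitian

attribute [local instance] InnerProductSpace.complexToReal

variable {n : ℕ} {H : Type} [TopologicalSpace H]
  {I : ModelWithCorners ℝ (EuclideanSpace ℝ (Fin n)) H}
  {R : Type*} [TopologicalSpace R] [ChartedSpace H R] [IsManifold I ∞ R]
  {F : Type*} [NormedAddCommGroup F] [NormedSpace ℂ F] [FiniteDimensional ℂ F]
  {E : R → Type*} [TopologicalSpace (TotalSpace F E)] [∀ p, NormedAddCommGroup (E p)]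
  [∀ p, InnerProductSpace ℂ (E p)] [FiberBundle F E]

variable (I F E) in
/-- A smooth complex vector bundle `E` with a smooth Hermitian metric (the given complex inner
products on the fibres). -/
class IsHermitianBundle : Prop where
  complexLinear : VectorBundle ℂ F E
  realLinear : VectorBundle ℝ F E
  smooth : ContMDiffVectorBundle ∞ F E I
  smooth_metric : IsContMDiffRiemannianBundle I ∞ F E

attribute [instance] IsHermitianBundle.complexLinear IsHermitianBundle.realLinear
  IsHermitianBundle.smooth IsHermitianBundle.smooth_metric

variable (I F E) in
/-- A smooth Hermitian connection: a smooth covariant derivative that is complex linear and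
satisfies `d⟨σ, τ⟩ = ⟨∇σ, τ⟩ + ⟨σ, ∇τ⟩`. -/
structure HermitianConnection [IsHermitianBundle I F E] extends CovariantDerivative I F E where
  smooth : CovariantDerivative.ContMDiffCovariantDerivative toCovariantDerivative ∞
  map_I_smul : ∀ (σ : ∀ p, E p) (p : R),
    MDifferentiableAt I (I.prod 𝓘(ℝ, F)) (fun q => (⟨q, σ q⟩ : TotalSpace F E)) p →
    ∀ v : TangentSpace I p, toFun (Complex.I • σ) p v = Complex.I • toFun σ p v
  metric : ∀ (σ τ : ∀ p, E p) (p : R),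
    MDifferentiableAt I (I.prod 𝓘(ℝ, F)) (fun q => (⟨q, σ q⟩ : TotalSpace F E)) p →
    MDifferentiableAt I (I.prod 𝓘(ℝ, F)) (fun q => (⟨q, τ q⟩ : TotalSpace F E)) p →
    ∀ v : TangentSpace I p,
      mfderiv I 𝓘(ℝ, ℂ) (fun q => inner ℂ (σ q) (τ q)) p v =
        inner ℂ (toFun σ p v) (τ p) + inner ℂ (σ p) (toFun τ p v)


variable [IsHermitianBundle I F E]

theorem contMDiffOn_complex_smul {σ : ∀ p, E p} {s : Set R} (c : ℂ)
    (hσ : ContMDiffOn I (I.prod 𝓘(ℝ, F)) ∞ (fun p => (⟨p, σ p⟩ : TotalSpace F E)) s) :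
    ContMDiffOn I (I.prod 𝓘(ℝ, F)) ∞ (fun p => (⟨p, c • σ p⟩ : TotalSpace F E)) s := by
  intro p₀ hp₀
  have h := contMDiffWithinAt_section.1 (hσ p₀ hp₀)
  rw [contMDiffWithinAt_section]
  have h' : ContMDiffWithinAt I 𝓘(ℝ, F) ∞
      (fun p => c • (trivializationAt F E p₀ ⟨p, σ p⟩).2) s p₀ := by
    have hL : ContMDiff 𝓘(ℝ, F) 𝓘(ℝ, F) ∞ (fun y : F => c • y) :=
      (contDiff_const_smul c).contMDiff
    exact hL.contMDiffAt.comp_contMDiffWithinAt p₀ h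
  have key : ∀ p ∈ (trivializationAt F E p₀).baseSet,
      (trivializationAt F E p₀ ⟨p, c • σ p⟩).2 = c • (trivializationAt F E p₀ ⟨p, σ p⟩).2 :=
    fun p hp => ((trivializationAt F E p₀).linear ℂ hp).map_smul c (σ p)
  refine h'.congr_of_eventuallyEq ?_ (key p₀ (FiberBundle.mem_baseSet_trivializationAt' p₀))
  filter_upwards [mem_nhdsWithin_of_mem_nhds ((trivializationAt F E p₀).open_baseSet.mem_nhds
    (FiberBundle.mem_baseSet_trivializationAt' p₀))] with p hp
  exact key p hp

variable (I F E) in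
/-- `C_c^∞(M, E)`: the smooth sections over the smooth stratum whose support is compact in the
smooth stratum, that is, the compactly supported smooth sections that vanish near the singular
stratum. -/
def CcSection : Submodule ℂ (∀ p, E p) where
  carrier := {σ | ContMDiff I (I.prod 𝓘(ℝ, F)) ∞ (fun p => (⟨p, σ p⟩ : TotalSpace F E)) ∧
    IsCompact (closure {p | σ p ≠ 0})}
  zero_mem' := ⟨contMDiff_zeroSection ℝ E, by simp⟩
  add_mem' := by
    rintro σ τ ⟨hσ, hσ'⟩ ⟨hτ, hτ'⟩
    refine ⟨hσ.add_section hτ, (hσ'.union hτ').of_isClosed_subset isClosed_closure ?_⟩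
    rw [← closure_union]
    refine closure_mono fun p hp => ?_
    by_contra h
    simp only [mem_union, mem_ofPred_eq, not_or, not_not] at h
    exact hp (by simp [h.1, h.2])
  smul_mem' := by
    rintro c σ ⟨hσ, hσ'⟩
    refine ⟨contMDiffOn_univ.1 (contMDiffOn_complex_smul c hσ.contMDiffOn), hσ'.of_isClosed_subset isClosed_closure ?_⟩
    refine closure_mono fun p hp => ?_
    by_contra h
    simp only [mem_ofPred_eq, not_not] at h
    exact hp (by simp [h])

theorem HermitianConnection.map_add (D : HermitianConnection I F E) (σ τ : CcSection I F E) :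
    D.toFun (σ + τ : CcSection I F E) = D.toFun σ + D.toFun τ := by
  ext1 p
  exact D.isCovariantDerivativeOnUniv.add ((σ.2.1 p).mdifferentiableAt (by simp))
    ((τ.2.1 p).mdifferentiableAt (by simp))

theorem HermitianConnection.map_smul (D : HermitianConnection I F E) (c : ℂ)
    (σ : CcSection I F E) (p : R) (v : TangentSpace I p) :
    D.toFun (c • σ : CcSection I F E) p v = c • D.toFun σ p v := by
  have h : ∀ τ : CcSection I F E, MDifferentiableAt I (I.prod 𝓘(ℝ, F))
      (fun q => (⟨q, (τ : ∀ p, E p) q⟩ : TotalSpace F E)) p :=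
    fun τ => (τ.2.1 p).mdifferentiableAt (by simp)
  have hc : ((c • σ : CcSection I F E) : ∀ p, E p) =
      ((c.re : ℝ) • (σ : ∀ p, E p)) + (c.im : ℝ) • (Complex.I • (σ : ∀ p, E p)) := by
    funext q
    simp only [Submodule.coe_smul, Pi.smul_apply, Pi.add_apply]
    conv_lhs => rw [← Complex.re_add_im c, add_smul, mul_smul]
    simp
  have hr : ∀ (a : ℝ) (τ : CcSection I F E), MDifferentiableAt I (I.prod 𝓘(ℝ, F))
      (fun q => (⟨q, (a • (τ : ∀ p, E p)) q⟩ : TotalSpace F E)) p := fun a τ => by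
    have := h ((a : ℂ) • τ)
    simpa using this
  have hI : MDifferentiableAt I (I.prod 𝓘(ℝ, F))
      (fun q => (⟨q, (Complex.I • (σ : ∀ p, E p)) q⟩ : TotalSpace F E)) p := h (Complex.I • σ)
  have hrI : MDifferentiableAt I (I.prod 𝓘(ℝ, F))
      (fun q => (⟨q, (c.im • (Complex.I • (σ : ∀ p, E p))) q⟩ : TotalSpace F E)) p :=
    hr c.im (Complex.I • σ)
  rw [hc, D.isCovariantDerivativeOnUniv.add (hr _ σ) hrI,
    D.isCovariantDerivativeOnUniv.smul_const _ (h σ),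
    D.isCovariantDerivativeOnUniv.smul_const _ hI]
  simp only [add_apply, smul_apply, D.map_I_smul _ p (h σ) v]
  conv_rhs => rw [← Complex.re_add_im c, add_smul, mul_smul]
  simp

/-- The Hermitian inner product of two elements of `T*_p ⊗ E_p`, namely `∑ ⟨T eᵢ, T' eᵢ⟩` for a
`g`-orthonormal basis `e` of the tangent space. -/
def gradInner (g : RiemMetric I R) (p : R) (T T' : TangentSpace I p →L[ℝ] E p) : ℂ :=
  letI : RiemannianBundle (fun p : R => TangentSpace I p) := ⟨g.toRiemannianMetric⟩
  letI : FiniteDimensional ℝ (TangentSpace I p) :=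
    inferInstanceAs (FiniteDimensional ℝ (EuclideanSpace ℝ (Fin n)))
  ∑ i, inner ℂ (T (stdOrthonormalBasis ℝ (TangentSpace I p) i))
    (T' (stdOrthonormalBasis ℝ (TangentSpace I p) i))

/-- An orthonormal trace, computed in an arbitrary basis with Gram matrix `G`. -/
theorem sum_orthonormal_eq {V W : Type*} [NormedAddCommGroup V] [InnerProductSpace ℝ V]
    [AddCommGroup W] [Module ℝ W] {ι κ : Type*} [Fintype ι] [DecidableEq ι] [Fintype κ]
    [DecidableEq κ]
    (e : OrthonormalBasis ι ℝ V) (v : Module.Basis κ ℝ V) (G : Matrix κ κ ℝ)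
    (hG : ∀ i j, G i j = inner ℝ (v i) (v j)) (B : V →ₗ[ℝ] V →ₗ[ℝ] W) :
    ∑ i, B (e i) (e i) = ∑ i, ∑ j, (G⁻¹ i j) • B (v i) (v j) := by
  set A : Matrix ι κ ℝ := Matrix.of fun k i => v.repr (e k) i with hA
  set P : Matrix κ ι ℝ := Matrix.of fun i k => inner ℝ (e k) (v i) with hP
  have he : ∀ k, e k = ∑ i, A k i • v i := fun k => (v.sum_repr (e k)).symm
  have hv : ∀ i, v i = ∑ k, P i k • e k := fun i => (e.sum_repr' (v i)).symm
  have hAP : A * P = 1 := by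
    ext k l
    have h1 : inner ℝ (e l) (e k) = ∑ i, A k i * P i l := by
      conv_lhs => rw [he k, inner_sum]
      simp [inner_smul_right, hP]
    rw [Matrix.mul_apply, ← h1, orthonormal_iff_ite.1 e.orthonormal, Matrix.one_apply]
    simp [eq_comm]
  have hPA : P * A = 1 := by
    ext i j
    have h1 : v i = ∑ j, (P * A) i j • v j := by
      conv_lhs => rw [hv i]
      simp only [Matrix.mul_apply, Finset.sum_smul]
      rw [Finset.sum_comm]
      refine Finset.sum_congr rfl fun k _ => ?_
      conv_lhs => rw [he k, Finset.smul_sum]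
      simp [mul_smul]
    have h2 := congrArg (fun x => v.repr x j) h1
    simp only [map_sum, map_smul, Module.Basis.repr_self] at h2
    simp only [Finsupp.coe_finsetSum, Finset.sum_apply, Finsupp.smul_apply, smul_eq_mul,
      Finsupp.single_apply] at h2
    rw [Matrix.one_apply]
    simpa using h2.symm
  have hGP : G = P * P.transpose := by
    ext i j
    rw [hG, Matrix.mul_apply]
    conv_lhs => rw [hv i, hv j]
    simp [inner_sum, sum_inner, inner_smul_left, inner_smul_right,
      orthonormal_iff_ite.1 e.orthonormal, mul_comm]
  have hinv : G⁻¹ = A.transpose * A := by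
    refine Matrix.inv_eq_left_inv ?_
    rw [hGP, Matrix.mul_assoc, ← Matrix.mul_assoc A, hAP, Matrix.one_mul, ← Matrix.transpose_mul,
      hPA, Matrix.transpose_one]
  rw [hinv]
  simp only [Matrix.mul_apply, Matrix.transpose_apply, Finset.sum_smul]
  have hk : ∀ k, B (e k) (e k) = ∑ i, ∑ j, (A k i * A k j) • B (v i) (v j) := by
    intro k
    conv_lhs => rw [he k]
    simp only [map_sum, map_smul, LinearMap.sum_apply, LinearMap.smul_apply, Finset.smul_sum,
      mul_smul]
    rw [Finset.sum_comm]
    refine Finset.sum_congr rfl fun i _ => Finset.sum_congr rfl fun j _ => ?_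
    rw [smul_comm]
  simp only [hk]
  rw [Finset.sum_comm]
  refine Finset.sum_congr rfl fun i _ => ?_
  rw [Finset.sum_comm]

theorem gradInner_eq (g : RiemMetric I R) (p₀ p : R) (hp : p ∈ (extChartAt I p₀).source)
    (T T' : TangentSpace I p →L[ℝ] E p) :
    gradInner g p T T' = ∑ i, ∑ j, ((gramMatrix g p₀ p)⁻¹ i j) •
      (inner ℂ (T (coordVector I p₀ p i)) (T' (coordVector I p₀ p j)) : ℂ) := by
  have hb : p ∈ (trivializationAt (EuclideanSpace ℝ (Fin n)) (TangentSpace I) p₀).baseSet := by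
    simpa using hp
  let v : Module.Basis (Fin n) ℝ (TangentSpace I p) :=
    (EuclideanSpace.basisFun (Fin n) ℝ).toBasis.map
      ((trivializationAt (EuclideanSpace ℝ (Fin n)) (TangentSpace I) p₀).linearEquivAt ℝ p
        hb).symm
  have hv : ∀ i, v i = coordVector I p₀ p i := fun i => by
    simp [v, coordVector]
  let : RiemannianBundle (fun p : R => TangentSpace I p) := ⟨g.toRiemannianMetric⟩
  let : FiniteDimensional ℝ (TangentSpace I p) :=
    inferInstanceAs (FiniteDimensional ℝ (EuclideanSpace ℝ (Fin n)))
  let B : TangentSpace I p →ₗ[ℝ] TangentSpace I p →ₗ[ℝ] ℂ :=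
    LinearMap.mk₂ ℝ (fun x y => (inner ℂ (T x) (T' y) : ℂ))
      (by intros; simp) (by intros; simp [inner_smul_left_eq_smul])
      (by intros; simp) (by intros; simp [inner_smul_right_eq_smul])
  have h := sum_orthonormal_eq (stdOrthonormalBasis ℝ (TangentSpace I p)) v (gramMatrix g p₀ p)
    (fun i j => by rw [hv, hv]; rfl) B
  simp only [hv] at h
  exact h

theorem det_gramMatrix_ne_zero (g : RiemMetric I R) (p₀ p : R)
    (hp : p ∈ (extChartAt I p₀).source) : (gramMatrix g p₀ p).det ≠ 0 := by
  have hb : p ∈ (trivializationAt (EuclideanSpace ℝ (Fin n)) (TangentSpace I) p₀).baseSet := by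
    simpa using hp
  let v : Module.Basis (Fin n) ℝ (TangentSpace I p) :=
    (EuclideanSpace.basisFun (Fin n) ℝ).toBasis.map
      ((trivializationAt (EuclideanSpace ℝ (Fin n)) (TangentSpace I) p₀).linearEquivAt ℝ p
        hb).symm
  have hv : ∀ i, v i = coordVector I p₀ p i := fun i => by
    simp [v, coordVector]
  let : RiemannianBundle (fun p : R => TangentSpace I p) := ⟨g.toRiemannianMetric⟩
  have h := (Matrix.posDef_gram_iff_linearIndependent (𝕜 := ℝ) (v := v)).2 v.linearIndependent
  have hG : gramMatrix g p₀ p = Matrix.gram ℝ v := by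
    ext i j
    rw [Matrix.gram_apply, hv, hv]; rfl
  rw [hG]
  exact h.det_pos.ne'

theorem continuousOn_inner_section {σ τ : ∀ p, E p} {s : Set R}
    (hσ : ContMDiffOn I (I.prod 𝓘(ℝ, F)) ∞ (fun p => (⟨p, σ p⟩ : TotalSpace F E)) s)
    (hτ : ContMDiffOn I (I.prod 𝓘(ℝ, F)) ∞ (fun p => (⟨p, τ p⟩ : TotalSpace F E)) s)
    (hτ' : ContMDiffOn I (I.prod 𝓘(ℝ, F)) ∞
      (fun p => (⟨p, Complex.I • τ p⟩ : TotalSpace F E)) s) :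
    ContinuousOn (fun p => (inner ℂ (σ p) (τ p) : ℂ)) s := by
  have h1 : ContinuousOn (fun p => (inner ℝ (σ p) (τ p) : ℝ)) s :=
    (ContMDiffOn.inner_bundle (IB := I) (n := ∞) hσ hτ).continuousOn
  have h2 : ContinuousOn (fun p => (inner ℝ (σ p) (Complex.I • τ p) : ℝ)) s :=
    (ContMDiffOn.inner_bundle (IB := I) (n := ∞) hσ hτ').continuousOn
  have h3 : ContinuousOn (fun p => (((inner ℝ (σ p) (τ p) : ℝ) : ℂ) -
      ((inner ℝ (σ p) (Complex.I • τ p) : ℝ) : ℂ) * Complex.I)) s :=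
    (Complex.continuous_ofReal.comp_continuousOn h1).sub
      ((Complex.continuous_ofReal.comp_continuousOn h2).mul continuousOn_const)
  refine h3.congr fun p _ => ?_
  apply Complex.ext
  · simp [real_inner_eq_re_inner ℂ]
  · simp [real_inner_eq_re_inner ℂ, inner_smul_right]

theorem CcSection.continuous_inner (σ τ : CcSection I F E) :
    Continuous (fun p => (inner ℂ ((σ : ∀ p, E p) p) ((τ : ∀ p, E p) p) : ℂ)) := by
  rw [← continuousOn_univ]
  exact continuousOn_inner_section σ.2.1.contMDiffOn τ.2.1.contMDiffOn
    (contMDiffOn_complex_smul _ τ.2.1.contMDiffOn)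

theorem HermitianConnection.continuous_gradInner (g : RiemMetric I R)
    (D : HermitianConnection I F E) (σ τ : CcSection I F E) :
    Continuous (fun p => gradInner g p (D.toFun σ p) (D.toFun τ p)) := by
  rw [continuous_iff_continuousAt]
  intro p₀
  have hs : IsOpen (extChartAt I p₀).source := isOpen_extChartAt_source p₀
  have hD : ∀ (ρ : CcSection I F E) (i : Fin n), ContMDiffOn I (I.prod 𝓘(ℝ, F)) ∞
      (fun p => (⟨p, D.toFun ρ p (coordVector I p₀ p i)⟩ : TotalSpace F E))
      (extChartAt I p₀).source := fun ρ i => by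
    have h := D.smooth.contMDiff.contMDiff (σ := ρ)
      ρ.2.1.contMDiffOn
    exact ContMDiffOn.clm_bundle_apply (h.mono (subset_univ _)) (contMDiffOn_coordVector p₀ i)
  have hinv : ContinuousOn (fun p => (gramMatrix g p₀ p)⁻¹) (extChartAt I p₀).source := by
    have h1 := continuousOn_gramMatrix g p₀
    simp only [Matrix.inv_def, Ring.inverse_eq_inv']
    refine ContinuousOn.smul (ContinuousOn.inv₀ ?_ fun p hp => det_gramMatrix_ne_zero g p₀ p hp) ?_
    · exact (Continuous.matrix_det continuous_id).comp_continuousOn h1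
    · exact (Continuous.matrix_adjugate continuous_id).comp_continuousOn h1
  have h : ContinuousOn (fun p => gradInner g p (D.toFun σ p) (D.toFun τ p))
      (extChartAt I p₀).source := by
    refine ContinuousOn.congr ?_ fun p hp => gradInner_eq g p₀ p hp _ _
    refine continuousOn_finsetSum _ fun i _ => continuousOn_finsetSum _ fun j _ => ?_
    have hij : ContinuousOn (fun p => (gramMatrix g p₀ p)⁻¹ i j) (extChartAt I p₀).source :=
      continuousOn_pi.1 (continuousOn_pi.1 hinv i) j
    exact hij.smul (continuousOn_inner_section (hD σ i) (hD τ j)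
      (contMDiffOn_complex_smul _ (hD τ j)))
  exact h.continuousAt (hs.mem_nhds (mem_extChartAt_source p₀))

theorem gradInner_add_left (g : RiemMetric I R) (p : R) (T T' T'' : TangentSpace I p →L[ℝ] E p) :
    gradInner g p (T + T') T'' = gradInner g p T T'' + gradInner g p T' T'' := by
  simp [gradInner, Finset.sum_add_distrib]

theorem gradInner_smul_left (g : RiemMetric I R) (p : R) (c : ℂ)
    (S T T' : TangentSpace I p →L[ℝ] E p) (hS : ∀ v, S v = c • T v) :
    gradInner g p S T' = (starRingEnd ℂ) c * gradInner g p T T' := by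
  simp [gradInner, hS, Finset.mul_sum, mul_comm]

theorem gradInner_conj (g : RiemMetric I R) (p : R) (T T' : TangentSpace I p →L[ℝ] E p) :
    (starRingEnd ℂ) (gradInner g p T' T) = gradInner g p T T' := by
  simp [gradInner]

theorem gradInner_self_nonneg (g : RiemMetric I R) (p : R) (T : TangentSpace I p →L[ℝ] E p) :
    0 ≤ RCLike.re (gradInner g p T T) := by
  simp only [gradInner, map_sum]
  exact Finset.sum_nonneg fun i _ => inner_self_nonneg

variable [MeasurableSpace R] [BorelSpace R]

theorem CcSection.integrable_inner (g : RiemMetric I R) (σ τ : CcSection I F E) :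
    Integrable (fun p => (inner ℂ ((σ : ∀ p, E p) p) ((τ : ∀ p, E p) p) : ℂ)) (riemVolume g) := by
  refine (CcSection.continuous_inner σ τ).integrable_of_hasCompactSupport ?_
  refine σ.2.2.of_isClosed_subset isClosed_closure (closure_mono fun p hp h => ?_)
  exact hp (by simp [h])

theorem HermitianConnection.integrable_gradInner (g : RiemMetric I R)
    (D : HermitianConnection I F E) (σ τ : CcSection I F E) :
    Integrable (fun p => gradInner g p (D.toFun σ p) (D.toFun τ p)) (riemVolume g) := by
  refine (D.continuous_gradInner g σ τ).integrable_of_hasCompactSupport ?_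
  refine σ.2.2.of_isClosed_subset isClosed_closure ?_
  refine closure_minimal (fun p hp => ?_) isClosed_closure
  by_contra h
  refine hp ?_
  have h0 : ∀ᶠ q in 𝓝 p, (σ : ∀ p, E p) q = (0 : ∀ p, E p) q := by
    filter_upwards [isClosed_closure.isOpen_compl.mem_nhds h] with q hq
    by_contra h'
    exact hq (subset_closure h')
  have h1 : D.toFun σ p = 0 := by
    rw [D.isCovariantDerivativeOnUniv.congr_of_eventuallyEq
      ((σ.2.1 p).mdifferentiableAt (by simp)) (mdifferentiableAt_zeroSection ..) univ_mem h0]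
    exact D.isCovariantDerivativeOnUniv.zero
  simp [gradInner, h1]

/-- The inner product `∫ ⟨φ, ψ⟩ dvol_g` on `C_c^∞(M, E)`. -/
def CcSection.l2Inner (g : RiemMetric I R) (φ ψ : CcSection I F E) : ℂ :=
  ∫ p, inner ℂ ((φ : ∀ p, E p) p) ((ψ : ∀ p, E p) p) ∂(riemVolume g)

/-- The inner product `∫ ⟨∇φ, ∇ψ⟩ dvol_g` on `C_c^∞(M, E)`. -/
def HermitianConnection.dirichletInner (g : RiemMetric I R) (D : HermitianConnection I F E)
    (φ ψ : CcSection I F E) : ℂ :=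
  ∫ p, gradInner g p (D.toFun φ p) (D.toFun ψ p) ∂(riemVolume g)

variable (F E) in
/-- `C_c^∞(M, E)` with the norm of `L²(M, E)`. -/
def L2Pre (_ : RiemMetric I R) : Type _ := CcSection I F E

/-- `C_c^∞(M, E)` with the norm of `H¹(M, E)`. -/
def H1Pre (_ : RiemMetric I R) (_ : HermitianConnection I F E) : Type _ := CcSection I F E

instance (g : RiemMetric I R) : AddCommGroup (L2Pre F E g) :=
  inferInstanceAs (AddCommGroup (CcSection I F E))

instance (g : RiemMetric I R) : Module ℂ (L2Pre F E g) :=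
  inferInstanceAs (Module ℂ (CcSection I F E))

instance (g : RiemMetric I R) (D : HermitianConnection I F E) : AddCommGroup (H1Pre g D) :=
  inferInstanceAs (AddCommGroup (CcSection I F E))

instance (g : RiemMetric I R) (D : HermitianConnection I F E) : Module ℂ (H1Pre g D) :=
  inferInstanceAs (Module ℂ (CcSection I F E))

theorem CcSection.l2Inner_conj (g : RiemMetric I R) (φ ψ : CcSection I F E) :
    (starRingEnd ℂ) (CcSection.l2Inner g ψ φ) = CcSection.l2Inner g φ ψ := by
  simp only [CcSection.l2Inner, ← integral_conj, inner_conj_symm]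

theorem CcSection.l2Inner_self_nonneg (g : RiemMetric I R) (φ : CcSection I F E) :
    0 ≤ RCLike.re (CcSection.l2Inner g φ φ) := by
  rw [CcSection.l2Inner, ← integral_re (CcSection.integrable_inner g φ φ)]
  exact integral_nonneg fun p => inner_self_nonneg

theorem CcSection.l2Inner_add_left (g : RiemMetric I R) (φ φ' ψ : CcSection I F E) :
    CcSection.l2Inner g (φ + φ') ψ = CcSection.l2Inner g φ ψ + CcSection.l2Inner g φ' ψ := by
  rw [CcSection.l2Inner, CcSection.l2Inner, CcSection.l2Inner,
    ← integral_add (CcSection.integrable_inner g φ ψ) (CcSection.integrable_inner g φ' ψ)]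
  simp

theorem CcSection.l2Inner_smul_left (g : RiemMetric I R) (φ ψ : CcSection I F E) (c : ℂ) :
    CcSection.l2Inner g (c • φ) ψ = (starRingEnd ℂ) c * CcSection.l2Inner g φ ψ := by
  rw [CcSection.l2Inner, CcSection.l2Inner, ← integral_const_mul]
  simp [mul_comm]

theorem HermitianConnection.dirichletInner_self_nonneg (g : RiemMetric I R)
    (D : HermitianConnection I F E) (φ : CcSection I F E) :
    0 ≤ RCLike.re (D.dirichletInner g φ φ) := by
  unfold HermitianConnection.dirichletInner
  rw [← integral_re (D.integrable_gradInner g φ φ)]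
  exact integral_nonneg fun p => gradInner_self_nonneg g p _

/-- The inner product `∫ ⟨φ, ψ⟩ + ⟨∇φ, ∇ψ⟩ dvol_g` on `C_c^∞(M, E)`. -/
def HermitianConnection.h1Inner (g : RiemMetric I R) (D : HermitianConnection I F E)
    (φ ψ : CcSection I F E) : ℂ :=
  CcSection.l2Inner g φ ψ + D.dirichletInner g φ ψ

theorem HermitianConnection.h1Inner_conj (g : RiemMetric I R) (D : HermitianConnection I F E)
    (φ ψ : CcSection I F E) : (starRingEnd ℂ) (D.h1Inner g ψ φ) = D.h1Inner g φ ψ := by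
  unfold HermitianConnection.h1Inner HermitianConnection.dirichletInner
  rw [_root_.map_add, CcSection.l2Inner_conj g]
  simp only [← integral_conj, gradInner_conj]

theorem HermitianConnection.h1Inner_self_nonneg (g : RiemMetric I R)
    (D : HermitianConnection I F E) (φ : CcSection I F E) :
    0 ≤ RCLike.re (D.h1Inner g φ φ) := by
  unfold HermitianConnection.h1Inner
  rw [_root_.map_add]
  exact add_nonneg (CcSection.l2Inner_self_nonneg g φ) (D.dirichletInner_self_nonneg g φ)

theorem HermitianConnection.h1Inner_add_left (g : RiemMetric I R)
    (D : HermitianConnection I F E) (φ φ' ψ : CcSection I F E) :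
    D.h1Inner g (φ + φ') ψ = D.h1Inner g φ ψ + D.h1Inner g φ' ψ := by
  have h : D.dirichletInner g (φ + φ') ψ =
      D.dirichletInner g φ ψ + D.dirichletInner g φ' ψ := by
    unfold HermitianConnection.dirichletInner
    rw [← integral_add (D.integrable_gradInner g φ ψ) (D.integrable_gradInner g φ' ψ)]
    simp only [D.map_add, Pi.add_apply, gradInner_add_left]
  unfold HermitianConnection.h1Inner
  rw [h, CcSection.l2Inner_add_left]
  ring

theorem HermitianConnection.h1Inner_smul_left (g : RiemMetric I R)
    (D : HermitianConnection I F E) (φ ψ : CcSection I F E) (c : ℂ) :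
    D.h1Inner g (c • φ) ψ = (starRingEnd ℂ) c * D.h1Inner g φ ψ := by
  have h : D.dirichletInner g (c • φ) ψ = (starRingEnd ℂ) c * D.dirichletInner g φ ψ := by
    unfold HermitianConnection.dirichletInner
    rw [← integral_const_mul]
    refine integral_congr_ae (Eventually.of_forall fun p => ?_)
    exact gradInner_smul_left g p c _ _ _ (D.map_smul c φ p)
  unfold HermitianConnection.h1Inner
  rw [h, CcSection.l2Inner_smul_left]
  ring

variable (F E) in
/-- The `L²`-inner product on `C_c^∞(M, E)`. -/
abbrev l2Core (g : RiemMetric I R) : PreInnerProductSpace.Core ℂ (L2Pre F E g) where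
  inner φ ψ := CcSection.l2Inner g φ ψ
  conj_inner_symm := CcSection.l2Inner_conj g
  re_inner_nonneg := CcSection.l2Inner_self_nonneg g
  add_left := CcSection.l2Inner_add_left g
  smul_left φ ψ c := CcSection.l2Inner_smul_left g φ ψ c

/-- The `H¹`-inner product on `C_c^∞(M, E)`, with norm `(‖φ‖² + ‖∇φ‖²)^{1/2}`. -/
abbrev h1Core (g : RiemMetric I R) (D : HermitianConnection I F E) :
    PreInnerProductSpace.Core ℂ (H1Pre g D) where
  inner φ ψ := D.h1Inner g φ ψ
  conj_inner_symm := D.h1Inner_conj g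
  re_inner_nonneg := D.h1Inner_self_nonneg g
  add_left := D.h1Inner_add_left g
  smul_left φ ψ c := D.h1Inner_smul_left g φ ψ c

instance (g : RiemMetric I R) : SeminormedAddCommGroup (L2Pre F E g) :=
  letI := l2Core F E g
  InnerProductSpace.Core.toSeminormedAddCommGroup (𝕜 := ℂ)

instance (g : RiemMetric I R) : NormedSpace ℂ (L2Pre F E g) :=
  letI := l2Core F E g
  InnerProductSpace.Core.toNormedSpace

instance (g : RiemMetric I R) (D : HermitianConnection I F E) :
    SeminormedAddCommGroup (H1Pre g D) :=
  letI := h1Core g D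
  InnerProductSpace.Core.toSeminormedAddCommGroup (𝕜 := ℂ)

instance (g : RiemMetric I R) (D : HermitianConnection I F E) : NormedSpace ℂ (H1Pre g D) :=
  letI := h1Core g D
  InnerProductSpace.Core.toNormedSpace

variable (F E) in
/-- The Hilbert space `L²(M, E)`, as the completion of `C_c^∞(M, E)` for the `L²`-norm. -/
abbrev L2 (g : RiemMetric I R) : Type _ := UniformSpace.Completion (L2Pre F E g)

/-- The Sobolev space `H¹(M, E)`: the completion of `C_c^∞(M, E)` for the `H¹`-norm. -/
abbrev H1 (g : RiemMetric I R) (D : HermitianConnection I F E) : Type _ :=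
  UniformSpace.Completion (H1Pre g D)

/-- The identity of `C_c^∞(M, E)`, from the `H¹`-norm to the `L²`-norm. -/
def sobolevInclusionPre (g : RiemMetric I R) (D : HermitianConnection I F E) :
    H1Pre g D →L[ℂ] L2Pre F E g :=
  LinearMap.mkContinuous
    { toFun := fun φ => (show CcSection I F E from φ)
      map_add' := fun _ _ => rfl
      map_smul' := fun _ _ => rfl } 1 fun φ => by
    rw [one_mul]
    refine Real.sqrt_le_sqrt ?_
    change RCLike.re (CcSection.l2Inner g φ φ) ≤ RCLike.re (D.h1Inner g φ φ)
    unfold HermitianConnection.h1Inner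
    rw [_root_.map_add]
    exact le_add_of_nonneg_right (D.dirichletInner_self_nonneg g φ)

/-- The inclusion of `H¹(M, E)` into `L²(M, E)`: the continuous extension to the completions of
the identity of `C_c^∞(M, E)`. -/
def sobolevInclusion (g : RiemMetric I R) (D : HermitianConnection I F E) :
    H1 g D →L[ℂ] L2 F E g :=
  (sobolevInclusionPre g D).completion

end Hermitian

end

/-! By Peetre's criterion, an operator is compact if its squared norm is bounded by an arbitrarily
small multiple of the squared norm of the argument plus a multiple of finitely many squared
functionals. The bound concerns an integral of `‖φ‖ ^ 2`, so it can be proved over pieces of the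
smooth stratum and added up. A subset over which it holds is an `IsRellichSet`, and a point of `M`
is good (`IsRellichAt`) if the regular part of some neighborhood is one. As `M` is compact, it
suffices that every point is good.

Points of the smooth stratum are good by the classical Rellich argument. Near such a point finitely
many sections `e i` control norms in `E` (`exists_spanning_sections`). Since the connection is
Hermitian, the gradient of `⟨e i, φ⟩` is bounded by the square root of the energy density `‖φ‖ ^ 2 +
|∇φ|²`. In a convex chart neighborhood, also at the boundary, Poincaré's inequality on small grid
cells (`exists_poincare_cells`) then leaves only the integrals of `⟨e i, φ⟩` over finitely many
cells, which are continuous functionals (`finitelyControlled_inner`).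

Near the vertices of a conical chart there is a direct estimate (`exists_tube_bound`). The metric is
uniformly comparable with `g_B + dr² + r² g_L(b)`, so moving outward along the radii contracts
lengths at most by a constant factor and therefore volume at most by a constant factor. The value of
`‖φ‖ ^ 2` at a point of radius less than `δ` is bounded by an integral of the energy density over a
radial segment of fixed length. Integrating over the tube and exchanging the integrals, each point
is reached only for flow times in an interval of length `δ`, so the mass of `φ` in the tube is at
most a constant times `δ ‖φ‖²`. The rest of a small compact neighborhood of the vertex lies at
radius at least `δ`. Hence a vertex is good as soon as all nearby points off the vertex set are good
(`isRellichAt_vertex`).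

Strata may accumulate on each other, and a conical chart may meet strata with other labels; instead
of an induction on depth, the conclusion uses Baire's theorem. Suppose that the closed set of bad
points is nonempty. It is covered by countably many pieces, indexed by the label and the base
dimension of a chart that has the point as a vertex. One piece is dense in a nonempty relatively
open part of the bad set. Take a point of that piece there, and a chart with this type at it. Bad
points nearby are limits of vertices of charts of the same type, and transition maps between such
charts send vertices to vertices; so all nearby points off the vertex set are good. Then the chosen
point is good too, a contradiction. -/

noncomputable section

/-! ### Compactness from finitely many functionals -/

section Peetre

/-- Peetre's criterion: an operator which is small up to finitely many functionals is compact. -/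
theorem isCompactOperator_of_functionals {X Y : Type*} [SeminormedAddCommGroup X] [NormedSpace ℂ X]
    [NormedAddCommGroup Y] [NormedSpace ℂ Y] [CompleteSpace Y] (T : X →L[ℂ] Y)
    (h : ∀ η > 0, ∃ (s : Finset (X →L[ℂ] ℂ)) (C : ℝ), 0 ≤ C ∧
      ∀ x, ‖T x‖ ^ 2 ≤ η * ‖x‖ ^ 2 + C * ∑ l ∈ s, ‖l x‖ ^ 2) : IsCompactOperator T := by
  refine (isCompactOperator_iff_isCompact_closure_image_ball T.toLinearMap one_pos).2 ?_
  refine TotallyBounded.isCompact_of_isClosed (TotallyBounded.closure ?_) isClosed_closure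
  rw [Metric.totallyBounded_iff]
  intro ε hε
  -- Differences of points of the unit ball have squared norm at most `4`, so this choice makes the
  -- first term at most `ε ^ 2 / 4`. The radius `δ` below does the same for the functionals, because
  -- `(2 * κ + 2) ^ 2 ≥ 4 * κ`.
  obtain ⟨s, C, hC, hs⟩ := h (ε ^ 2 / 16) (by positivity)
  let L : X →L[ℂ] (s → ℂ) := ContinuousLinearMap.pi fun l => l.1
  have hb : TotallyBounded (L '' Metric.ball 0 1) := by
    have : Bornology.IsBounded (L '' Metric.ball 0 1) :=
      (LipschitzWith.isBounded_image L.lipschitz Metric.isBounded_ball)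
    exact this.isCompact_closure.totallyBounded.subset subset_closure
  set κ : ℝ := (C + 1) * (s.card + 1) with hκ
  have hκ0 : 0 < κ := by positivity
  set δ : ℝ := ε / (2 * κ + 2) with hδ
  have hδ0 : 0 < δ := by positivity
  -- The net is taken inside the image of the ball, so its centres lift to points `z y` of the ball,
  -- and the `T (z y)` form the required net for `T`.
  obtain ⟨t, ht, htf, hcov⟩ := totallyBounded_iff_subset.1 hb _ (Metric.dist_mem_uniformity hδ0)
  choose! z hz hzL using fun y (hy : y ∈ t) => ht hy
  refine ⟨(T ∘ z) '' t, htf.image _, ?_⟩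
  rintro _ ⟨x, hx, rfl⟩
  obtain ⟨y, hy, hxy⟩ := mem_iUnion₂.1 (hcov (mem_image_of_mem L hx))
  refine mem_iUnion₂.2 ⟨T (z y), mem_image_of_mem _ hy, ?_⟩
  have hxy' : ‖L (x - z y)‖ < δ := by
    rw [map_sub, hzL y hy, ← dist_eq_norm]
    exact hxy
  have hn : ‖x - z y‖ ≤ 2 := by
    have h1 : ‖x‖ < 1 := by simpa using hx
    have h2 : ‖z y‖ < 1 := by simpa using hz y hy
    exact (norm_sub_le _ _).trans (by linarith)
  have hsum : ∑ l ∈ s, ‖l (x - z y)‖ ^ 2 ≤ s.card * δ ^ 2 := by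
    rw [← nsmul_eq_mul]
    refine Finset.sum_le_card_nsmul _ _ _ fun l hl => ?_
    have h1 : ‖L (x - z y) ⟨l, hl⟩‖ ≤ ‖L (x - z y)‖ := norm_le_pi_norm _ _
    have h2 : ‖l (x - z y)‖ ≤ δ := h1.trans hxy'.le
    gcongr
  have hT := hs (x - z y)
  have h3 : C * (s.card * δ ^ 2) ≤ ε ^ 2 / 4 := by
    have h4 : C * s.card ≤ κ := by
      rw [hκ]; nlinarith [(Nat.cast_nonneg s.card : (0 : ℝ) ≤ s.card)]
    have h5 : δ * (2 * κ + 2) = ε := by rw [hδ]; field_simp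
    have h6 : C * (s.card * δ ^ 2) ≤ κ * δ ^ 2 := by
      rw [← mul_assoc]; gcongr
    rw [← h5]
    nlinarith [sq_nonneg δ, mul_nonneg (sq_nonneg δ) (sq_nonneg κ), mul_nonneg (sq_nonneg δ) hκ0.le]
  have h7 : ‖T (x - z y)‖ ^ 2 < ε ^ 2 := by
    have : ‖x - z y‖ ^ 2 ≤ 4 := by nlinarith [norm_nonneg (x - z y)]
    nlinarith [mul_le_mul_of_nonneg_left hsum hC, sq_pos_of_pos hε]
  have h8 := lt_of_pow_lt_pow_left₀ 2 hε.le h7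
  rw [map_sub] at h8
  simpa [dist_eq_norm] using h8

/-- Peetre's criterion for the extension of an operator to the completions. -/
theorem isCompactOperator_completion_of_functionals {X Y : Type*} [SeminormedAddCommGroup X]
    [NormedSpace ℂ X] [SeminormedAddCommGroup Y] [NormedSpace ℂ Y] (T : X →L[ℂ] Y)
    (h : ∀ η > 0, ∃ (s : Finset (X →L[ℂ] ℂ)) (C : ℝ), 0 ≤ C ∧
      ∀ x, ‖T x‖ ^ 2 ≤ η * ‖x‖ ^ 2 + C * ∑ l ∈ s, ‖l x‖ ^ 2) :
    IsCompactOperator T.completion := by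
  classical
  refine isCompactOperator_of_functionals _ fun η hη => ?_
  obtain ⟨s, C, hC, hs⟩ := h η hη
  let J : X →L[ℂ] UniformSpace.Completion X := UniformSpace.Completion.toComplL
  have hJ : DenseRange J := UniformSpace.Completion.denseRange_coe
  have hJ' : IsUniformInducing J := UniformSpace.Completion.isUniformInducing_coe X
  have he : ∀ (l : X →L[ℂ] ℂ) (x : X), l.extend J (x : UniformSpace.Completion X) = l x := fun l x =>
    l.extend_eq hJ hJ' x
  -- Distinct functionals have distinct extensions, so the sum over the image finset is the original
  -- sum. The inequality is closed, hence passes from the dense subspace to the completion.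
  have hinj : Function.Injective fun l : X →L[ℂ] ℂ => l.extend J := fun l l' hll => by
    ext x
    rw [← he, ← he l']
    exact congrArg (fun f => f (x : UniformSpace.Completion X)) hll
  refine ⟨s.image fun l => l.extend J, C, hC, fun x => ?_⟩
  rw [Finset.sum_image hinj.injOn]
  induction x using UniformSpace.Completion.induction_on with
  | hp =>
    refine isClosed_le (by fun_prop) ?_
    fun_prop
  | ih x =>
    simp only [he]
    have : T.completion (x : UniformSpace.Completion X) = (T x : UniformSpace.Completion Y) := by
      simp
    rw [this, UniformSpace.Completion.norm_coe, UniformSpace.Completion.norm_coe]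
    exact hs x

end Peetre

/-! ### Poincaré's inequality on convex sets and grid cells -/

section Poincare

/-- Cauchy–Schwarz against the constant function `1`. -/
theorem sq_lintegral_le {α : Type*} [MeasurableSpace α] (μ : Measure α) {f : α → ENNReal}
    (hf : AEMeasurable f μ) : (∫⁻ x, f x ∂μ) ^ 2 ≤ μ univ * ∫⁻ x, f x ^ 2 ∂μ := by
  have h := ENNReal.lintegral_mul_le_Lp_mul_Lq μ Real.HolderConjugate.two_two
    (aemeasurable_const (b := (1 : ENNReal))) hf
  simp only [Pi.mul_apply, one_mul, ENNReal.one_rpow, lintegral_const] at h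
  have h2 := ENNReal.rpow_le_rpow h (z := 2) (by norm_num)
  rw [ENNReal.mul_rpow_of_nonneg _ _ (by norm_num), ← ENNReal.rpow_mul, ← ENNReal.rpow_mul] at h2
  norm_num at h2
  simpa using h2

theorem lintegral_lintegral_const_mul_lintegral {α β γ : Type*} [MeasurableSpace α]
    [MeasurableSpace β] [MeasurableSpace γ] {μ : Measure α} {ν : Measure β} {ρ : Measure γ}
    [SFinite μ] [SFinite ν] [SFinite ρ] {c : ENNReal} (hc : c ≠ ⊤) {k : α → β → γ → ENNReal}
    (hk : Measurable fun p : α × β × γ => k p.1 p.2.1 p.2.2) :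
    ∫⁻ y, ∫⁻ x, c * ∫⁻ t, k y x t ∂ρ ∂ν ∂μ = c * ∫⁻ t, ∫⁻ y, ∫⁻ x, k y x t ∂ν ∂μ ∂ρ := by
  have hm1 : Measurable fun p : (α × γ) × β => k p.1.1 p.2 p.1.2 :=
    hk.comp (f := fun p : (α × γ) × β => (p.1.1, p.2, p.1.2)) (by fun_prop)
  have hm4 : Measurable fun p : α × γ => ∫⁻ x, k p.1 x p.2 ∂ν := hm1.lintegral_prod_right'
  have e1 : ∀ y, ∫⁻ x, c * ∫⁻ t, k y x t ∂ρ ∂ν = c * ∫⁻ t, ∫⁻ x, k y x t ∂ν ∂ρ := fun y => by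
    rw [lintegral_const_mul' _ _ hc, lintegral_lintegral_swap]
    exact (hk.comp (measurable_prodMk_left (x := y))).aemeasurable
  simp only [e1]
  rw [lintegral_const_mul' _ _ hc, lintegral_lintegral_swap]
  exact hm4.aemeasurable

theorem enorm_add_sq_le {G : Type*} [SeminormedAddCommGroup G] (a b : G) :
    ‖a + b‖ₑ ^ 2 ≤ 2 * ‖a‖ₑ ^ 2 + 2 * ‖b‖ₑ ^ 2 := by
  rw [← ofReal_norm, ← ofReal_norm, ← ofReal_norm, ← ENNReal.ofReal_pow (norm_nonneg _),
    ← ENNReal.ofReal_pow (norm_nonneg _), ← ENNReal.ofReal_pow (norm_nonneg _)]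
  have h2 : (2 : ENNReal) = ENNReal.ofReal 2 := by simp
  rw [h2, ← ENNReal.ofReal_mul (by norm_num), ← ENNReal.ofReal_mul (by norm_num),
    ← ENNReal.ofReal_add (by positivity) (by positivity)]
  refine ENNReal.ofReal_le_ofReal ?_
  have := norm_add_le a b
  nlinarith [sq_nonneg (‖a‖ - ‖b‖), norm_nonneg (a + b), norm_nonneg a, norm_nonneg b]

variable {n : ℕ}

local notation "𝔼" => EuclideanSpace ℝ (Fin n)

theorem lintegral_comp_affine {a : ℝ} (ha : 0 < a) (b : 𝔼) {h : 𝔼 → ENNReal}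
    (hh : Measurable h) :
    ∫⁻ x, h (a • x + b) = ENNReal.ofReal (a ^ n)⁻¹ * ∫⁻ x, h x := by
  have h1 : ∫⁻ x, h (a • x + b) = ∫⁻ z, h (z + b) ∂(Measure.map (fun x : 𝔼 => a • x) volume) := by
    rw [lintegral_map (by fun_prop) (by fun_prop)]
  rw [h1, Measure.map_addHaar_smul _ ha.ne', lintegral_smul_measure,
    lintegral_add_right_eq_self h b]
  simp [abs_of_pos ha]

/-- Contraction towards `y` keeps the convex set `s` inside itself and scales Lebesgue measure by
`(1 - t) ^ n`. This is at least `2⁻ⁿ` exactly because `t` stays in the first half of the segment. -/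
theorem setLIntegral_lineMap_le {s : Set 𝔼} (hs : MeasurableSet s) (hc : Convex ℝ s)
    {h : 𝔼 → ENNReal} (hh : Measurable h) {y : 𝔼} (hy : y ∈ s) {t : ℝ} (ht : t ∈ Icc (0 : ℝ) (1 / 2)) :
    ∫⁻ x in s, h (AffineMap.lineMap x y t) ≤ 2 ^ n * ∫⁻ x in s, h x := by
  have ha : 0 < 1 - t := by linarith [ht.2]
  rw [← lintegral_indicator hs, ← lintegral_indicator hs]
  calc ∫⁻ x, s.indicator (fun x => h (AffineMap.lineMap x y t)) x
      ≤ ∫⁻ x, s.indicator h ((1 - t) • x + t • y) := by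
        refine lintegral_mono fun x => ?_
        by_cases hx : x ∈ s
        · have : (1 - t) • x + t • y ∈ s := hc hx hy ha.le ht.1 (by ring)
          rw [indicator_of_mem hx, indicator_of_mem this, AffineMap.lineMap_apply_module]
        · rw [indicator_of_notMem hx]; exact zero_le
    _ = ENNReal.ofReal ((1 - t) ^ n)⁻¹ * ∫⁻ x, s.indicator h x :=
        lintegral_comp_affine ha _ (hh.indicator hs)
    _ ≤ _ := by
        gcongr
        have : ((1 - t) ^ n)⁻¹ ≤ 2 ^ n := by
          rw [← inv_pow]
          refine pow_le_pow_left₀ (by positivity) ?_ n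
          rw [inv_le_comm₀ ha (by norm_num)]
          linarith [ht.2]
        refine (ENNReal.ofReal_le_ofReal this).trans ?_
        rw [ENNReal.ofReal_pow (by norm_num)]
        simp

/-- In the second half of the segment the contraction towards `y` degenerates. There the roles of
`x` and `y` are exchanged, and the point is contracted towards `x` with parameter `1 - t ≤ 1 / 2`.
-/
theorem lintegral_lintegral_lineMap_le {s : Set 𝔼} (hs : MeasurableSet s) (hc : Convex ℝ s)
    {h : 𝔼 → ENNReal} (hh : Measurable h) {t : ℝ} (ht : t ∈ Icc (0 : ℝ) 1) :
    ∫⁻ y in s, ∫⁻ x in s, h (AffineMap.lineMap x y t) ≤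
      volume s * (2 ^ n * ∫⁻ x in s, h x) := by
  have key : ∀ t ∈ Icc (0 : ℝ) (1 / 2), ∫⁻ y in s, ∫⁻ x in s, h (AffineMap.lineMap x y t) ≤
      volume s * (2 ^ n * ∫⁻ x in s, h x) := fun t ht => by
    refine (setLIntegral_mono' hs fun y hy => setLIntegral_lineMap_le hs hc hh hy ht).trans ?_
    rw [setLIntegral_const, mul_comm]
  rcases le_total t (1 / 2) with h2 | h2
  · exact key t ⟨ht.1, h2⟩
  · rw [lintegral_lintegral_swap]
    · have h3 : ∀ x y : 𝔼, AffineMap.lineMap x y t = AffineMap.lineMap y x (1 - t) := fun x y =>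
        (AffineMap.lineMap_apply_one_sub y x t).symm
      simp only [h3]
      exact key (1 - t) ⟨by linarith [ht.2], by linarith⟩
    · refine Measurable.aemeasurable (hh.comp ?_)
      simp only [AffineMap.lineMap_apply_module]
      fun_prop

/-- The difference of two values of a function, estimated along the segment. -/
theorem enorm_sub_sq_le_lintegral_lineMap {Q : Set 𝔼} (hc : Convex ℝ Q) {u : 𝔼 → ℂ} {W : 𝔼 → ℝ}
    (hW : ContinuousOn W Q)
    (hu : ∀ x ∈ Q, ∃ u' : 𝔼 →L[ℝ] ℂ, HasFDerivWithinAt u u' Q x ∧ ‖u'‖ ≤ W x)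
    {x y : 𝔼} (hx : x ∈ Q) (hy : y ∈ Q) :
    ‖u y - u x‖ₑ ^ 2 ≤ ‖y - x‖ₑ ^ 2 *
      ∫⁻ t in Icc (0 : ℝ) 1, ENNReal.ofReal (W (AffineMap.lineMap x y t)) ^ 2 := by
  have hmem : ∀ t ∈ Icc (0 : ℝ) 1, AffineMap.lineMap x y t ∈ Q := fun t ht =>
    hc.lineMap_mem hx hy ht
  have hd : ∀ t ∈ Icc (0 : ℝ) 1, ∃ d : ℂ, HasDerivWithinAt
      (fun t => u (AffineMap.lineMap x y t)) d (Icc 0 1) t ∧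
      ‖d‖ ≤ ‖y - x‖ * W (AffineMap.lineMap x y t) := fun t ht => by
    obtain ⟨u', hu', hn⟩ := hu _ (hmem t ht)
    refine ⟨u' (y - x), ?_, ?_⟩
    · exact hu'.comp_hasDerivWithinAt t (AffineMap.hasDerivWithinAt_lineMap) hmem
    · rw [mul_comm]
      exact (u'.le_opNorm _).trans (by gcongr)
  -- At interior parameters the derivative within `[0, 1]` is a genuine derivative, even if the
  -- segment runs in the boundary of `Q`.
  have hdo : ∀ t ∈ Ioo (0 : ℝ) 1, ∃ d : ℂ, HasDerivAt
      (fun t => u (AffineMap.lineMap x y t)) d t ∧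
      ‖d‖ ≤ ‖y - x‖ * W (AffineMap.lineMap x y t) := fun t ht => by
    obtain ⟨d, h1, h2⟩ := hd t ⟨ht.1.le, ht.2.le⟩
    exact ⟨d, h1.hasDerivAt (Icc_mem_nhds ht.1 ht.2), h2⟩
  have hWc : ContinuousOn (fun t : ℝ => ‖y - x‖ * W (AffineMap.lineMap x y t)) (Icc 0 1) :=
    continuousOn_const.mul (hW.comp (by fun_prop) hmem)
  have h1 := norm_sub_le_integral_of_norm_deriv_le_of_le (f := fun t => u (AffineMap.lineMap x y t))
    (B := fun t : ℝ => ‖y - x‖ * W (AffineMap.lineMap x y t)) zero_le_one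
    (fun t ht => (hd t ht).choose_spec.1.continuousWithinAt)
    (fun t ht => (hdo t ht).choose_spec.1.differentiableAt.differentiableWithinAt)
    (Eventually.of_forall fun t ht => by
      rw [(hdo t ht).choose_spec.1.deriv]
      exact (hdo t ht).choose_spec.2)
    (by rw [← uIcc_of_le (zero_le_one (α := ℝ))] at hWc; exact hWc.intervalIntegrable)
  simp only [AffineMap.lineMap_apply_one, AffineMap.lineMap_apply_zero] at h1
  rw [intervalIntegral.integral_of_le zero_le_one, ← integral_Icc_eq_integral_Ioc] at h1
  have hm : AEMeasurable (fun t : ℝ => ENNReal.ofReal (‖y - x‖ * W (AffineMap.lineMap x y t)))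
      (volume.restrict (Icc 0 1)) := (hWc.aemeasurable measurableSet_Icc).ennreal_ofReal
  have h2 : ‖u y - u x‖ₑ ≤
      ∫⁻ t in Icc (0 : ℝ) 1, ENNReal.ofReal (‖y - x‖ * W (AffineMap.lineMap x y t)) := by
    rw [← ofReal_norm]
    refine (ENNReal.ofReal_le_ofReal h1).trans ?_
    rw [ofReal_integral_eq_lintegral_ofReal]
    · exact hWc.integrableOn_Icc
    · refine (ae_restrict_iff' measurableSet_Icc).2 (Eventually.of_forall fun t ht => ?_)
      obtain ⟨u', -, hn⟩ := hu _ (hmem t ht)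
      exact mul_nonneg (norm_nonneg _) ((norm_nonneg _).trans hn)
  -- Cauchy–Schwarz on `[0, 1]`, whose total mass is one.
  refine (pow_le_pow_left₀ zero_le h2 2).trans ((sq_lintegral_le _ hm).trans ?_)
  simp only [ENNReal.ofReal_mul (norm_nonneg (y - x)), mul_pow, ofReal_norm]
  rw [lintegral_const_mul' _ _ (by simp)]
  simp

/-- Poincaré's inequality on a convex set. -/
theorem lintegral_enorm_sq_le_of_convex {s : Set 𝔼} (hs : MeasurableSet s) (hc : Convex ℝ s)
    {δ : ENNReal} (hδ : ∀ x ∈ s, ∀ y ∈ s, ‖y - x‖ₑ ≤ δ) (hδfin : δ ≠ ⊤)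
    (hfin : volume s ≠ ⊤) {u : 𝔼 → ℂ} {W : 𝔼 → ℝ} (hW : ContinuousOn W s) (hui : IntegrableOn u s)
    (hu : ∀ x ∈ s, ∃ u' : 𝔼 →L[ℝ] ℂ, HasFDerivWithinAt u u' s x ∧ ‖u'‖ ≤ W x) :
    ∫⁻ x in s, ‖u x‖ₑ ^ 2 ≤ 2 * δ ^ 2 * 2 ^ n * (∫⁻ x in s, ENNReal.ofReal (W x) ^ 2) +
      2 * (volume s)⁻¹ * ‖∫ x in s, u x‖ₑ ^ 2 := by
  classical
  -- In the null case the factor `(volume s)⁻¹` is infinite, but the left side vanishes.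
  rcases eq_or_ne (volume s) 0 with h0 | h0
  · rw [Measure.restrict_zero_set h0]; simp
  set V := volume s
  have huc : ContinuousOn u s := fun x hx => (hu x hx).choose_spec.1.continuousWithinAt
  -- `W` is controlled only on `s`. Extending its square by zero gives a globally measurable
  -- function, as Tonelli and the affine substitutions need.
  set h : 𝔼 → ENNReal := s.piecewise (fun x => ENNReal.ofReal (W x) ^ 2) 0 with hh
  have hhm : Measurable h := by
    refine ContinuousOn.measurable_piecewise ?_ (by fun_prop) hs
    exact (ENNReal.continuous_pow 2).comp_continuousOn
      (ENNReal.continuous_ofReal.comp_continuousOn hW)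
  have hhs : ∀ x ∈ s, h x = ENNReal.ofReal (W x) ^ 2 := fun x hx => by rw [hh, piecewise_eq_of_mem _ _ _ hx]
  have hum : Measurable (s.piecewise u 0) := huc.measurable_piecewise (by fun_prop) hs
  -- the double integral
  have hdouble : ∫⁻ y in s, ∫⁻ x in s, ‖u y - u x‖ₑ ^ 2 ≤
      δ ^ 2 * (V * (2 ^ n * ∫⁻ x in s, h x)) := by
    calc ∫⁻ y in s, ∫⁻ x in s, ‖u y - u x‖ₑ ^ 2
        ≤ ∫⁻ y in s, ∫⁻ x in s, δ ^ 2 * ∫⁻ t in Icc (0 : ℝ) 1, h (AffineMap.lineMap x y t) := by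
          refine setLIntegral_mono' hs fun y hy => setLIntegral_mono' hs fun x hx => ?_
          refine (enorm_sub_sq_le_lintegral_lineMap hc hW hu hx hy).trans ?_
          gcongr ?_ ^ 2 * ?_
          · exact hδ x hx y hy
          · refine le_of_eq (setLIntegral_congr_fun measurableSet_Icc fun t ht => ?_)
            exact (hhs _ (hc.lineMap_mem hx hy ht)).symm
      _ = δ ^ 2 * ∫⁻ t in Icc (0 : ℝ) 1, ∫⁻ y in s, ∫⁻ x in s, h (AffineMap.lineMap x y t) := by
          refine lintegral_lintegral_const_mul_lintegral (ENNReal.pow_ne_top hδfin) ?_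
          refine hhm.comp (g := h) (f := fun p : 𝔼 × 𝔼 × ℝ => AffineMap.lineMap p.2.1 p.1 p.2.2) ?_
          simp only [AffineMap.lineMap_apply_module]
          fun_prop
      _ ≤ δ ^ 2 * ∫⁻ t in Icc (0 : ℝ) 1, V * (2 ^ n * ∫⁻ x in s, h x) := by
          gcongr δ ^ 2 * ?_
          exact setLIntegral_mono' measurableSet_Icc fun t ht =>
            lintegral_lintegral_lineMap_le hs hc hhm ht
      _ = _ := by simp
  -- Writing `V u(y) = ∫ (u(y) - u(x)) dx + ∫ u` keeps the mean as a separate term. It is this term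
  -- that becomes a functional later.
  have hpt : ∀ y ∈ s, V ^ 2 * ‖u y‖ₑ ^ 2 ≤
      2 * (V * ∫⁻ x in s, ‖u y - u x‖ₑ ^ 2) + 2 * ‖∫ x in s, u x‖ₑ ^ 2 := fun y hy => by
    have hc' : IntegrableOn (fun _ => u y) s := integrableOn_const hfin
    have e : (V.toReal : ℝ) • u y = (∫ x in s, (u y - u x)) + ∫ x in s, u x := by
      rw [integral_sub hc' hui, setIntegral_const]
      simp [Measure.real, V]
    have e2 : V ^ 2 * ‖u y‖ₑ ^ 2 = ‖(V.toReal : ℝ) • u y‖ₑ ^ 2 := by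
      rw [enorm_smul, mul_pow, Real.enorm_of_nonneg ENNReal.toReal_nonneg,
        ENNReal.ofReal_toReal hfin]
    rw [e2, e]
    refine (enorm_add_sq_le _ _).trans ?_
    gcongr
    refine (pow_le_pow_left₀ zero_le (enorm_integral_le_lintegral_enorm _) 2).trans ?_
    refine (sq_lintegral_le _ ?_).trans (by simp [V])
    exact (hc'.sub hui).aestronglyMeasurable.enorm
  have hint : V ^ 2 * ∫⁻ y in s, ‖u y‖ₑ ^ 2 ≤
      2 * (V * (δ ^ 2 * (V * (2 ^ n * ∫⁻ x in s, h x)))) + 2 * ‖∫ x in s, u x‖ₑ ^ 2 * V := by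
    rw [← lintegral_const_mul' _ _ (by simp [hfin])]
    refine (setLIntegral_mono' hs hpt).trans ?_
    rw [lintegral_add_right _ measurable_const, lintegral_const_mul' _ _ (by simp),
      lintegral_const_mul' _ _ hfin, setLIntegral_const]
    gcongr
  have hhint : ∫⁻ x in s, h x = ∫⁻ x in s, ENNReal.ofReal (W x) ^ 2 :=
    setLIntegral_congr_fun hs hhs
  rw [hhint] at hint
  have hV : V⁻¹ ^ 2 * V ^ 2 = 1 := by
    rw [← mul_pow, ENNReal.inv_mul_cancel h0 hfin, one_pow]
  calc ∫⁻ y in s, ‖u y‖ₑ ^ 2 = V⁻¹ ^ 2 * (V ^ 2 * ∫⁻ y in s, ‖u y‖ₑ ^ 2) := by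
        rw [← mul_assoc, hV, one_mul]
    _ ≤ V⁻¹ ^ 2 * (2 * (V * (δ ^ 2 * (V * (2 ^ n * ∫⁻ x in s, ENNReal.ofReal (W x) ^ 2)))) +
        2 * ‖∫ x in s, u x‖ₑ ^ 2 * V) := by gcongr
    _ = (V⁻¹ ^ 2 * V ^ 2) * (2 * δ ^ 2 * 2 ^ n * ∫⁻ x in s, ENNReal.ofReal (W x) ^ 2) +
        (V⁻¹ * V) * (2 * V⁻¹ * ‖∫ x in s, u x‖ₑ ^ 2) := by ring
    _ = _ := by rw [hV, ENNReal.inv_mul_cancel h0 hfin, one_mul, one_mul]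

/-- The grid cell of side `1 / N` containing `y`. -/
def gridCell (N : ℕ) (y : 𝔼) : Fin n → ℤ := fun i => ⌊N * y i⌋

theorem measurable_gridCell (N : ℕ) : Measurable (gridCell (n := n) N) := by
  refine measurable_pi_lambda _ fun i => Int.measurable_floor.comp ?_
  fun_prop

theorem convex_gridCell (N : ℕ) (k : Fin n → ℤ) : Convex ℝ (gridCell (n := n) N ⁻¹' {k}) := by
  have h : gridCell (n := n) N ⁻¹' {k} =
      ⋂ i, (fun y : 𝔼 => (N : ℝ) * y i) ⁻¹' Ico (k i : ℝ) (k i + 1) := by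
    ext y
    simp [gridCell, funext_iff, Int.floor_eq_iff]
  rw [h]
  refine convex_iInter fun i => (convex_Ico _ _).is_linear_preimage ⟨?_, ?_⟩
  · intro x y; simp [mul_add]
  · intro c x; simp; ring

/-- Each of the `n` coordinates differs by less than `1 / N`. -/
theorem enorm_sub_le_of_gridCell {N : ℕ} (hN : 0 < N) {x y : 𝔼}
    (h : gridCell N x = gridCell N y) : ‖y - x‖ₑ ≤ ENNReal.ofReal (√n / N) := by
  rw [← ofReal_norm]
  refine ENNReal.ofReal_le_ofReal ?_
  have hN' : (0 : ℝ) < N := by exact_mod_cast hN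
  rw [EuclideanSpace.norm_eq, ← Real.sqrt_sq hN'.le, ← Real.sqrt_div (by positivity)]
  refine Real.sqrt_le_sqrt ?_
  have : ∀ i ∈ Finset.univ, ‖(y - x) i‖ ^ 2 ≤ 1 / (N : ℝ) ^ 2 := fun i _ => by
    have h1 := Int.abs_sub_lt_one_of_floor_eq_floor (congrFun h i)
    rw [← mul_sub, abs_mul, abs_of_pos hN', abs_sub_comm] at h1
    rw [PiLp.sub_apply, Real.norm_eq_abs, le_div_iff₀ (by positivity), ← mul_pow, mul_comm]
    exact pow_le_one₀ (by positivity) h1.le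
  refine (Finset.sum_le_card_nsmul _ _ _ this).trans ?_
  simp [div_eq_mul_inv]

/-- Poincaré's inequality on a compact convex set, up to the integrals over finitely many cells. -/
theorem exists_poincare_cells {Q : Set 𝔼} (hQ : IsCompact Q) (hc : Convex ℝ Q) {η : ℝ}
    (hη : 0 < η) : ∃ (K : Finset (Fin n → ℤ)) (S : (Fin n → ℤ) → Set 𝔼) (C : ℝ), 0 ≤ C ∧
      (∀ k, S k ⊆ Q ∧ MeasurableSet (S k)) ∧ ∀ (u : 𝔼 → ℂ) (W : 𝔼 → ℝ), ContinuousOn W Q →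
      (∀ x ∈ Q, ∃ u' : 𝔼 →L[ℝ] ℂ, HasFDerivWithinAt u u' Q x ∧ ‖u'‖ ≤ W x) →
      ∫⁻ x in Q, ‖u x‖ₑ ^ 2 ≤ ENNReal.ofReal η * (∫⁻ x in Q, ENNReal.ofReal (W x) ^ 2) +
        ENNReal.ofReal C * ∑ k ∈ K, ‖∫ x in S k, u x‖ₑ ^ 2 := by
  -- With cells of diameter at most `√n / N`, the Poincaré constant is `2 * (n / N ^ 2) * 2 ^ n ≤ 2
  -- * n * 2 ^ n / N`, which this `N` makes smaller than `η`.
  obtain ⟨N, hN⟩ := exists_nat_gt (2 * n * 2 ^ n / η)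
  have hN0 : 0 < N := by
    have : (0 : ℝ) < N := lt_of_le_of_lt (by positivity) hN
    exact_mod_cast this
  have hN1 : (1 : ℝ) ≤ N := by exact_mod_cast hN0
  obtain ⟨R, hR⟩ := hQ.isBounded.exists_norm_le
  have hKf : (gridCell N '' Q).Finite := by
    refine (finite_Icc (fun _ : Fin n => ⌊-(N * R)⌋) (fun _ => ⌊N * R⌋)).subset ?_
    rintro _ ⟨y, hy, rfl⟩
    have hyi : ∀ i, |y i| ≤ R := fun i => (PiLp.norm_apply_le y i).trans (hR y hy)
    refine ⟨fun i => Int.floor_le_floor ?_, fun i => Int.floor_le_floor ?_⟩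
    · nlinarith [neg_abs_le (y i), hyi i]
    · nlinarith [le_abs_self (y i), hyi i]
  set S : (Fin n → ℤ) → Set 𝔼 := fun k => Q ∩ gridCell N ⁻¹' {k} with hS
  have hSm : ∀ k, MeasurableSet (S k) := fun k =>
    hQ.measurableSet.inter (measurable_gridCell N (measurableSet_singleton k))
  have hSQ : ∀ k, S k ⊆ Q := fun k => inter_subset_left
  set K := hKf.toFinset
  -- The sum dominates the constant of each cell. For a null cell `toReal` turns an infinite
  -- constant into `0`, which is harmless since the integrals over it vanish.
  set C : ℝ := ∑ k ∈ K, (2 * (volume (S k))⁻¹).toReal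
  refine ⟨K, S, C, Finset.sum_nonneg fun k _ => ENNReal.toReal_nonneg,
    fun k => ⟨hSQ k, hSm k⟩, fun u W hW hu => ?_⟩
  have hQu : Q = ⋃ k ∈ K, S k := by
    ext y
    simp only [mem_iUnion, hS, K]
    refine ⟨fun hy => ⟨gridCell N y, by simpa using ⟨y, hy, rfl⟩, hy, rfl⟩, ?_⟩
    rintro ⟨k, -, hy, -⟩
    exact hy
  have hdisj : (K : Set (Fin n → ℤ)).PairwiseDisjoint S := by
    intro k _ l _ hkl
    refine Set.disjoint_left.2 ?_
    rintro y ⟨-, hk⟩ ⟨-, hl⟩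
    exact hkl (hk.symm.trans hl)
  have huc : ContinuousOn u Q := fun x hx => (hu x hx).choose_spec.1.continuousWithinAt
  have hui : IntegrableOn u Q := huc.integrableOn_compact hQ
  have hcell : ∀ k ∈ K, ∫⁻ x in S k, ‖u x‖ₑ ^ 2 ≤
      ENNReal.ofReal η * (∫⁻ x in S k, ENNReal.ofReal (W x) ^ 2) +
        ENNReal.ofReal C * ‖∫ x in S k, u x‖ₑ ^ 2 := fun k hk => by
    have hfin : volume (S k) ≠ ⊤ :=
      ((measure_mono (hSQ k)).trans_lt hQ.measure_lt_top).ne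
    refine (lintegral_enorm_sq_le_of_convex (hSm k) (hc.inter (convex_gridCell N k))
      (δ := ENNReal.ofReal (√n / N)) (fun x hx y hy => enorm_sub_le_of_gridCell hN0
      ((hx.2 : gridCell N x = k).trans hy.2.symm)) ENNReal.ofReal_ne_top hfin (hW.mono (hSQ k))
      (hui.mono_set (hSQ k)) fun x hx => ?_).trans ?_
    · obtain ⟨u', h1, h2⟩ := hu x (hSQ k hx)
      exact ⟨u', h1.mono (hSQ k), h2⟩
    refine add_le_add ?_ ?_
    · gcongr
      rw [← ENNReal.ofReal_pow (by positivity), div_pow, Real.sq_sqrt (by positivity)]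
      have h2 : (2 : ENNReal) = ENNReal.ofReal 2 := by simp
      rw [h2, ← ENNReal.ofReal_mul (by norm_num), ← ENNReal.ofReal_pow (by norm_num),
        ← ENNReal.ofReal_mul (by positivity)]
      refine ENNReal.ofReal_le_ofReal ?_
      rw [div_lt_iff₀ hη] at hN
      have h3 : (n : ℝ) / N ^ 2 ≤ n / N := by
        gcongr
        nlinarith
      calc 2 * ((n : ℝ) / N ^ 2) * 2 ^ n ≤ 2 * (n / N) * 2 ^ n := by gcongr
        _ = 2 * n * 2 ^ n / N := by ring
        _ ≤ η := by
          rw [div_le_iff₀ (by linarith)]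
          linarith
    · rcases eq_or_ne (volume (S k)) 0 with h0 | h0
      · rw [Measure.restrict_zero_set h0]; simp
      · gcongr
        rw [← ENNReal.ofReal_toReal (a := 2 * (volume (S k))⁻¹)
          (ENNReal.mul_ne_top (by simp) (ENNReal.inv_ne_top.2 h0))]
        exact ENNReal.ofReal_le_ofReal (Finset.single_le_sum
          (f := fun k => (2 * (volume (S k))⁻¹).toReal)
          (fun k _ => ENNReal.toReal_nonneg) hk)
  rw [hQu, lintegral_biUnion_finset hdisj (fun k _ => hSm k),
    lintegral_biUnion_finset hdisj (fun k _ => hSm k), Finset.mul_sum, Finset.mul_sum,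
    ← Finset.sum_add_distrib]
  exact Finset.sum_le_sum hcell

end Poincare

/-! ### Energy density, spanning sections and the two norms -/

section Sections

attribute [local instance] InnerProductSpace.complexToReal

variable {n : ℕ} {H : Type} [TopologicalSpace H]
  {I : ModelWithCorners ℝ (EuclideanSpace ℝ (Fin n)) H}
  {R : Type*} [TopologicalSpace R] [ChartedSpace H R] [IsManifold I ∞ R]
  {F : Type*} [NormedAddCommGroup F] [NormedSpace ℂ F] [FiniteDimensional ℂ F]
  {E : R → Type*} [TopologicalSpace (TotalSpace F E)] [∀ p, NormedAddCommGroup (E p)]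
  [∀ p, InnerProductSpace ℂ (E p)] [FiberBundle F E] [IsHermitianBundle I F E]

theorem metric_nonneg (g : RiemMetric I R) (p : R) (v : TangentSpace I p) : 0 ≤ g.inner p v v := by
  rcases eq_or_ne v 0 with rfl | h
  · simp
  · exact (g.pos p v h).le

/-- The operator norm of an element of `T*_p ⊗ E_p` is at most its Hilbert–Schmidt norm. -/
theorem norm_sq_apply_le_gradInner (g : RiemMetric I R) (p : R) (T : TangentSpace I p →L[ℝ] E p)
    (v : TangentSpace I p) :
    ‖T v‖ ^ 2 ≤ g.inner p v v * RCLike.re (gradInner g p T T) := by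
  let _ : RiemannianBundle (fun p : R => TangentSpace I p) := ⟨g.toRiemannianMetric⟩
  let _ : FiniteDimensional ℝ (TangentSpace I p) :=
    inferInstanceAs (FiniteDimensional ℝ (EuclideanSpace ℝ (Fin n)))
  set b := stdOrthonormalBasis ℝ (TangentSpace I p) with hb
  have h1 : g.inner p v v = ∑ i, ‖b.repr v i‖ ^ 2 := by
    have : g.inner p v v = inner ℝ v v := rfl
    rw [this, real_inner_self_eq_norm_sq, ← b.repr.norm_map, EuclideanSpace.norm_sq_eq]
  have h2 : RCLike.re (gradInner g p T T) = ∑ i, ‖T (b i)‖ ^ 2 := by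
    simp only [gradInner, map_sum]
    exact Finset.sum_congr rfl fun i _ => by rw [inner_self_eq_norm_sq]
  have h3 : ‖T v‖ ≤ ∑ i, ‖b.repr v i‖ * ‖T (b i)‖ := by
    conv_lhs => rw [← b.sum_repr v, map_sum]
    refine (norm_sum_le _ _).trans (Finset.sum_le_sum fun i _ => ?_)
    rw [map_smul, norm_smul]
  rw [h1, h2]
  exact (pow_le_pow_left₀ (norm_nonneg _) h3 2).trans (Finset.sum_mul_sq_le_sq_mul_sq _ _ _)

/-- The pointwise `H¹`-density `|φ|² + |∇φ|²`. -/
def energyDensity (g : RiemMetric I R) (D : HermitianConnection I F E) (φ : CcSection I F E)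
    (p : R) : ℝ :=
  ‖(φ : ∀ p, E p) p‖ ^ 2 + RCLike.re (gradInner g p (D.toFun φ p) (D.toFun φ p))

variable (g : RiemMetric I R) (D : HermitianConnection I F E)

theorem norm_sq_le_energyDensity (φ : CcSection I F E) (p : R) :
    ‖(φ : ∀ p, E p) p‖ ^ 2 ≤ energyDensity g D φ p :=
  le_add_of_nonneg_right (gradInner_self_nonneg g p _)

theorem energyDensity_nonneg (φ : CcSection I F E) (p : R) : 0 ≤ energyDensity g D φ p :=
  (sq_nonneg _).trans (norm_sq_le_energyDensity g D φ p)

theorem norm_sq_connection_le (φ : CcSection I F E) (p : R) (v : TangentSpace I p) :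
    ‖D.toFun φ p v‖ ^ 2 ≤ g.inner p v v * energyDensity g D φ p :=
  (norm_sq_apply_le_gradInner g p _ v).trans
    (mul_le_mul_of_nonneg_left (le_add_of_nonneg_left (sq_nonneg _)) (metric_nonneg g p v))

theorem continuous_norm_sq (φ : CcSection I F E) :
    Continuous fun p => ‖(φ : ∀ p, E p) p‖ ^ 2 := by
  refine (RCLike.continuous_re.comp (CcSection.continuous_inner φ φ)).congr fun p => ?_
  exact inner_self_eq_norm_sq (𝕜 := ℂ) _

theorem continuous_energyDensity (φ : CcSection I F E) : Continuous (energyDensity g D φ) :=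
  (continuous_norm_sq φ).add (RCLike.continuous_re.comp (D.continuous_gradInner g φ φ))

theorem CcSection.mdifferentiableAt (φ : CcSection I F E) (p : R) :
    MDifferentiableAt I (I.prod 𝓘(ℝ, F))
      (fun q => (⟨q, (φ : ∀ p, E p) q⟩ : TotalSpace F E)) p :=
  (φ.2.1 p).mdifferentiableAt (by simp)

/-- Compatibility of the connection with the metric splits the derivative into `⟨∇e, φ⟩ + ⟨e, ∇φ⟩`.
Both summands satisfy the same bound, and `(x + y)² ≤ 2 x² + 2 y²` gives the factor `4`. This
reduces estimates for sections to estimates for scalar functions. -/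
theorem norm_mfderiv_inner_le (e φ : CcSection I F E) (p : R) (v : TangentSpace I p) {d : ℂ}
    (hd : mfderiv I 𝓘(ℝ, ℂ)
      (fun q => (inner ℂ ((e : ∀ p, E p) q) ((φ : ∀ p, E p) q) : ℂ)) p v = d) :
    ‖d‖ ^ 2 ≤ 4 * g.inner p v v * energyDensity g D e p * energyDensity g D φ p := by
  rw [D.metric _ _ p (CcSection.mdifferentiableAt e p) (CcSection.mdifferentiableAt φ p) v] at hd
  rw [← hd]
  set G := g.inner p v v
  have hG : 0 ≤ G := metric_nonneg g p v
  set a := energyDensity g D e p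
  set b := energyDensity g D φ p
  have h1 := norm_inner_le_norm (𝕜 := ℂ) (D.toFun (e : ∀ p, E p) p v) ((φ : ∀ p, E p) p)
  have h2 := norm_inner_le_norm (𝕜 := ℂ) ((e : ∀ p, E p) p) (D.toFun (φ : ∀ p, E p) p v)
  have h3 := norm_sq_connection_le g D e p v
  have h4 := norm_sq_connection_le g D φ p v
  have h5 : ‖(e : ∀ p, E p) p‖ ^ 2 ≤ a := norm_sq_le_energyDensity g D e p
  have h6 : ‖(φ : ∀ p, E p) p‖ ^ 2 ≤ b := norm_sq_le_energyDensity g D φ p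
  have ha : 0 ≤ a := energyDensity_nonneg g D e p
  have hb : 0 ≤ b := energyDensity_nonneg g D φ p
  set x := inner ℂ (D.toFun (e : ∀ p, E p) p v) ((φ : ∀ p, E p) p)
  set y := inner ℂ ((e : ∀ p, E p) p) (D.toFun (φ : ∀ p, E p) p v)
  have h7 : ‖x‖ ^ 2 ≤ G * a * b := by
    refine (pow_le_pow_left₀ (norm_nonneg _) h1 2).trans ?_
    rw [mul_pow]
    exact mul_le_mul h3 h6 (sq_nonneg _) (mul_nonneg hG ha)
  have h8 : ‖y‖ ^ 2 ≤ G * a * b := by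
    refine (pow_le_pow_left₀ (norm_nonneg _) h2 2).trans ?_
    rw [mul_pow]
    exact (mul_le_mul h5 h4 (sq_nonneg _) ha).trans_eq (by ring)
  have h9 := pow_le_pow_left₀ (norm_nonneg _) (norm_add_le x y) 2
  calc _ ≤ (‖x‖ + ‖y‖) ^ 2 := h9
    _ ≤ 4 * G * a * b := by nlinarith [sq_nonneg (‖x‖ - ‖y‖)]

/-- Near every point there are finitely many global sections that control the norm. -/
theorem exists_spanning_sections [T2Space R] (p₀ : R) :
    ∃ (N : ℕ) (e : Fin N → CcSection I F E) (C : ℝ), 0 ≤ C ∧ ∀ᶠ p in 𝓝 p₀, ∀ v : E p,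
      ‖v‖ ^ 2 ≤ C * ∑ i, ‖(inner ℂ ((e i : ∀ p, E p) p) v : ℂ)‖ ^ 2 := by
  have : FiniteDimensional ℝ F := FiniteDimensional.complexToReal F
  have : IsContinuousRiemannianBundle F E := by
    obtain ⟨k, hk, hk'⟩ :=
      (IsHermitianBundle.smooth_metric (I := I) (F := F) (E := E)).exists_contMDiff
    exact ⟨k, hk.continuous, hk'⟩
  let b := Module.finBasis ℝ F
  let τ := trivializationAt F E p₀
  have hs : τ.baseSet ∈ 𝓝 p₀ :=
    τ.open_baseSet.mem_nhds (FiberBundle.mem_baseSet_trivializationAt' p₀)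
  -- Multiplying the local frame by a bump function supported in the trivializing set gives elements
  -- of `C_c^∞` that coincide with the frame near `p₀`, where the bump is `1`.
  obtain ⟨χ, -, hχ⟩ := (SmoothBumpFunction.nhds_basis_tsupport (I := I) p₀).mem_iff.1 hs
  have hsm : ∀ i, ContMDiff I (I.prod 𝓘(ℝ, F)) ∞
      (fun p => (⟨p, ((χ : R → ℝ) • τ.localFrame b i) p⟩ : TotalSpace F E)) := fun i =>
    ContMDiffOn.smul_section_of_tsupport χ.contMDiff.contMDiffOn τ.open_baseSet hχ
      (τ.contMDiffOn_localFrame_baseSet ∞ b i)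
  have hcp : ∀ i, IsCompact (closure {p | ((χ : R → ℝ) • τ.localFrame b i) p ≠ 0}) := fun i => by
    refine χ.hasCompactSupport.of_isClosed_subset isClosed_closure (closure_mono fun p hp h => ?_)
    exact hp (by simp [h])
  let e : Fin (Module.finrank ℝ F) → CcSection I F E := fun i => ⟨_, hsm i, hcp i⟩
  obtain ⟨C, hC0, hC⟩ := eventually_norm_trivializationAt_lt F E p₀
  let B : F →L[ℝ] (Fin (Module.finrank ℝ F) → ℝ) := b.equivFunL.toContinuousLinearMap
  refine ⟨_, e, (‖B‖ * C) ^ 2 * Module.finrank ℝ F, by positivity, ?_⟩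
  filter_upwards [hC, hs, χ.eventuallyEq_one] with p hp hpb hp1 v
  set c := B (τ.continuousLinearMapAt ℝ p v) with hc
  have hci : ∀ i, |c i| ≤ ‖B‖ * C * ‖v‖ := fun i => by
    refine (norm_le_pi_norm c i).trans ((B.le_opNorm _).trans ?_)
    rw [mul_assoc]
    gcongr
    exact (ContinuousLinearMap.le_opNorm _ _).trans (by gcongr)
  have hei : ∀ i, (e i : ∀ p, E p) p = τ.symm p (b i) := fun i => by
    change χ p • τ.localFrame b i p = _
    rw [hp1, Pi.one_apply, one_smul, τ.localFrame_apply_of_mem_baseSet b hpb]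
    simp [Trivialization.basisAt]
  have hv : v = ∑ i, c i • (e i : ∀ p, E p) p := by
    have h1 : τ.symmL ℝ p (τ.continuousLinearMapAt ℝ p v) = v :=
      τ.symmL_continuousLinearMapAt hpb v
    conv_lhs => rw [← h1, ← b.sum_repr (τ.continuousLinearMapAt ℝ p v), map_sum]
    refine Finset.sum_congr rfl fun i _ => ?_
    rw [hei, map_smul, τ.symmL_apply hpb]
    rfl
  -- Pairing `v` with its own expansion avoids inverting a Gram matrix: the coefficients are bounded
  -- by a multiple of `‖v‖`, so one factor `‖v‖` cancels.
  have h2 : ‖v‖ ^ 2 = ∑ i, c i * inner ℝ ((e i : ∀ p, E p) p) v := by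
    rw [← real_inner_self_eq_norm_sq]
    conv_lhs => rw [hv, sum_inner, ← hv]
    simp only [real_inner_smul_left]
  have h3 : ‖v‖ ^ 2 ≤ ∑ i, ‖B‖ * C * ‖v‖ * ‖(inner ℂ ((e i : ∀ p, E p) p) v : ℂ)‖ := by
    rw [h2]
    refine Finset.sum_le_sum fun i _ => ?_
    refine (le_abs_self _).trans ?_
    rw [abs_mul]
    refine mul_le_mul (hci i) ?_ (abs_nonneg _) (by positivity)
    rw [real_inner_eq_re_inner ℂ]
    exact RCLike.abs_re_le_norm _
  rw [← Finset.mul_sum] at h3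
  set S := ∑ i, ‖(inner ℂ ((e i : ∀ p, E p) p) v : ℂ)‖
  have hS : 0 ≤ S := Finset.sum_nonneg fun i _ => norm_nonneg _
  have h4 : ‖v‖ ≤ ‖B‖ * C * S := by
    rcases (norm_nonneg v).eq_or_lt with h0 | h0
    · rw [← h0]; positivity
    · refine le_of_mul_le_mul_left ?_ h0
      nlinarith
  have h5 : S ^ 2 ≤ Module.finrank ℝ F * ∑ i, ‖(inner ℂ ((e i : ∀ p, E p) p) v : ℂ)‖ ^ 2 := by
    have := sq_sum_le_card_mul_sum_sq (s := Finset.univ)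
      (f := fun i => ‖(inner ℂ ((e i : ∀ p, E p) p) v : ℂ)‖)
    simpa using this
  calc ‖v‖ ^ 2 ≤ (‖B‖ * C * S) ^ 2 := by gcongr
    _ = (‖B‖ * C) ^ 2 * S ^ 2 := by ring
    _ ≤ (‖B‖ * C) ^ 2 * (Module.finrank ℝ F * ∑ i, ‖(inner ℂ ((e i : ∀ p, E p) p) v : ℂ)‖ ^ 2) := by gcongr
    _ = _ := by ring

variable [MeasurableSpace R] [BorelSpace R]

theorem integrable_norm_sq (φ : CcSection I F E) :
    Integrable (fun p => ‖(φ : ∀ p, E p) p‖ ^ 2) (riemVolume g) := by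
  refine (CcSection.integrable_inner g φ φ).re.congr (Eventually.of_forall fun p => ?_)
  exact inner_self_eq_norm_sq (𝕜 := ℂ) _

theorem re_l2Inner_self (φ : CcSection I F E) :
    RCLike.re (CcSection.l2Inner g φ φ) = ∫ p, ‖(φ : ∀ p, E p) p‖ ^ 2 ∂(riemVolume g) := by
  rw [CcSection.l2Inner, ← integral_re (CcSection.integrable_inner g φ φ)]
  exact integral_congr_ae (Eventually.of_forall fun p => inner_self_eq_norm_sq (𝕜 := ℂ) _)

theorem norm_sq_L2Pre (φ : L2Pre F E g) :
    ‖φ‖ ^ 2 = ∫ p, ‖((show CcSection I F E from φ) : ∀ p, E p) p‖ ^ 2 ∂(riemVolume g) := by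
  have h : ‖φ‖ = √(RCLike.re (CcSection.l2Inner g φ φ)) := rfl
  rw [h, Real.sq_sqrt (CcSection.l2Inner_self_nonneg g φ)]
  exact re_l2Inner_self g φ

theorem integrable_energyDensity (φ : CcSection I F E) :
    Integrable (energyDensity g D φ) (riemVolume g) :=
  (integrable_norm_sq g φ).add (D.integrable_gradInner g φ φ).re

theorem re_h1Inner_self (φ : CcSection I F E) :
    RCLike.re (D.h1Inner g φ φ) = ∫ p, energyDensity g D φ p ∂(riemVolume g) := by
  rw [HermitianConnection.h1Inner, _root_.map_add, re_l2Inner_self,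
    HermitianConnection.dirichletInner, ← integral_re (D.integrable_gradInner g φ φ),
    ← integral_add (integrable_norm_sq g φ) (D.integrable_gradInner g φ φ).re]
  rfl

theorem norm_sq_H1Pre (φ : H1Pre g D) :
    ‖φ‖ ^ 2 = ∫ p, energyDensity g D (show CcSection I F E from φ) p ∂(riemVolume g) := by
  have h : ‖φ‖ = √(RCLike.re (D.h1Inner g φ φ)) := rfl
  rw [h, Real.sq_sqrt (D.h1Inner_self_nonneg g φ)]
  exact re_h1Inner_self g D φ

theorem lintegral_energyDensity (φ : H1Pre g D) :
    ∫⁻ p, ENNReal.ofReal (energyDensity g D (show CcSection I F E from φ) p) ∂(riemVolume g) =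
      ENNReal.ofReal (‖φ‖ ^ 2) := by
  rw [norm_sq_H1Pre, ofReal_integral_eq_lintegral_ofReal (integrable_energyDensity g D φ)
    (Eventually.of_forall fun p => energyDensity_nonneg g D φ p)]

theorem lintegral_enorm_sq (φ : L2Pre F E g) :
    ∫⁻ p, ‖((show CcSection I F E from φ) : ∀ p, E p) p‖ₑ ^ 2 ∂(riemVolume g) =
      ENNReal.ofReal (‖φ‖ ^ 2) := by
  rw [norm_sq_L2Pre, ofReal_integral_eq_lintegral_ofReal (integrable_norm_sq g φ)
    (Eventually.of_forall fun p => sq_nonneg _)]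
  refine lintegral_congr fun p => ?_
  rw [ENNReal.ofReal_pow (norm_nonneg _), ofReal_norm]

end Sections

/-! ### Calculus of quantities controlled by finitely many functionals -/

section FinitelyControlled

variable {X : Type*} [SeminormedAddCommGroup X] [NormedSpace ℂ X]

/-- A quadratic quantity on a normed space is finitely controlled if, up to an arbitrarily small
multiple of the squared norm, it is bounded by finitely many continuous functionals. -/
def FinitelyControlled (q : X → ENNReal) : Prop :=
  ∀ η > 0, ∃ (s : Finset (X →L[ℂ] ℂ)) (C : ℝ), 0 ≤ C ∧
    ∀ x, q x ≤ ENNReal.ofReal (η * ‖x‖ ^ 2 + C * ∑ l ∈ s, ‖l x‖ ^ 2)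

theorem FinitelyControlled.mono {q q' : X → ENNReal} (h : FinitelyControlled q')
    (hq : ∀ x, q x ≤ q' x) : FinitelyControlled q := fun η hη => by
  obtain ⟨s, C, hC, hs⟩ := h η hη
  exact ⟨s, C, hC, fun x => (hq x).trans (hs x)⟩

theorem FinitelyControlled.zero : FinitelyControlled fun _ : X => (0 : ENNReal) := fun _ _ =>
  ⟨∅, 0, le_rfl, fun _ => zero_le⟩

theorem FinitelyControlled.add {q q' : X → ENNReal} (h : FinitelyControlled q)
    (h' : FinitelyControlled q') : FinitelyControlled fun x => q x + q' x := fun η hη => by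
  classical
  obtain ⟨s, C, hC, hs⟩ := h (η / 2) (half_pos hη)
  obtain ⟨s', C', hC', hs'⟩ := h' (η / 2) (half_pos hη)
  refine ⟨s ∪ s', C + C', add_nonneg hC hC', fun x => (add_le_add (hs x) (hs' x)).trans ?_⟩
  have h1 : ∑ l ∈ s, ‖l x‖ ^ 2 ≤ ∑ l ∈ s ∪ s', ‖l x‖ ^ 2 :=
    Finset.sum_le_sum_of_subset_of_nonneg Finset.subset_union_left fun _ _ _ => sq_nonneg _
  have h2 : ∑ l ∈ s', ‖l x‖ ^ 2 ≤ ∑ l ∈ s ∪ s', ‖l x‖ ^ 2 :=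
    Finset.sum_le_sum_of_subset_of_nonneg Finset.subset_union_right fun _ _ _ => sq_nonneg _
  rw [← ENNReal.ofReal_add (by positivity) (by positivity)]
  refine ENNReal.ofReal_le_ofReal ?_
  nlinarith [mul_le_mul_of_nonneg_left h1 hC, mul_le_mul_of_nonneg_left h2 hC']

theorem FinitelyControlled.sum {ι : Type*} (s : Finset ι) {q : ι → X → ENNReal}
    (h : ∀ i ∈ s, FinitelyControlled (q i)) : FinitelyControlled fun x => ∑ i ∈ s, q i x := by
  classical
  induction s using Finset.induction_on with
  | empty => simpa using! FinitelyControlled.zero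
  | insert i s hi ih =>
    simp only [Finset.sum_insert hi]
    exact (h i (Finset.mem_insert_self i s)).add
      (ih fun j hj => h j (Finset.mem_insert_of_mem hj))

theorem FinitelyControlled.const_mul {q : X → ENNReal} (h : FinitelyControlled q) {c : ℝ}
    (hc : 0 ≤ c) : FinitelyControlled fun x => ENNReal.ofReal c * q x := fun η hη => by
  -- Dividing by `c + 1` rather than `c` covers the case `c = 0`.
  obtain ⟨s, C, hC, hs⟩ := h (η / (c + 1)) (by positivity)
  refine ⟨s, c * C, mul_nonneg hc hC, fun x => (mul_le_mul_right (hs x) _).trans ?_⟩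
  rw [← ENNReal.ofReal_mul hc, mul_add, ← mul_assoc, ← mul_assoc]
  refine ENNReal.ofReal_le_ofReal ?_
  gcongr
  rw [mul_div_assoc', div_le_iff₀ (by positivity)]
  nlinarith

theorem finitelyControlled_functional (l : X →L[ℂ] ℂ) :
    FinitelyControlled fun x => ‖l x‖ₑ ^ 2 := fun η hη => by
  refine ⟨{l}, 1, zero_le_one, fun x => ?_⟩
  beta_reduce
  rw [← ofReal_norm, ← ENNReal.ofReal_pow (norm_nonneg _), Finset.sum_singleton, one_mul]
  exact ENNReal.ofReal_le_ofReal (le_add_of_nonneg_left (by positivity))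

/-- Half of `η` is spent on the remainder and half on `q'`. Through this lemma Poincaré's inequality
and the tube estimate enter: the finitely controlled comparison quantity may depend on `η`. -/
theorem FinitelyControlled.of_forall_small {q : X → ENNReal}
    (h : ∀ η > 0, ∃ q' : X → ENNReal, FinitelyControlled q' ∧
      ∀ x, q x ≤ ENNReal.ofReal (η * ‖x‖ ^ 2) + q' x) : FinitelyControlled q := fun η hη => by
  obtain ⟨q', hq', hle⟩ := h (η / 2) (half_pos hη)
  obtain ⟨s, C, hC, hs⟩ := hq' (η / 2) (half_pos hη)
  refine ⟨s, C, hC, fun x => (hle x).trans ?_⟩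
  refine (add_le_add_right (hs x) _).trans ?_
  rw [← ENNReal.ofReal_add (by positivity) (by positivity)]
  exact ENNReal.ofReal_le_ofReal (le_of_eq (by ring))

end FinitelyControlled

/-! ### Riemannian volume against Lebesgue measure in a chart -/

section ChartVolume

variable {n : ℕ} {H : Type} [TopologicalSpace H]
  {I : ModelWithCorners ℝ (EuclideanSpace ℝ (Fin n)) H}
  {R : Type*} [TopologicalSpace R] [ChartedSpace H R] [IsManifold I ∞ R]

/-- A small closed ball is intersected with the range of the model with corners, which is convex.
Thus boundary points also have convex coordinate neighborhoods, and Poincaré's inequality needs no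
separate treatment there. -/
theorem exists_convex_chart_nhds (p₀ : R) {U : Set R} (hU : U ∈ 𝓝 p₀) :
    ∃ Q ⊆ (extChartAt I p₀).target, IsCompact Q ∧ Convex ℝ Q ∧ Q ⊆ range I ∧
      (extChartAt I p₀).symm '' Q ⊆ U ∧ (extChartAt I p₀).symm '' Q ∈ 𝓝 p₀ := by
  have h1 : (extChartAt I p₀).symm ⁻¹' U ∈ 𝓝 (extChartAt I p₀ p₀) :=
    (continuousAt_extChartAt_symm p₀).preimage_mem_nhds (by simpa using hU)
  have h2 : (extChartAt I p₀).symm ⁻¹' U ∩ (extChartAt I p₀).target ∈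
      𝓝[range I] (extChartAt I p₀ p₀) :=
    inter_mem (mem_nhdsWithin_of_mem_nhds h1) (extChartAt_target_mem_nhdsWithin p₀)
  obtain ⟨ρ, hρ, hsub⟩ := Metric.mem_nhdsWithin_iff.1 h2
  set Q := Metric.closedBall (extChartAt I p₀ p₀) (ρ / 2) ∩ range I
  have hQ : Q ⊆ (extChartAt I p₀).symm ⁻¹' U ∩ (extChartAt I p₀).target :=
    (inter_subset_inter_left _ (Metric.closedBall_subset_ball (half_lt_self hρ))).trans hsub
  refine ⟨Q, fun y hy => (hQ hy).2, (isCompact_closedBall _ _).inter_right I.isClosed_range,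
    (convex_closedBall _ _).inter I.convex_range, inter_subset_right, ?_, ?_⟩
  · rintro _ ⟨y, hy, rfl⟩
    exact (hQ hy).1
  · have h3 : extChartAt I p₀ ⁻¹' Metric.closedBall (extChartAt I p₀ p₀) (ρ / 2) ∈ 𝓝 p₀ :=
      (continuousAt_extChartAt p₀).preimage_mem_nhds (Metric.closedBall_mem_nhds _ (half_pos hρ))
    filter_upwards [h3, extChartAt_source_mem_nhds (I := I) p₀] with p hp hps
    refine ⟨extChartAt I p₀ p, ⟨hp, ?_⟩, (extChartAt I p₀).left_inv hps⟩
    exact extChartAt_target_subset_range p₀ ((extChartAt I p₀).map_source hps)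

variable [MeasurableSpace R] [BorelSpace R]

theorem riemVolume_apply (g : RiemMetric I R) (p₀ : R) {A : Set R} (hA : MeasurableSet A)
    (hs : A ⊆ (extChartAt I p₀).source) :
    riemVolume g A = ∫⁻ y in extChartAt I p₀ '' A,
      ENNReal.ofReal (volumeDensity g p₀ ((extChartAt I p₀).symm y)) := by
  rw [← chartVolume_apply g p₀ hA hs]
  have := congrArg (fun μ => μ A) (riemVolume_restrict g p₀)
  simpa only [Measure.restrict_apply hA, inter_eq_left.2 hs] using this

theorem volumeDensity_pos (g : RiemMetric I R) (p₀ p : R) (hp : p ∈ (extChartAt I p₀).source) :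
    0 < volumeDensity g p₀ p := by
  refine Real.sqrt_pos.2 (lt_of_le_of_ne ?_ (det_gramMatrix_ne_zero g p₀ p hp).symm)
  let _ : RiemannianBundle (fun p : R => TangentSpace I p) := ⟨g.toRiemannianMetric⟩
  have hG : gramMatrix g p₀ p =
      Matrix.gram ℝ (fun i => (coordVector I p₀ p i : TangentSpace I p)) := by
    ext i j
    rw [Matrix.gram_apply]; rfl
  rw [hG]
  exact Matrix.PosSemidef.det_nonneg (Matrix.posSemidef_gram ℝ _)

theorem image_symm_inter_eq {p₀ : R} {Q : Set (EuclideanSpace ℝ (Fin n))}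
    (hQ : Q ⊆ (extChartAt I p₀).target) (A : Set R) :
    extChartAt I p₀ '' (A ∩ (extChartAt I p₀).symm '' Q) = (extChartAt I p₀).symm ⁻¹' A ∩ Q := by
  ext y
  constructor
  · rintro ⟨_, ⟨hA, z, hz, rfl⟩, rfl⟩
    rw [(extChartAt I p₀).right_inv (hQ hz)]
    exact ⟨hA, hz⟩
  · rintro ⟨hA, hy⟩
    exact ⟨_, ⟨hA, y, hy, rfl⟩, (extChartAt I p₀).right_inv (hQ hy)⟩

theorem measurableSet_image_symm {p₀ : R} {Q : Set (EuclideanSpace ℝ (Fin n))}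
    (hQ : Q ⊆ (extChartAt I p₀).target) (hQc : IsClosed Q) :
    MeasurableSet ((extChartAt I p₀).symm '' Q) := by
  have h : (extChartAt I p₀).symm '' Q = (extChartAt I p₀).source ∩ extChartAt I p₀ ⁻¹' Q := by
    rw [PartialEquiv.symm_image_eq_source_inter_preimage _ hQ]
  rw [h]
  obtain ⟨A, hA, hA'⟩ := continuousOn_iff_isClosed.1 (continuousOn_extChartAt (I := I) p₀) Q hQc
  rw [inter_comm, hA']
  exact hA.measurableSet.inter (isOpen_extChartAt_source p₀).measurableSet

variable (g : RiemMetric I R) {p₀ : R} {Q : Set (EuclideanSpace ℝ (Fin n))}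

/-- An upper bound on the density is an inequality of measures between the restricted volume and a
multiple of the pushforward of Lebesgue measure. The next lemma is the reverse comparison, from a
lower bound. -/
theorem setLIntegral_riemVolume_le (hQ : Q ⊆ (extChartAt I p₀).target) (hQc : IsClosed Q)
    {C : ℝ} (hC : ∀ y ∈ Q, volumeDensity g p₀ ((extChartAt I p₀).symm y) ≤ C)
    {f : R → ENNReal} (hf : Measurable f) :
    ∫⁻ p in (extChartAt I p₀).symm '' Q, f p ∂(riemVolume g) ≤
      ENNReal.ofReal C * ∫⁻ y in Q, f ((extChartAt I p₀).symm y) := by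
  have hae : AEMeasurable (extChartAt I p₀).symm (volume.restrict Q) :=
    ((continuousOn_extChartAt_symm p₀).mono hQ).aemeasurable hQc.measurableSet
  have hle : (riemVolume g).restrict ((extChartAt I p₀).symm '' Q) ≤
      ENNReal.ofReal C • Measure.map (extChartAt I p₀).symm (volume.restrict Q) := by
    refine Measure.le_iff.2 fun A hA => ?_
    have hm := hA.inter (measurableSet_image_symm hQ hQc)
    rw [Measure.restrict_apply hA, riemVolume_apply g p₀ hm, image_symm_inter_eq hQ,
      Measure.smul_apply, Measure.map_apply_of_aemeasurable hae hA, smul_eq_mul,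
      Measure.restrict_apply₀' hQc.measurableSet.nullMeasurableSet, ← setLIntegral_const]
    · have hm' := measurableSet_extChartAt_image (I := I) p₀ hm
        (inter_subset_right.trans (by
          rintro _ ⟨y, hy, rfl⟩; exact (extChartAt I p₀).map_target (hQ hy)))
      rw [image_symm_inter_eq hQ] at hm'
      exact setLIntegral_mono' hm' fun y hy => ENNReal.ofReal_le_ofReal (hC y hy.2)
    · exact inter_subset_right.trans (by
        rintro _ ⟨y, hy, rfl⟩; exact (extChartAt I p₀).map_target (hQ hy))
  refine (lintegral_mono' hle le_rfl).trans ?_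
  rw [lintegral_smul_measure, lintegral_map' hf.aemeasurable hae, smul_eq_mul]

theorem setLIntegral_comp_symm_le (hQ : Q ⊆ (extChartAt I p₀).target) (hQc : IsClosed Q)
    {c : ℝ} (hc : 0 < c) (hC : ∀ y ∈ Q, c ≤ volumeDensity g p₀ ((extChartAt I p₀).symm y))
    {f : R → ENNReal} (hf : Measurable f) :
    ∫⁻ y in Q, f ((extChartAt I p₀).symm y) ≤ ENNReal.ofReal c⁻¹ *
      ∫⁻ p in (extChartAt I p₀).symm '' Q, f p ∂(riemVolume g) := by
  have hae : AEMeasurable (extChartAt I p₀).symm (volume.restrict Q) :=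
    ((continuousOn_extChartAt_symm p₀).mono hQ).aemeasurable hQc.measurableSet
  have hle : Measure.map (extChartAt I p₀).symm (volume.restrict Q) ≤
      ENNReal.ofReal c⁻¹ • (riemVolume g).restrict ((extChartAt I p₀).symm '' Q) := by
    refine Measure.le_iff.2 fun A hA => ?_
    have hm := hA.inter (measurableSet_image_symm hQ hQc)
    have hsub : A ∩ (extChartAt I p₀).symm '' Q ⊆ (extChartAt I p₀).source :=
      inter_subset_right.trans (by
        rintro _ ⟨y, hy, rfl⟩; exact (extChartAt I p₀).map_target (hQ hy))
    have hm' := measurableSet_extChartAt_image (I := I) p₀ hm hsub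
    rw [image_symm_inter_eq hQ] at hm'
    rw [Measure.smul_apply, Measure.restrict_apply hA, riemVolume_apply g p₀ hm hsub,
      image_symm_inter_eq hQ, Measure.map_apply_of_aemeasurable hae hA, smul_eq_mul,
      Measure.restrict_apply₀' hQc.measurableSet.nullMeasurableSet]
    have h1 : ENNReal.ofReal c * volume ((extChartAt I p₀).symm ⁻¹' A ∩ Q) ≤
        ∫⁻ y in (extChartAt I p₀).symm ⁻¹' A ∩ Q,
          ENNReal.ofReal (volumeDensity g p₀ ((extChartAt I p₀).symm y)) := by
      rw [← setLIntegral_const]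
      exact setLIntegral_mono' hm' fun y hy => ENNReal.ofReal_le_ofReal (hC y hy.2)
    refine le_trans ?_ (mul_le_mul_right h1 _)
    rw [← mul_assoc, ← ENNReal.ofReal_mul (by positivity), inv_mul_cancel₀ hc.ne']
    simp
  have h2 := lintegral_mono' hle (le_refl f)
  rwa [lintegral_smul_measure, lintegral_map' hf.aemeasurable hae, smul_eq_mul] at h2

/-- By continuity of the metric, the inverse trivialization has locally bounded operator norm; `B`
is the square of such a bound. -/
theorem exists_metric_symmL_le (p₀ : R) : ∃ B : ℝ, 0 ≤ B ∧ ∀ᶠ p in 𝓝 p₀,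
    ∀ ξ : EuclideanSpace ℝ (Fin n), ∀ v : TangentSpace I p,
      v = (trivializationAt (EuclideanSpace ℝ (Fin n)) (TangentSpace I) p₀).symmL ℝ p ξ →
      g.inner p v v ≤ B * ‖ξ‖ ^ 2 := by
  let _ : RiemannianBundle (fun p : R => TangentSpace I p) := ⟨g.toRiemannianMetric⟩
  have : IsContinuousRiemannianBundle (EuclideanSpace ℝ (Fin n))
      (fun p : R => TangentSpace I p) := ⟨⟨g.inner, g.contMDiff.continuous, fun _ _ _ => rfl⟩⟩
  obtain ⟨C, hC0, hC⟩ := eventually_norm_symmL_trivializationAt_lt (EuclideanSpace ℝ (Fin n))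
    (fun p : R => TangentSpace I p) p₀
  refine ⟨C ^ 2, sq_nonneg _, ?_⟩
  filter_upwards [hC] with p hp ξ v hv
  have h1 : g.inner p v v = ‖v‖ ^ 2 := real_inner_self_eq_norm_sq v
  rw [h1, ← mul_pow]
  refine pow_le_pow_left₀ (norm_nonneg _) ?_ 2
  rw [hv]
  exact (ContinuousLinearMap.le_opNorm _ _).trans (by gcongr)

end ChartVolume

/-! ### The local Rellich theorem on the smooth stratum -/

section Rellich

attribute [local instance] InnerProductSpace.complexToReal

variable {n : ℕ} {H : Type} [TopologicalSpace H]
  {I : ModelWithCorners ℝ (EuclideanSpace ℝ (Fin n)) H}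
  {R : Type*} [TopologicalSpace R] [ChartedSpace H R] [IsManifold I ∞ R]
  {F : Type*} [NormedAddCommGroup F] [NormedSpace ℂ F] [FiniteDimensional ℂ F]
  {E : R → Type*} [TopologicalSpace (TotalSpace F E)] [∀ p, NormedAddCommGroup (E p)]
  [∀ p, InnerProductSpace ℂ (E p)] [FiberBundle F E] [IsHermitianBundle I F E]

/-- Smoothness is known for real inner products, and the Hermitian product is recovered from them:
the real part of `⟨σ, iτ⟩` is minus the imaginary part of `⟨σ, τ⟩`. -/
theorem CcSection.contMDiff_inner (σ τ : CcSection I F E) :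
    ContMDiff I 𝓘(ℝ, ℂ) ∞
      (fun p => (inner ℂ ((σ : ∀ p, E p) p) ((τ : ∀ p, E p) p) : ℂ)) := by
  have hI : ContMDiff I (I.prod 𝓘(ℝ, F)) ∞
      (fun p => (⟨p, Complex.I • (τ : ∀ p, E p) p⟩ : TotalSpace F E)) :=
    (Complex.I • τ).2.1
  have h1 : ContMDiff I 𝓘(ℝ, ℝ) ∞
      (fun p => (inner ℝ ((σ : ∀ p, E p) p) ((τ : ∀ p, E p) p) : ℝ)) :=
    ContMDiff.inner_bundle (IB := I) (n := ∞) σ.2.1 τ.2.1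
  have h2 : ContMDiff I 𝓘(ℝ, ℝ) ∞
      (fun p => (inner ℝ ((σ : ∀ p, E p) p) (Complex.I • (τ : ∀ p, E p) p) : ℝ)) :=
    ContMDiff.inner_bundle (IB := I) (n := ∞) σ.2.1 hI
  have h3 := (h1.smul (contMDiff_const (I' := 𝓘(ℝ, ℂ)) (c := (1 : ℂ)))).sub
    (h2.smul (contMDiff_const (I' := 𝓘(ℝ, ℂ)) (c := Complex.I)))
  refine h3.congr fun p => ?_
  apply Complex.ext
  · simp [real_inner_eq_re_inner ℂ]
  · simp [real_inner_eq_re_inner ℂ, inner_smul_right]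

variable (g : RiemMetric I R) (D : HermitianConnection I F E)

/-- In a chart, the derivative of `⟨e, φ⟩` is bounded by the energy density of `φ`. -/
theorem hasFDerivWithinAt_inner_symm (e φ : CcSection I F E) {p₀ : R}
    {y : EuclideanSpace ℝ (Fin n)} (hy : y ∈ (extChartAt I p₀).target) {A B : ℝ}
    (hA : energyDensity g D e ((extChartAt I p₀).symm y) ≤ A) (hB0 : 0 ≤ B)
    (hB : ∀ ξ : EuclideanSpace ℝ (Fin n), ∀ v : TangentSpace I ((extChartAt I p₀).symm y),
      v = (trivializationAt (EuclideanSpace ℝ (Fin n)) (TangentSpace I) p₀).symmL ℝ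
        ((extChartAt I p₀).symm y) ξ →
      g.inner ((extChartAt I p₀).symm y) v v ≤ B * ‖ξ‖ ^ 2) :
    ∃ u' : EuclideanSpace ℝ (Fin n) →L[ℝ] ℂ,
      HasFDerivWithinAt (fun z => (inner ℂ ((e : ∀ p, E p) ((extChartAt I p₀).symm z))
        ((φ : ∀ p, E p) ((extChartAt I p₀).symm z)) : ℂ)) u' (range I) y ∧
      ‖u'‖ ≤ √(4 * B * A * energyDensity g D φ ((extChartAt I p₀).symm y)) := by
  set p := (extChartAt I p₀).symm y with hp
  have hps : p ∈ (extChartAt I p₀).source := (extChartAt I p₀).map_target hy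
  have hps' : p ∈ (chartAt H p₀).source := by rwa [extChartAt_source] at hps
  have h1 : MDifferentiableAt I 𝓘(ℝ, ℂ)
      (fun q => (inner ℂ ((e : ∀ p, E p) q) ((φ : ∀ p, E p) q) : ℂ)) p :=
    (CcSection.contMDiff_inner e φ p).mdifferentiableAt (by simp)
  -- At a boundary point the inverse chart is differentiable only within the range of the model,
  -- hence the derivative within a set.
  have h2 : MDifferentiableWithinAt 𝓘(ℝ, EuclideanSpace ℝ (Fin n)) I (extChartAt I p₀).symm
      (range I) y := mdifferentiableWithinAt_extChartAt_symm hy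
  have h3 := h1.hasMFDerivAt.comp_hasMFDerivWithinAt y h2.hasMFDerivWithinAt
  rw [hasMFDerivWithinAt_iff_hasFDerivWithinAt] at h3
  refine ⟨_, h3, ?_⟩
  refine ContinuousLinearMap.opNorm_le_bound _ (Real.sqrt_nonneg _) fun ξ => ?_
  refine le_of_sq_le_sq ?_ (by positivity)
  set v := mfderivWithin 𝓘(ℝ, EuclideanSpace ℝ (Fin n)) I (extChartAt I p₀).symm (range I) y ξ
    with hv
  have hA0 : 0 ≤ A := (energyDensity_nonneg g D e _).trans hA
  have hE0 := energyDensity_nonneg g D φ p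
  have h4 := norm_mfderiv_inner_le g D e φ p v rfl
  have h5 : g.inner p v v ≤ B * ‖ξ‖ ^ 2 := by
    refine hB ξ v ?_
    rw [hv, TangentBundle.symmL_trivializationAt hps', hp, (extChartAt I p₀).right_inv hy]
    rfl
  rw [mul_pow, Real.sq_sqrt (by positivity)]
  refine le_trans h4 ?_
  have h6 := metric_nonneg g p v
  have h7 := energyDensity_nonneg g D e p
  calc 4 * g.inner p v v * energyDensity g D e p * energyDensity g D φ p
      ≤ 4 * (B * ‖ξ‖ ^ 2) * A * energyDensity g D φ p := by gcongr
    _ = _ := by ring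

variable [MeasurableSpace R] [BorelSpace R]

/-- The functional `φ ↦ ∫ ⟨e, φ⟩` over a measurable subset of a compact set in a chart. -/
theorem exists_functional_integral_inner (e : CcSection I F E) {p₀ : R}
    {Q : Set (EuclideanSpace ℝ (Fin n))} (hQ : Q ⊆ (extChartAt I p₀).target) (hQc : IsCompact Q)
    {c : ℝ} (hc : 0 < c) (hC : ∀ y ∈ Q, c ≤ volumeDensity g p₀ ((extChartAt I p₀).symm y))
    {A : ℝ} (hA0 : 0 ≤ A) (hA : ∀ y ∈ Q, energyDensity g D e ((extChartAt I p₀).symm y) ≤ A)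
    {S : Set (EuclideanSpace ℝ (Fin n))} (hS : S ⊆ Q) :
    ∃ l : H1Pre g D →L[ℂ] ℂ, ∀ φ : H1Pre g D, l φ = ∫ y in S,
      (inner ℂ ((e : ∀ p, E p) ((extChartAt I p₀).symm y))
        ((show CcSection I F E from φ : ∀ p, E p) ((extChartAt I p₀).symm y)) : ℂ) := by
  have hcont : ∀ φ : CcSection I F E, ContinuousOn (fun y =>
      (inner ℂ ((e : ∀ p, E p) ((extChartAt I p₀).symm y))
        ((φ : ∀ p, E p) ((extChartAt I p₀).symm y)) : ℂ)) Q := fun φ =>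
    (CcSection.continuous_inner e φ).comp_continuousOn ((continuousOn_extChartAt_symm p₀).mono hQ)
  have hint : ∀ φ : CcSection I F E, IntegrableOn (fun y =>
      (inner ℂ ((e : ∀ p, E p) ((extChartAt I p₀).symm y))
        ((φ : ∀ p, E p) ((extChartAt I p₀).symm y)) : ℂ)) S := fun φ =>
    ((hcont φ).integrableOn_compact hQc).mono_set hS
  let L : H1Pre g D →ₗ[ℂ] ℂ :=
    { toFun := fun φ => ∫ y in S, (inner ℂ ((e : ∀ p, E p) ((extChartAt I p₀).symm y))
        ((show CcSection I F E from φ : ∀ p, E p) ((extChartAt I p₀).symm y)) : ℂ)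
      map_add' := fun φ ψ => by
        rw [← integral_add (hint φ) (hint ψ)]
        exact integral_congr_ae (Eventually.of_forall fun y => inner_add_right _ _ _)
      map_smul' := fun a φ => by
        rw [RingHom.id_apply, smul_eq_mul, ← integral_const_mul]
        exact integral_congr_ae (Eventually.of_forall fun y => inner_smul_right _ _ _) }
  set V := (volume Q).toReal
  -- The three factors come from Cauchy–Schwarz on `Q`, from passing from Lebesgue measure to
  -- Riemannian volume, and from the bound `A` on the energy density of `e`.
  refine ⟨L.mkContinuous √(V * (c⁻¹ * A)) fun φ => ?_, fun φ => rfl⟩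
  set ψ : CcSection I F E := show CcSection I F E from φ with hψ
  refine le_of_sq_le_sq ?_ (by positivity)
  rw [mul_pow, Real.sq_sqrt (by positivity), ← ENNReal.ofReal_le_ofReal_iff (by positivity),
    ENNReal.ofReal_pow (norm_nonneg _), ofReal_norm]
  have hVQ : volume Q = ENNReal.ofReal V := (ENNReal.ofReal_toReal hQc.measure_lt_top.ne).symm
  calc ‖L φ‖ₑ ^ 2 ≤ (∫⁻ y in S, ‖(inner ℂ ((e : ∀ p, E p) ((extChartAt I p₀).symm y))
        ((ψ : ∀ p, E p) ((extChartAt I p₀).symm y)) : ℂ)‖ₑ) ^ 2 :=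
        pow_le_pow_left₀ zero_le (enorm_integral_le_lintegral_enorm _) 2
    _ ≤ (∫⁻ y in Q, ‖(inner ℂ ((e : ∀ p, E p) ((extChartAt I p₀).symm y))
        ((ψ : ∀ p, E p) ((extChartAt I p₀).symm y)) : ℂ)‖ₑ) ^ 2 := by
        gcongr
    _ ≤ ENNReal.ofReal V * ∫⁻ y in Q, ‖(inner ℂ ((e : ∀ p, E p) ((extChartAt I p₀).symm y))
        ((ψ : ∀ p, E p) ((extChartAt I p₀).symm y)) : ℂ)‖ₑ ^ 2 := by
        refine (sq_lintegral_le _ ?_).trans_eq (by rw [Measure.restrict_apply_univ, hVQ])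
        exact ((hcont ψ).aestronglyMeasurable hQc.measurableSet).enorm
    _ ≤ ENNReal.ofReal V * ∫⁻ y in Q, ENNReal.ofReal (A * energyDensity g D ψ
        ((extChartAt I p₀).symm y)) := by
        gcongr ENNReal.ofReal V * ?_
        refine setLIntegral_mono' hQc.measurableSet fun y hy => ?_
        rw [← ofReal_norm, ← ENNReal.ofReal_pow (norm_nonneg _)]
        refine ENNReal.ofReal_le_ofReal ?_
        refine (pow_le_pow_left₀ (norm_nonneg _) (norm_inner_le_norm _ _) 2).trans ?_
        rw [mul_pow]
        exact mul_le_mul ((norm_sq_le_energyDensity g D e _).trans (hA y hy))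
          (norm_sq_le_energyDensity g D ψ _) (sq_nonneg _) hA0
    _ ≤ ENNReal.ofReal V * (ENNReal.ofReal c⁻¹ * ∫⁻ p in (extChartAt I p₀).symm '' Q,
        ENNReal.ofReal (A * energyDensity g D ψ p) ∂(riemVolume g)) := by
        gcongr ENNReal.ofReal V * ?_
        exact setLIntegral_comp_symm_le g hQ hQc.isClosed hc hC
          (((continuous_energyDensity g D ψ).const_mul A |>.measurable).ennreal_ofReal)
    _ ≤ ENNReal.ofReal V * (ENNReal.ofReal c⁻¹ * (ENNReal.ofReal A * ENNReal.ofReal (‖φ‖ ^ 2))) := by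
        gcongr ENNReal.ofReal V * (ENNReal.ofReal c⁻¹ * ?_)
        simp only [ENNReal.ofReal_mul hA0]
        rw [lintegral_const_mul' _ _ ENNReal.ofReal_ne_top, ← lintegral_energyDensity g D φ]
        gcongr
        exact Measure.restrict_le_self
    _ = ENNReal.ofReal (V * (c⁻¹ * A) * ‖φ‖ ^ 2) := by
        rw [← ENNReal.ofReal_mul hA0, ← ENNReal.ofReal_mul (by positivity),
          ← ENNReal.ofReal_mul (by positivity)]
        congr 1; ring

/-- The gradient of `⟨e, φ⟩` in a chart is bounded by the square root of the energy density of `φ`.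
Poincaré's inequality on fine cells makes the gradient term small and leaves the integrals over the
cells, which are continuous functionals of `φ`. -/
theorem finitelyControlled_inner (e : CcSection I F E) (p₀ : R) : ∃ W ∈ 𝓝 p₀,
    FinitelyControlled fun φ : H1Pre g D => ∫⁻ p in W, ‖(inner ℂ ((e : ∀ p, E p) p)
      ((show CcSection I F E from φ : ∀ p, E p) p) : ℂ)‖ₑ ^ 2 ∂(riemVolume g) := by
  obtain ⟨B, hB0, hB⟩ := exists_metric_symmL_le g p₀
  set A := energyDensity g D e p₀ + 1
  have hA0 : 0 ≤ A := add_nonneg (energyDensity_nonneg g D e p₀) zero_le_one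
  have hAe : ∀ᶠ p in 𝓝 p₀, energyDensity g D e p < A :=
    (continuous_energyDensity g D e).continuousAt.eventually_lt continuousAt_const (lt_add_one _)
  set d := volumeDensity g p₀ p₀
  have hd : 0 < d := volumeDensity_pos g p₀ p₀ (mem_extChartAt_source p₀)
  have hdc := (continuousOn_volumeDensity g p₀).continuousAt (extChartAt_source_mem_nhds (I := I) p₀)
  have hd1 : ∀ᶠ p in 𝓝 p₀, d / 2 < volumeDensity g p₀ p :=
    continuousAt_const.eventually_lt hdc (half_lt_self hd)
  have hd2 : ∀ᶠ p in 𝓝 p₀, volumeDensity g p₀ p < 2 * d :=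
    hdc.eventually_lt continuousAt_const (by linarith)
  obtain ⟨Q, hQt, hQc, hQconv, hQr, hQU, hQn⟩ :=
    exists_convex_chart_nhds (I := I) p₀ (hB.and (hAe.and (hd1.and hd2)))
  have hQU' : ∀ y ∈ Q, _ := fun y hy => hQU (mem_image_of_mem _ hy)
  refine ⟨_, hQn, FinitelyControlled.of_forall_small fun η hη => ?_⟩
  -- This is the total loss: `2 * d` from volume to Lebesgue measure, `4 * B * A` from the gradient
  -- bound, and `(d / 2)⁻¹` for the way back. Poincaré's inequality is therefore applied with `η /
  -- (κ + 1)`.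
  set κ : ℝ := 2 * d * (4 * B * A * (d / 2)⁻¹) with hκ
  have hκ0 : 0 ≤ κ := by positivity
  obtain ⟨K, S, C, hC, hS, hP⟩ := exists_poincare_cells hQc hQconv
    (show 0 < η / (κ + 1) by positivity)
  choose l hl using fun k => exists_functional_integral_inner g D e hQt hQc (half_pos hd)
    (fun y hy => (hQU' y hy).2.2.1.le) hA0 (fun y hy => (hQU' y hy).2.1.le) (hS k).1
  refine ⟨fun φ => ENNReal.ofReal (2 * d * C) * ∑ k ∈ K, ‖l k φ‖ₑ ^ 2,
    (FinitelyControlled.sum K fun k _ => finitelyControlled_functional (l k)).const_mul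
      (by positivity), fun φ => ?_⟩
  set ψ : CcSection I F E := show CcSection I F E from φ with hψ
  have hW : ContinuousOn (fun y => √(4 * B * A * energyDensity g D ψ
      ((extChartAt I p₀).symm y))) Q := by
    refine Real.continuous_sqrt.comp_continuousOn (continuousOn_const.mul ?_)
    exact (continuous_energyDensity g D ψ).comp_continuousOn
      ((continuousOn_extChartAt_symm p₀).mono hQt)
  have hP' := hP (fun y => (inner ℂ ((e : ∀ p, E p) ((extChartAt I p₀).symm y))
        ((ψ : ∀ p, E p) ((extChartAt I p₀).symm y)) : ℂ)) _ hW fun y hy => by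
    obtain ⟨u', h1, h2⟩ := hasFDerivWithinAt_inner_symm g D e ψ (hQt hy) (hQU' y hy).2.1.le hB0
      (hQU' y hy).1
    exact ⟨u', h1.mono hQr, h2⟩
  have hE : ∫⁻ y in Q, ENNReal.ofReal (√(4 * B * A * energyDensity g D ψ
      ((extChartAt I p₀).symm y))) ^ 2 ≤
      ENNReal.ofReal (4 * B * A * (d / 2)⁻¹ * ‖φ‖ ^ 2) := by
    have h1 : ∀ y, ENNReal.ofReal (√(4 * B * A * energyDensity g D ψ
      ((extChartAt I p₀).symm y))) ^ 2 = ENNReal.ofReal (4 * B * A) *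
        ENNReal.ofReal (energyDensity g D ψ ((extChartAt I p₀).symm y)) := fun y => by
      have := energyDensity_nonneg g D ψ ((extChartAt I p₀).symm y)
      rw [← ENNReal.ofReal_pow (Real.sqrt_nonneg _), Real.sq_sqrt (by positivity),
        ENNReal.ofReal_mul (by positivity)]
    simp only [h1]
    rw [lintegral_const_mul' _ _ ENNReal.ofReal_ne_top, mul_assoc (4 * B * A),
      ENNReal.ofReal_mul (p := 4 * B * A) (by positivity)]
    gcongr
    refine (setLIntegral_comp_symm_le g hQt hQc.isClosed (half_pos hd)
      (fun y hy => (hQU' y hy).2.2.1.le)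
      (continuous_energyDensity g D ψ).measurable.ennreal_ofReal).trans ?_
    rw [ENNReal.ofReal_mul (by positivity), ← lintegral_energyDensity g D φ]
    gcongr
    exact Measure.restrict_le_self
  calc _ ≤ ENNReal.ofReal (2 * d) * ∫⁻ y in Q, ‖(inner ℂ
        ((e : ∀ p, E p) ((extChartAt I p₀).symm y))
        ((ψ : ∀ p, E p) ((extChartAt I p₀).symm y)) : ℂ)‖ₑ ^ 2 :=
        setLIntegral_riemVolume_le g hQt hQc.isClosed (fun y hy => (hQU' y hy).2.2.2.le)
          (f := fun p => ‖(inner ℂ ((e : ∀ p, E p) p) ((ψ : ∀ p, E p) p) : ℂ)‖ₑ ^ 2)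
          ((CcSection.continuous_inner e ψ).measurable.enorm.pow_const 2)
    _ ≤ ENNReal.ofReal (2 * d) * (ENNReal.ofReal (η / (κ + 1)) *
        ENNReal.ofReal (4 * B * A * (d / 2)⁻¹ * ‖φ‖ ^ 2) +
        ENNReal.ofReal C * ∑ k ∈ K, ‖l k φ‖ₑ ^ 2) := by
        gcongr ENNReal.ofReal (2 * d) * ?_
        refine hP'.trans ?_
        gcongr with k hk
        rw [hl]
    _ ≤ _ := by
        rw [mul_add, ← mul_assoc (ENNReal.ofReal (2 * d)) (ENNReal.ofReal C),
          ← ENNReal.ofReal_mul (by positivity) (q := C), ← ENNReal.ofReal_mul (by positivity),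
          ← ENNReal.ofReal_mul (by positivity)]
        refine add_le_add (ENNReal.ofReal_le_ofReal ?_) le_rfl
        have h3 : κ * (η / (κ + 1)) ≤ η := by
          rw [mul_div_assoc', div_le_iff₀ (by positivity)]
          nlinarith
        calc 2 * d * (η / (κ + 1) * (4 * B * A * (d / 2)⁻¹ * ‖φ‖ ^ 2))
            = κ * (η / (κ + 1)) * ‖φ‖ ^ 2 := by rw [hκ]; ring
          _ ≤ η * ‖φ‖ ^ 2 := by gcongr

/-- A subset of the smooth stratum over which the inclusion `H¹ → L²` is compact. -/
def IsRellichSet (S : Set R) : Prop :=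
  FinitelyControlled fun φ : H1Pre g D =>
    ∫⁻ p in S, ‖(show CcSection I F E from φ : ∀ p, E p) p‖ₑ ^ 2 ∂(riemVolume g)

variable {g D}

theorem IsRellichSet.mono {S T : Set R} (hT : IsRellichSet g D T) (h : S ⊆ T) :
    IsRellichSet g D S :=
  FinitelyControlled.mono hT fun _ => lintegral_mono_set h

theorem IsRellichSet.union {S T : Set R} (hS : IsRellichSet g D S) (hT : IsRellichSet g D T) :
    IsRellichSet g D (S ∪ T) :=
  (FinitelyControlled.add hS hT).mono fun _ => lintegral_union_le _ _ _

theorem isRellichSet_empty : IsRellichSet g D (∅ : Set R) :=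
  FinitelyControlled.zero.mono fun _ => by simp

/-- Finitely many scalar functions `⟨e i, φ⟩` control `‖φ‖` near the point, so the scalar estimate
carries over to sections. -/
theorem exists_isRellichSet_nhds [T2Space R] (p₀ : R) : ∃ W ∈ 𝓝 p₀, IsRellichSet g D W := by
  obtain ⟨N, e, C, hC, hev⟩ := exists_spanning_sections (I := I) (F := F) (E := E) p₀
  choose W hW hWc using fun i => finitelyControlled_inner g D (e i) p₀
  obtain ⟨V, hV, hVo, hpV⟩ := mem_nhds_iff.1 hev
  refine ⟨V ∩ ⋂ i, W i, inter_mem (hVo.mem_nhds hpV) (iInter_mem.2 hW), ?_⟩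
  refine ((FinitelyControlled.sum Finset.univ fun i _ => hWc i).const_mul hC).mono fun φ => ?_
  set ψ : CcSection I F E := show CcSection I F E from φ
  have hm : ∀ i, Measurable fun p => ‖(inner ℂ ((e i : ∀ p, E p) p) ((ψ : ∀ p, E p) p) : ℂ)‖ₑ ^ 2 :=
    fun i => (CcSection.continuous_inner (e i) ψ).measurable.enorm.pow_const 2
  calc ∫⁻ p in V ∩ ⋂ i, W i, ‖(ψ : ∀ p, E p) p‖ₑ ^ 2 ∂(riemVolume g)
      ≤ ∫⁻ p in V ∩ ⋂ i, W i, ENNReal.ofReal C * ∑ i, ‖(inner ℂ ((e i : ∀ p, E p) p)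
        ((ψ : ∀ p, E p) p) : ℂ)‖ₑ ^ 2 ∂(riemVolume g) := by
        refine setLIntegral_mono (Measurable.const_mul
          (Finset.measurable_sum _ fun i _ => hm i) _) fun p hp => ?_
        simp only [← ofReal_norm, ← ENNReal.ofReal_pow (norm_nonneg _)]
        rw [← ENNReal.ofReal_sum_of_nonneg fun i _ => sq_nonneg _, ← ENNReal.ofReal_mul hC]
        exact ENNReal.ofReal_le_ofReal (hV hp.1 _)
    _ = ENNReal.ofReal C * ∑ i, ∫⁻ p in V ∩ ⋂ i, W i, ‖(inner ℂ ((e i : ∀ p, E p) p)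
        ((ψ : ∀ p, E p) p) : ℂ)‖ₑ ^ 2 ∂(riemVolume g) := by
        rw [lintegral_const_mul' _ _ ENNReal.ofReal_ne_top,
          lintegral_finsetSum _ fun i _ => hm i]
    _ ≤ _ := by
        gcongr with i
        exact inter_subset_right.trans (iInter_subset _ i)

/-- If the whole smooth stratum is a Rellich set, the Sobolev inclusion is compact. -/
theorem IsRellichSet.isCompactOperator (h : IsRellichSet g D (univ : Set R)) :
    IsCompactOperator (sobolevInclusion g D) := by
  refine isCompactOperator_completion_of_functionals _ fun η hη => ?_
  obtain ⟨s, C, hC, hs⟩ := h η hη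
  refine ⟨s, C, hC, fun φ => ?_⟩
  have h1 := hs φ
  rw [Measure.restrict_univ] at h1
  have h2 := lintegral_enorm_sq g (sobolevInclusionPre g D φ)
  rw [← ENNReal.ofReal_le_ofReal_iff (by positivity), ← h2]
  exact h1

end Rellich

/-! ### Monotonicity of the determinant -/

section Determinant

open scoped MatrixOrder

variable {ι : Type*} [Fintype ι] [DecidableEq ι]

/-- The quadratic form of `1 + P` dominates the squared norm, so every eigenvalue is at least `1`.
-/
theorem one_le_det_one_add {P : Matrix ι ι ℝ} (hP : P.PosSemidef) : 1 ≤ (1 + P).det := by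
  have hH : (1 + P).IsHermitian := Matrix.isHermitian_one.add hP.1
  rw [hH.det_eq_prod_eigenvalues]
  rw [← Finset.prod_const_one (s := Finset.univ (α := ι))]
  refine Finset.prod_le_prod (fun _ _ => zero_le_one) fun i _ => ?_
  set v := hH.eigenvectorBasis i
  have h1 := hH.eigenvalues_eq i
  have h2 := hP.dotProduct_mulVec_nonneg (x := v)
  have h3 : dotProduct (star ⇑v) ⇑v = (1 : ℝ) := by
    have h4 : inner ℝ v v = (1 : ℝ) := by
      rw [real_inner_self_eq_norm_sq, hH.eigenvectorBasis.orthonormal.1 i, one_pow]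
    rw [← h4, EuclideanSpace.inner_eq_star_dotProduct, dotProduct_comm]
  rw [Matrix.add_mulVec, Matrix.one_mulVec, dotProduct_add] at h1
  change _ = dotProduct (star ⇑v) ⇑v + dotProduct (star ⇑v) (P.mulVec ⇑v) at h1
  change 1 ≤ hH.eigenvalues i
  rw [h1, h3]
  exact le_add_of_nonneg_right h2

/-- The determinant is monotone on positive definite matrices. -/
theorem det_le_det_of_posSemidef_sub {A B : Matrix ι ι ℝ} (hA : A.PosDef)
    (hAB : (B - A).PosSemidef) : A.det ≤ B.det := by
  -- Conjugation by the square root of `A` writes `B` as `S (1 + P) S` with `P` positive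
  -- semidefinite, which reduces the claim to `A = 1`.
  set S := CFC.sqrt A
  have hS : S * S = A := CFC.sqrt_mul_sqrt_self A hA.posSemidef.nonneg
  have hSh : S.IsHermitian := (CFC.sqrt_nonneg A).isSelfAdjoint
  have hdet : S.det * S.det = A.det := by rw [← Matrix.det_mul, hS]
  have hu : IsUnit S.det := by
    rw [isUnit_iff_ne_zero]
    intro h
    rw [h, zero_mul] at hdet
    exact hA.det_pos.ne hdet
  have hP : (S⁻¹ * (B - A) * S⁻¹).PosSemidef := by
    have := hAB.conjTranspose_mul_mul_same S⁻¹
    rwa [hSh.inv.eq] at this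
  have hB : B = S * (1 + S⁻¹ * (B - A) * S⁻¹) * S := by
    have h1 : S * (1 + S⁻¹ * (B - A) * S⁻¹) * S =
        S * S + (S * S⁻¹) * (B - A) * (S⁻¹ * S) := by noncomm_ring
    rw [h1, hS, Matrix.mul_nonsing_inv _ hu, Matrix.nonsing_inv_mul _ hu]
    simp
  have h1 := one_le_det_one_add hP
  rw [hB, Matrix.det_mul, Matrix.det_mul, ← hdet]
  nlinarith [mul_self_nonneg S.det]

end Determinant

/-! ### Maps that expand lengths expand volume -/

section VolumeExpansion

variable {n : ℕ} {H : Type} [TopologicalSpace H]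
  {I : ModelWithCorners ℝ (EuclideanSpace ℝ (Fin n)) H}
  {R : Type*} [TopologicalSpace R] [ChartedSpace H R] [IsManifold I ∞ R] (g : RiemMetric I R)

/-- The coordinate fields are the images of the standard basis under the derivative of the inverse
chart. Hence the Gram matrix represents the metric pulled back to coordinates. -/
theorem dotProduct_gramMatrix (p₀ p : R) (hp : p ∈ (extChartAt I p₀).source)
    (ξ : EuclideanSpace ℝ (Fin n)) (v : TangentSpace I p)
    (hv : v = mfderivWithin 𝓘(ℝ, EuclideanSpace ℝ (Fin n)) I (extChartAt I p₀).symm (range I)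
      (extChartAt I p₀ p) ξ) :
    dotProduct ⇑ξ ((gramMatrix g p₀ p).mulVec ⇑ξ) = g.inner p v v := by
  have hp' : p ∈ (chartAt H p₀).source := by rwa [extChartAt_source] at hp
  have hb : p ∈ (trivializationAt (EuclideanSpace ℝ (Fin n)) (TangentSpace I) p₀).baseSet := by
    simpa using hp
  have hv' : v = ∑ i, ξ i • coordVector I p₀ p i := by
    have h1 : v = (trivializationAt (EuclideanSpace ℝ (Fin n)) (TangentSpace I) p₀).symmL ℝ p ξ := by
      rw [hv, TangentBundle.symmL_trivializationAt hp']
      rfl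
    have h2 : ξ = ∑ i, ξ i • EuclideanSpace.single i (1 : ℝ) := by
      simpa using ((EuclideanSpace.basisFun (Fin n) ℝ).sum_repr ξ).symm
    rw [h1]
    conv_lhs => rw [h2, map_sum]
    refine Finset.sum_congr rfl fun i _ => ?_
    rw [map_smul, Trivialization.symmL_apply _ hb]
    rfl
  rw [hv']
  simp only [dotProduct, Matrix.mulVec, gramMatrix, Matrix.of_apply, map_sum, map_smul, sum_apply,
    smul_apply, smul_eq_mul, Finset.mul_sum]
  rw [Finset.sum_comm]
  refine Finset.sum_congr rfl fun i _ => Finset.sum_congr rfl fun j _ => ?_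
  rw [g.symm]
  ring

theorem posDef_gramMatrix (p₀ p : R) (hp : p ∈ (extChartAt I p₀).source) :
    (gramMatrix g p₀ p).PosDef := by
  let _ : RiemannianBundle (fun p : R => TangentSpace I p) := ⟨g.toRiemannianMetric⟩
  have hG : gramMatrix g p₀ p =
      Matrix.gram ℝ (fun i => (coordVector I p₀ p i : TangentSpace I p)) := by
    ext i j
    rw [Matrix.gram_apply]; rfl
  have h : (gramMatrix g p₀ p).PosSemidef := by rw [hG]; exact Matrix.posSemidef_gram ℝ _
  exact h.posDef_iff_det_ne_zero.2 (det_gramMatrix_ne_zero g p₀ p hp)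

/-- A linear map that expands the metric expands the volume density. -/
theorem volumeDensity_le_of_expanding {p₀ p q₀ q : R} (hp : p ∈ (extChartAt I p₀).source)
    (hq : q ∈ (extChartAt I q₀).source) {c : ℝ} (hc : 0 < c)
    (T : EuclideanSpace ℝ (Fin n) →L[ℝ] EuclideanSpace ℝ (Fin n))
    (hT : ∀ ξ : EuclideanSpace ℝ (Fin n), c * dotProduct ⇑ξ ((gramMatrix g p₀ p).mulVec ⇑ξ) ≤
      dotProduct ⇑(T ξ) ((gramMatrix g q₀ q).mulVec ⇑(T ξ))) :
    √(c ^ n) * volumeDensity g p₀ p ≤ |T.det| * volumeDensity g q₀ q := by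
  set A := LinearMap.toMatrix (EuclideanSpace.basisFun (Fin n) ℝ).toBasis
    (EuclideanSpace.basisFun (Fin n) ℝ).toBasis T.toLinearMap with hA
  have hdet : T.det = A.det := by
    rw [hA, LinearMap.det_toMatrix]
  have hAξ : ∀ ξ : EuclideanSpace ℝ (Fin n), A.mulVec ⇑ξ = ⇑(T ξ) := fun ξ => by
    have := LinearMap.toMatrix_mulVec_repr (EuclideanSpace.basisFun (Fin n) ℝ).toBasis
      (EuclideanSpace.basisFun (Fin n) ℝ).toBasis T.toLinearMap ξ
    exact this
  have hP := posDef_gramMatrix g p₀ p hp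
  have hQ := posDef_gramMatrix g q₀ q hq
  have hPc : (c • gramMatrix g p₀ p).PosDef := hP.smul hc
  -- The expansion hypothesis is an inequality of quadratic forms. Taking determinants turns the
  -- factor `c` into `c ^ n`, and taking roots gives the densities.
  have hsub : (A.transpose * gramMatrix g q₀ q * A - c • gramMatrix g p₀ p).PosSemidef := by
    have h1 := hQ.posSemidef.conjTranspose_mul_mul_same A
    rw [Matrix.conjTranspose_eq_transpose_of_trivial] at h1
    refine Matrix.PosSemidef.of_dotProduct_mulVec_nonneg (h1.1.sub hPc.1) fun x => ?_
    have h2 := hT (WithLp.toLp 2 x)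
    rw [← hAξ] at h2
    simp only [star_trivial, Matrix.sub_mulVec, dotProduct_sub, Matrix.smul_mulVec,
      dotProduct_smul, smul_eq_mul, ← Matrix.mulVec_mulVec]
    rw [Matrix.dotProduct_mulVec x A.transpose, Matrix.vecMul_transpose]
    exact sub_nonneg.2 h2
  have h3 := det_le_det_of_posSemidef_sub hPc hsub
  rw [Matrix.det_smul, Fintype.card_fin, Matrix.det_mul, Matrix.det_mul, Matrix.det_transpose] at h3
  rw [volumeDensity, volumeDensity, hdet, ← Real.sqrt_mul (by positivity), ← Real.sqrt_sq_eq_abs,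
    ← Real.sqrt_mul (sq_nonneg _)]
  exact Real.sqrt_le_sqrt (h3.trans_eq (by ring))

variable [MeasurableSpace R] [BorelSpace R]

theorem measurableSet_source_inter_preimage (p₀ : R) {B : Set (EuclideanSpace ℝ (Fin n))}
    (hB : MeasurableSet B) :
    MeasurableSet ((extChartAt I p₀).source ∩ extChartAt I p₀ ⁻¹' B) := by
  have h := (continuousOn_extChartAt (I := I) p₀).domRestrict.measurable hB
  have h2 := (isOpen_extChartAt_source (I := I) p₀).measurableSet.subtype_image h
  convert h2 using 1
  ext p
  simp [domRestrict, and_comm]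

variable {g}

/-- The case of one chart in the source and one in the target: the change of variables formula for
the coordinate expression of `Φ`, combined with the pointwise inequality of densities. Measurability
of the image is part of the conclusion because the pieces are summed later. -/
theorem riemVolume_le_of_expanding_chart {Φ : R → R} {A : Set R} (hA : MeasurableSet A) {p₀ q₀ : R}
    (hp : A ⊆ (extChartAt I p₀).source) (hq : MapsTo Φ A (extChartAt I q₀).source)
    (hinj : InjOn Φ A) (hd : ∀ p ∈ A, MDifferentiableAt I I Φ p) {c : ℝ} (hc : 0 < c)
    (hexp : ∀ p ∈ A, ∀ v : TangentSpace I p,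
      c * g.inner p v v ≤ g.inner (Φ p) (mfderiv I I Φ p v) (mfderiv I I Φ p v)) :
    MeasurableSet (Φ '' A) ∧ ENNReal.ofReal √(c ^ n) * riemVolume g A ≤ riemVolume g (Φ '' A) := by
  set Y := extChartAt I p₀ '' A with hY
  set G : EuclideanSpace ℝ (Fin n) → EuclideanSpace ℝ (Fin n) :=
    fun y => extChartAt I q₀ (Φ ((extChartAt I p₀).symm y)) with hG
  let T : EuclideanSpace ℝ (Fin n) → EuclideanSpace ℝ (Fin n) →L[ℝ] EuclideanSpace ℝ (Fin n) :=
    fun y => (mfderiv I 𝓘(ℝ, EuclideanSpace ℝ (Fin n)) (extChartAt I q₀)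
      (Φ ((extChartAt I p₀).symm y))).comp ((mfderiv I I Φ ((extChartAt I p₀).symm y)).comp
      (mfderivWithin 𝓘(ℝ, EuclideanSpace ℝ (Fin n)) I (extChartAt I p₀).symm (range I) y))
  have hYm : MeasurableSet Y := measurableSet_extChartAt_image p₀ hA hp
  have hYt : Y ⊆ (extChartAt I p₀).target := by
    rintro _ ⟨p, hpA, rfl⟩; exact (extChartAt I p₀).map_source (hp hpA)
  have hYA : ∀ y ∈ Y, (extChartAt I p₀).symm y ∈ A := by
    rintro _ ⟨p, hpA, rfl⟩; rwa [(extChartAt I p₀).left_inv (hp hpA)]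
  have hGd : ∀ y ∈ Y, HasFDerivWithinAt G (T y) Y y := fun y hy => by
    have hq' := hq (hYA y hy)
    rw [extChartAt_source] at hq'
    have h1 := (mdifferentiableAt_extChartAt (I := I) hq').hasMFDerivAt
    have h2 := (hd _ (hYA y hy)).hasMFDerivAt
    have h3 := (mdifferentiableWithinAt_extChartAt_symm (I := I) (hYt hy)).hasMFDerivWithinAt
    have h4 := h1.comp_hasMFDerivWithinAt y (h2.comp_hasMFDerivWithinAt y h3)
    rw [hasMFDerivWithinAt_iff_hasFDerivWithinAt] at h4
    exact HasFDerivWithinAt.mono h4 (hYt.trans (extChartAt_target_subset_range p₀))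
  have hGi : InjOn G Y := fun y hy z hz h => by
    have h1 := (extChartAt I q₀).injOn (hq (hYA y hy)) (hq (hYA z hz)) h
    have h2 := hinj (hYA y hy) (hYA z hz) h1
    exact (extChartAt I p₀).symm.injOn (hYt hy) (hYt hz) h2
  have himg : extChartAt I q₀ '' (Φ '' A) = G '' Y := by
    rw [hY, image_image, image_image]
    refine image_congr fun p hpA => ?_
    simp only [hG]
    rw [(extChartAt I p₀).left_inv (hp hpA)]
  have hGm : MeasurableSet (G '' Y) := measurable_image_of_fderivWithin hYm hGd hGi
  have hsub : Φ '' A ⊆ (extChartAt I q₀).source := hq.image_subset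
  have hm : MeasurableSet (Φ '' A) := by
    have h1 : Φ '' A = (extChartAt I q₀).source ∩ extChartAt I q₀ ⁻¹' (G '' Y) := by
      rw [← himg]
      refine Subset.antisymm (fun q hqA => ⟨hsub hqA, mem_image_of_mem _ hqA⟩) ?_
      rintro q ⟨hqs, q', hq', h⟩
      rwa [← (extChartAt I q₀).injOn (hsub hq') hqs h]
    rw [h1]
    exact measurableSet_source_inter_preimage q₀ hGm
  refine ⟨hm, ?_⟩
  rw [riemVolume_apply g p₀ hA hp, riemVolume_apply g q₀ hm hsub, himg,
    lintegral_image_eq_lintegral_abs_det_fderiv_mul volume hYm hGd hGi,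
    ← lintegral_const_mul' _ _ ENNReal.ofReal_ne_top]
  refine setLIntegral_mono' hYm fun y hy => ?_
  have hy1 := hp (hYA y hy)
  have hy2 := hq (hYA y hy)
  have hy3 : (extChartAt I q₀).symm (G y) = Φ ((extChartAt I p₀).symm y) :=
    (extChartAt I q₀).left_inv hy2
  rw [hy3, ← ENNReal.ofReal_mul (Real.sqrt_nonneg _), ← ENNReal.ofReal_mul (abs_nonneg _)]
  refine ENNReal.ofReal_le_ofReal (volumeDensity_le_of_expanding g hy1 hy2 hc (T y) fun ξ => ?_)
  set p := (extChartAt I p₀).symm y with hpdef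
  have hyp : extChartAt I p₀ p = y := (extChartAt I p₀).right_inv (hYt hy)
  rw [dotProduct_gramMatrix g p₀ p hy1 ξ _ rfl, dotProduct_gramMatrix g q₀ (Φ p) hy2 (T y ξ)
    (mfderiv I I Φ p (mfderivWithin 𝓘(ℝ, EuclideanSpace ℝ (Fin n)) I (extChartAt I p₀).symm
      (range I) (extChartAt I p₀ p) ξ))]
  · exact hexp p (hYA y hy) _
  · have h5 := mfderivWithin_extChartAt_symm_comp_mfderiv_extChartAt' (I := I) hy2
    have h6 := congrArg (fun L => L (mfderiv I I Φ p (mfderivWithin 𝓘(ℝ, EuclideanSpace ℝ (Fin n)) I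
      (extChartAt I p₀).symm (range I) (extChartAt I p₀ p) ξ))) h5
    rw [hyp] at h6 ⊢
    exact h6.symm

theorem measurableSet_inter_preimage_of_continuousOn {X Y : Type*} [TopologicalSpace X]
    [MeasurableSpace X] [BorelSpace X] [TopologicalSpace Y] [MeasurableSpace Y] [BorelSpace Y]
    {f : X → Y} {A : Set X} (hA : MeasurableSet A) (hf : ContinuousOn f A) {B : Set Y}
    (hB : MeasurableSet B) : MeasurableSet (A ∩ f ⁻¹' B) := by
  have h := hA.subtype_image (hf.domRestrict.measurable hB)
  convert h using 1
  ext p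
  simp [domRestrict, and_comm]

/-- Second countability provides countably many charts. `A` is cut into disjoint measurable pieces,
each inside one chart and mapped into one chart; injectivity keeps the images disjoint, so the
inequalities add up. -/
theorem riemVolume_le_of_expanding [SecondCountableTopology R] {Φ : R → R} {A : Set R}
    (hA : MeasurableSet A) (hinj : InjOn Φ A) (hd : ∀ p ∈ A, MDifferentiableAt I I Φ p) {c : ℝ}
    (hc : 0 < c) (hexp : ∀ p ∈ A, ∀ v : TangentSpace I p,
      c * g.inner p v v ≤ g.inner (Φ p) (mfderiv I I Φ p v) (mfderiv I I Φ p v)) :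
    ENNReal.ofReal √(c ^ n) * riemVolume g A ≤ riemVolume g (Φ '' A) := by
  rcases isEmpty_or_nonempty R with hR | hR
  · rw [eq_empty_of_isEmpty A]; simp
  have hcont : ContinuousOn Φ A := fun p hp => (hd p hp).continuousAt.continuousWithinAt
  obtain ⟨s, hs, hsU⟩ := TopologicalSpace.countable_cover_nhds
    (fun p : R => extChartAt_source_mem_nhds (I := I) p)
  have hsn : s.Nonempty := by
    by_contra h
    rw [not_nonempty_iff_eq_empty.1 h] at hsU
    simp only [mem_empty_iff_false, iUnion_of_empty, iUnion_empty] at hsU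
    exact empty_ne_univ hsU
  obtain ⟨σ, rfl⟩ := hs.exists_eq_range hsn
  set S : ℕ → Set R := fun k => (extChartAt I (σ k)).source with hS
  have hSm : ∀ k, MeasurableSet (disjointed S k) :=
    MeasurableSet.disjointed fun k => (isOpen_extChartAt_source (I := I) (σ k)).measurableSet
  have hSs : ∀ k, disjointed S k ⊆ (extChartAt I (σ k)).source := fun k => disjointed_subset S k
  have hcover : ∀ p : R, ∃ k, p ∈ disjointed S k := fun p => by
    have : p ∈ ⋃ k, disjointed S k := by
      rw [iUnion_disjointed]
      have h1 : p ∈ ⋃ x ∈ range σ, (extChartAt I x).source := by rw [hsU]; trivial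
      simpa [hS] using h1
    exact mem_iUnion.1 this
  let P : ℕ × ℕ → Set R := fun k => A ∩ disjointed S k.1 ∩ Φ ⁻¹' disjointed S k.2
  have hPA : ∀ k, P k ⊆ A := fun k p hp => hp.1.1
  have hPm : ∀ k, MeasurableSet (P k) := fun k =>
    measurableSet_inter_preimage_of_continuousOn (hA.inter (hSm _))
      (hcont.mono inter_subset_left) (hSm _)
  have hPd : Pairwise (Function.onFun Disjoint P) := fun k l hkl => by
    refine Set.disjoint_left.2 ?_
    rintro p ⟨⟨-, h1⟩, h2⟩ ⟨⟨-, h3⟩, h4⟩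
    have e1 : k.1 = l.1 := by
      by_contra h
      exact Set.disjoint_left.1 (disjoint_disjointed S h) h1 h3
    have e2 : k.2 = l.2 := by
      by_contra h
      exact Set.disjoint_left.1 (disjoint_disjointed S h) h2 h4
    exact hkl (Prod.ext e1 e2)
  have hPU : A = ⋃ k, P k := by
    refine Subset.antisymm (fun p hp => ?_) (iUnion_subset hPA)
    obtain ⟨i, hi⟩ := hcover p
    obtain ⟨j, hj⟩ := hcover (Φ p)
    exact mem_iUnion.2 ⟨(i, j), ⟨hp, hi⟩, hj⟩
  have hpiece := fun k => riemVolume_le_of_expanding_chart (g := g) (hPm k) (p₀ := σ k.1)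
    (q₀ := σ k.2) (fun p hp => hSs _ hp.1.2) (fun p hp => hSs _ hp.2) (hinj.mono (hPA k))
    (fun p hp => hd p (hPA k hp)) hc (fun p hp => hexp p (hPA k hp))
  have hdimg : Pairwise (Function.onFun Disjoint fun k => Φ '' P k) := fun k l hkl =>
    Set.disjoint_left.2 (by
      rintro _ ⟨p, hp, rfl⟩ ⟨q, hq, h⟩
      have := hinj (hPA l hq) (hPA k hp) h
      subst this
      exact Set.disjoint_left.1 (hPd hkl) hp hq)
  conv_lhs => rw [hPU]
  conv_rhs => rw [hPU]
  rw [image_iUnion, measure_iUnion hPd hPm, measure_iUnion hdimg fun k => (hpiece k).1,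
    ← ENNReal.tsum_mul_left]
  exact ENNReal.tsum_le_tsum fun k => (hpiece k).2

/-- The change of variables inequality for an expanding map. -/
theorem setLIntegral_comp_le_of_expanding [SecondCountableTopology R] {Φ : R → R} {A : Set R}
    (hA : MeasurableSet A) (hinj : InjOn Φ A) (hd : ∀ p ∈ A, MDifferentiableAt I I Φ p) {c : ℝ}
    (hc : 0 < c) (hexp : ∀ p ∈ A, ∀ v : TangentSpace I p,
      c * g.inner p v v ≤ g.inner (Φ p) (mfderiv I I Φ p v) (mfderiv I I Φ p v))
    {f : R → ENNReal} (hf : Measurable f) :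
    ENNReal.ofReal √(c ^ n) * ∫⁻ p in A, f (Φ p) ∂(riemVolume g) ≤
      ∫⁻ p in Φ '' A, f p ∂(riemVolume g) := by
  have hcont : ContinuousOn Φ A := fun p hp => (hd p hp).continuousAt.continuousWithinAt
  have hae : AEMeasurable Φ ((riemVolume g).restrict A) := hcont.aemeasurable hA
  -- Applied to all measurable subsets of `A`, the volume inequality becomes one between measures
  -- and can be integrated against any measurable function.
  have hle : ENNReal.ofReal √(c ^ n) • Measure.map Φ ((riemVolume g).restrict A) ≤
      (riemVolume g).restrict (Φ '' A) := by
    refine Measure.le_iff.2 fun B hB => ?_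
    have hm := measurableSet_inter_preimage_of_continuousOn hA hcont hB
    rw [Measure.smul_apply, Measure.map_apply_of_aemeasurable hae hB, Measure.restrict_apply hB,
      Measure.restrict_apply₀' hA.nullMeasurableSet, smul_eq_mul, inter_comm _ A]
    refine (riemVolume_le_of_expanding hm (hinj.mono inter_subset_left) (fun p hp => hd p hp.1) hc
      fun p hp => hexp p hp.1).trans (measure_mono ?_)
    rintro _ ⟨p, ⟨hp, hpB⟩, rfl⟩
    exact ⟨hpB, mem_image_of_mem _ hp⟩
  have h2 := lintegral_mono' hle (le_refl f)
  rwa [lintegral_smul_measure, lintegral_map' hf.aemeasurable hae, smul_eq_mul] at h2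

end VolumeExpansion

/-! ### The metric near the vertices of a conical chart -/

namespace ConicalChart

variable {n : ℕ} {H : Type} [TopologicalSpace H]
  {I : ModelWithCorners ℝ (EuclideanSpace ℝ (Fin n)) H} {S : SingularSpace.{u} I}

/-- The model of `ℝʰ × (0, ε) × L` for a conical chart. -/
abbrev model (c : ConicalChart S) :=
  (𝓘(ℝ, EuclideanSpace ℝ (Fin c.h))).prod (𝓘(ℝ, ℝ).prod (𝓡 c.l))

variable (c : ConicalChart S) (g : RiemMetric I S.reg) (gB : c.BaseMetric)
  (gL : EuclideanSpace ℝ (Fin c.h) → RiemMetric (𝓡 c.l) c.L.reg)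

/-- Only positivity of `a` is given. But `β(b, r) / r` tends to `a` uniformly on `K`, so `a` is
continuous there and has a positive minimum and a maximum. The orders `0` and `1` of the
asymptotics, with error half the minimum, then bound `β / r` and `β'`. -/
theorem exists_radius_bounds {β : EuclideanSpace ℝ (Fin c.h) → ℝ → ℝ}
    {a : EuclideanSpace ℝ (Fin c.h) → ℝ}
    (hβ : ContDiffOn ℝ ∞ (Function.uncurry β) (univ ×ˢ Ioo 0 c.ε)) (ha : ∀ b, 0 < a b)
    {K : Set (EuclideanSpace ℝ (Fin c.h))} (hK : IsCompact K) (hne : K.Nonempty)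
    (h : IsLittleO₂ 1 K 1 (fun b r => β b r - a b * r)) :
    ∃ δ > 0, ∃ c₀ > 0, ∃ C₀ : ℝ, ∀ b ∈ K, ∀ r ∈ Ioo 0 δ,
      (c₀ ≤ deriv (β b) r ∧ deriv (β b) r ≤ C₀) ∧ c₀ * r ≤ β b r ∧ β b r ≤ C₀ * r := by
  have hcont : ∀ r ∈ Ioo 0 c.ε, Continuous fun b => β b r := fun r hr => by
    refine continuousOn_univ.1 ?_
    exact hβ.continuousOn.comp (f := fun b => (b, r)) (by fun_prop) fun b _ => ⟨mem_univ _, hr⟩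
  have hu : TendstoUniformlyOn (fun (r : ℝ) b => β b r / r) a (𝓝[>] 0) K := by
    rw [Metric.tendstoUniformlyOn_iff]
    intro η hη
    obtain ⟨δ, hδ, hδ'⟩ := h (η / 2) (by positivity)
    filter_upwards [Ioo_mem_nhdsGT hδ] with r hr b hb
    have h1 := hδ' b hb r hr 0 (by norm_num)
    have hr0 : 0 < r := hr.1
    simp only [pow_zero, iteratedDeriv_zero, one_mul, pow_one, Pi.one_apply, mul_one] at h1
    rw [dist_comm, Real.dist_eq, show β b r / r - a b = (β b r - a b * r) / r by field_simp,
      abs_div, abs_of_pos hr0, div_lt_iff₀ hr0]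
    nlinarith
  have hac : ContinuousOn a K := by
    refine hu.continuousOn ?_
    refine Eventually.frequently ?_
    filter_upwards [Ioo_mem_nhdsGT c.ε_pos] with r hr
    exact ((hcont r hr).div_const r).continuousOn
  obtain ⟨b₁, hb₁, hmin⟩ := hK.exists_isMinOn hne hac
  obtain ⟨b₂, hb₂, hmax⟩ := hK.exists_isMaxOn hne hac
  obtain ⟨δ, hδ, hδ'⟩ := h (a b₁ / 2) (half_pos (ha b₁))
  refine ⟨min δ c.ε, lt_min hδ c.ε_pos, a b₁ / 2, half_pos (ha b₁), a b₂ + a b₁ / 2,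
    fun b hb r hr => ?_⟩
  have hr0 : 0 < r := hr.1
  have h0 := hδ' b hb r ⟨hr0, hr.2.trans_le (min_le_left _ _)⟩ 0 (by norm_num)
  have h1 := hδ' b hb r ⟨hr0, hr.2.trans_le (min_le_left _ _)⟩ 1 (by norm_num)
  have hd : DifferentiableAt ℝ (β b) r := by
    have h2 : DifferentiableAt ℝ (Function.uncurry β) (b, r) :=
      (hβ.differentiableOn (by simp)).differentiableAt
        (prod_mem_nhds univ_mem (Ioo_mem_nhds hr0 (hr.2.trans_le (min_le_right _ _))))
    exact h2.comp (f := fun r => (b, r)) r (by fun_prop)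
  have hmin' := isMinOn_iff.1 hmin b hb
  have hmax' := isMaxOn_iff.1 hmax b hb
  have h3 : deriv (fun r => β b r - a b * r) r = deriv (β b) r - a b := by
    have := (hd.hasDerivAt.fun_sub ((hasDerivAt_id r).const_mul (a b))).deriv
    simpa using this
  simp only [pow_zero, iteratedDeriv_zero, one_mul, pow_one, Pi.one_apply, mul_one] at h0
  simp only [iteratedDeriv_one, pow_one, Pi.one_apply, mul_one, h3] at h1
  have h4 : |deriv (β b) r - a b| ≤ a b₁ / 2 := le_of_mul_le_mul_left (by linarith) hr0
  rw [abs_le] at h0 h4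
  refine ⟨⟨by linarith, by linarith⟩, ?_, ?_⟩
  · nlinarith
  · nlinarith

/-- The pullback of `g` to a conical chart, as a quadratic form at `(b, r, x)`. -/
def pullback (b : EuclideanSpace ℝ (Fin c.h)) (r : ℝ) (x : c.L.reg)
    (u : EuclideanSpace ℝ (Fin c.h) × ℝ × EuclideanSpace ℝ (Fin c.l)) : ℝ :=
  g.inner (c.diffeo.invFun (b, r, x)) (mfderiv c.model I c.diffeo.invFun (b, r, x) u)
    (mfderiv c.model I c.diffeo.invFun (b, r, x) u)

theorem metricError_eq (β : EuclideanSpace ℝ (Fin c.h) → ℝ → ℝ)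
    (b : EuclideanSpace ℝ (Fin c.h)) (x : c.L.reg)
    (v : EuclideanSpace ℝ (Fin c.h)) (s : ℝ) (w : EuclideanSpace ℝ (Fin c.l)) (r : ℝ) :
    c.metricError g gB gL β b x v s w r = c.pullback g b r x (v, s, w) -
      (gB.inner b v v + deriv (β b) r ^ 2 * s ^ 2 + β b r ^ 2 * (gL b).inner x w w) :=
  rfl

/-- The decisive point is the power of `r` in the error: for `r < 1`, `r² (X + s² + Y)` is at most
`X + s² + r² Y`, so an error with coefficient `m / 2` costs half of the lower bound `m`, even in the
link directions, where the model metric degenerates like `r²`. -/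
theorem quadratic_form_bounds {m M c₀ C₀ r X s Y B B' G : ℝ} (hX : 0 ≤ X) (hY : 0 ≤ Y)
    (hm0 : 0 < m) (hm1 : m ≤ 1) (hm2 : m ≤ c₀ ^ 2) (hM1 : 1 ≤ M) (hM2 : C₀ ^ 2 ≤ M) (hc₀ : 0 < c₀)
    (hr0 : 0 < r) (hr1 : r < 1) (h2 : c₀ ≤ B') (h3 : B' ≤ C₀) (h4 : c₀ * r ≤ B) (h5 : B ≤ C₀ * r)
    (h1 : |G - (X + B' ^ 2 * s ^ 2 + B ^ 2 * Y)| ≤ m / 2 * r ^ 2 * (X + s ^ 2 + Y)) :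
    m / 2 * (X + s ^ 2 + r ^ 2 * Y) ≤ G ∧ G ≤ (M + m / 2) * (X + s ^ 2 + r ^ 2 * Y) := by
  have hβ1 : (c₀ * r) ^ 2 ≤ B ^ 2 := pow_le_pow_left₀ (by positivity) h4 2
  have hβ2 : B ^ 2 ≤ (C₀ * r) ^ 2 := pow_le_pow_left₀ ((by positivity : 0 ≤ c₀ * r).trans h4) h5 2
  have hd1 : c₀ ^ 2 ≤ B' ^ 2 := pow_le_pow_left₀ (by positivity) h2 2
  have hd2 : B' ^ 2 ≤ C₀ ^ 2 := pow_le_pow_left₀ (hc₀.le.trans h2) h3 2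
  have e1 : m * s ^ 2 ≤ B' ^ 2 * s ^ 2 :=
    mul_le_mul_of_nonneg_right (hm2.trans hd1) (sq_nonneg s)
  have e2 : B' ^ 2 * s ^ 2 ≤ M * s ^ 2 :=
    mul_le_mul_of_nonneg_right (hd2.trans hM2) (sq_nonneg s)
  have e3 : m * (r ^ 2 * Y) ≤ B ^ 2 * Y := by
    rw [← mul_assoc]
    refine mul_le_mul_of_nonneg_right (le_trans ?_ hβ1) hY
    rw [mul_pow]; gcongr
  have e4 : B ^ 2 * Y ≤ M * (r ^ 2 * Y) := by
    rw [← mul_assoc]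
    refine mul_le_mul_of_nonneg_right (hβ2.trans ?_) hY
    rw [mul_pow]; gcongr
  have e5 : m * X ≤ X := by nlinarith
  have e6 : X ≤ M * X := by nlinarith
  have hrr : r ^ 2 ≤ 1 := by nlinarith
  have e7 : m / 2 * r ^ 2 * (X + s ^ 2 + Y) ≤ m / 2 * (X + s ^ 2 + r ^ 2 * Y) := by
    rw [mul_assoc]
    refine mul_le_mul_of_nonneg_left ?_ (half_pos hm0).le
    nlinarith [sq_nonneg s, mul_nonneg (sub_nonneg.2 hrr) hX,
      mul_nonneg (sub_nonneg.2 hrr) (sq_nonneg s)]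
  rw [abs_le] at h1
  constructor <;> linarith [h1.1, h1.2]

/-- In a conical chart, near the vertices the metric is uniformly equivalent to
`g_B ⊕ dr² ⊕ r² g_L(b)`. -/
theorem exists_metric_bounds (h : c.IsAsymptoticallyConical g gB gL)
    {K : Set (EuclideanSpace ℝ (Fin c.h))} (hK : IsCompact K) (hne : K.Nonempty) :
    ∃ δ > 0, δ ≤ c.ε ∧ ∃ c₁ > 0, ∃ C₁ > 0, ∀ b ∈ K, ∀ r ∈ Ioo 0 δ, ∀ (x : c.L.reg)
      (u : EuclideanSpace ℝ (Fin c.h) × ℝ × EuclideanSpace ℝ (Fin c.l)),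
      c₁ * (gB.inner b u.1 u.1 + u.2.1 ^ 2 + r ^ 2 * (gL b).inner x u.2.2 u.2.2) ≤
        c.pullback g b r x u ∧
      c.pullback g b r x u ≤
        C₁ * (gB.inner b u.1 u.1 + u.2.1 ^ 2 + r ^ 2 * (gL b).inner x u.2.2 u.2.2) := by
  obtain ⟨β, a, hβ, ha, hh⟩ := h
  obtain ⟨δ₁, hδ₁, c₀, hc₀, C₀, hb⟩ := c.exists_radius_bounds hβ ha hK hne (hh K hK).1
  set m := min 1 (c₀ ^ 2) with hm
  have hm0 : 0 < m := lt_min one_pos (by positivity)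
  set M := max 1 (C₀ ^ 2) with hM
  obtain ⟨δ₂, hδ₂, he⟩ := (hh K hK).2 (m / 2) (half_pos hm0)
  refine ⟨min (min δ₁ δ₂) (min 1 c.ε), by have := c.ε_pos; positivity,
    (min_le_right _ _).trans (min_le_right _ _), m / 2, half_pos hm0, M + m / 2,
    by positivity, ?_⟩
  rintro b hbK r ⟨hr0, hr⟩ x ⟨v, s, w⟩
  have hr1 : r < δ₁ := hr.trans_le ((min_le_left _ _).trans (min_le_left _ _))
  have hr2 : r < δ₂ := hr.trans_le ((min_le_left _ _).trans (min_le_right _ _))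
  have hr3 : r < 1 := hr.trans_le ((min_le_right _ _).trans (min_le_left _ _))
  have h1 := he (b, x, v, s, w) hbK r ⟨hr0, hr2⟩ 0 (by norm_num)
  obtain ⟨⟨h2, h3⟩, h4, h5⟩ := hb b hbK r ⟨hr0, hr1⟩
  simp only [pow_zero, iteratedDeriv_zero, one_mul] at h1
  rw [metricError_eq] at h1
  exact quadratic_form_bounds (metric_nonneg gB b v) (metric_nonneg (gL b) x w) hm0
    (min_le_left _ _) (min_le_right _ _) (le_max_left _ _) (le_max_right _ _) hc₀ hr0 hr3 h2 h3 h4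
    h5 h1

end ConicalChart

/-! ### The radial flow and its expansion -/

namespace ConicalChart

section Flow

variable {n : ℕ} {H : Type} [TopologicalSpace H]
  {I : ModelWithCorners ℝ (EuclideanSpace ℝ (Fin n)) H} {S : SingularSpace.{u} I}

variable (c : ConicalChart S)

theorem mem_diffeo_target {b : EuclideanSpace ℝ (Fin c.h)} {r : ℝ} {x : c.L.reg} :
    (b, r, x) ∈ c.diffeo.target ↔ r ∈ Ioo 0 c.ε := by
  rw [c.diffeo_target]
  simp

theorem radius_mem {p : S.reg} (hp : p ∈ c.diffeo.source) : (c.diffeo p).2.1 ∈ Ioo 0 c.ε :=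
  c.mem_diffeo_target.1 (c.diffeo.map_source hp)

/-- The radial flow `(b, r, x) ↦ (b, r + τ, x)` of a conical chart. -/
def flow (τ : ℝ) (p : S.reg) : S.reg :=
  c.diffeo.invFun ((c.diffeo p).1, (c.diffeo p).2.1 + τ, (c.diffeo p).2.2)

/-- The part of a conical chart with base point in `K` and radius less than `δ`. -/
def tube (K : Set (EuclideanSpace ℝ (Fin c.h))) (δ : ℝ) : Set S.reg :=
  {p | p ∈ c.diffeo.source ∧ (c.diffeo p).1 ∈ K ∧ (c.diffeo p).2.1 < δ}

variable {c}

theorem diffeo_flow {p : S.reg} {τ : ℝ} (h : (c.diffeo p).2.1 + τ ∈ Ioo 0 c.ε) :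
    c.diffeo (c.flow τ p) = ((c.diffeo p).1, (c.diffeo p).2.1 + τ, (c.diffeo p).2.2) :=
  c.diffeo.right_inv (c.mem_diffeo_target.2 h)

theorem flow_mem_source {p : S.reg} {τ : ℝ} (h : (c.diffeo p).2.1 + τ ∈ Ioo 0 c.ε) :
    c.flow τ p ∈ c.diffeo.source :=
  c.diffeo.map_target (c.mem_diffeo_target.2 h)

theorem mdifferentiableAt_diffeo {p : S.reg} (hp : p ∈ c.diffeo.source) :
    MDifferentiableAt I c.model c.diffeo.toFun p :=
  (c.diffeo.contMDiffOn_toFun.contMDiffAt (c.diffeo.open_source.mem_nhds hp)).mdifferentiableAt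
    (by simp)

theorem mdifferentiableAt_diffeo_symm {q : EuclideanSpace ℝ (Fin c.h) × ℝ × c.L.reg}
    (hq : q ∈ c.diffeo.target) : MDifferentiableAt c.model I c.diffeo.invFun q :=
  (c.diffeo.contMDiffOn_invFun.contMDiffAt (c.diffeo.open_target.mem_nhds hq)).mdifferentiableAt
    (by simp)

/-- In product coordinates the flow is a translation of the radius, so it preserves the components
of a tangent vector. Only the coefficients of the metric change along it. -/
theorem hasMFDerivAt_shift (τ : ℝ) (q : EuclideanSpace ℝ (Fin c.h) × ℝ × c.L.reg) :
    HasMFDerivAt c.model c.model (fun q : EuclideanSpace ℝ (Fin c.h) × ℝ × c.L.reg =>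
      ((q.1, q.2.1 + τ, q.2.2) : EuclideanSpace ℝ (Fin c.h) × ℝ × c.L.reg)) q
      (ContinuousLinearMap.id ℝ
        (EuclideanSpace ℝ (Fin c.h) × ℝ × EuclideanSpace ℝ (Fin c.l))) := by
  have h1 : HasMFDerivAt 𝓘(ℝ, ℝ) 𝓘(ℝ, ℝ) (fun r : ℝ => r + τ) q.2.1 (ContinuousLinearMap.id ℝ ℝ) :=
    ((hasFDerivAt_id q.2.1).add_const τ).hasMFDerivAt
  have h2 := h1.prodMap (hasMFDerivAt_id (I := 𝓡 c.l) q.2.2)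
  rw [h1.mfderiv, mfderiv_id] at h2
  have h3 := (hasMFDerivAt_id (I := 𝓘(ℝ, EuclideanSpace ℝ (Fin c.h))) q.1).prodMap h2
  rw [h2.mfderiv, mfderiv_id] at h3
  exact h3

theorem hasMFDerivAt_flow {p : S.reg} (hp : p ∈ c.diffeo.source) {τ : ℝ}
    (h : (c.diffeo p).2.1 + τ ∈ Ioo 0 c.ε) :
    HasMFDerivAt I I (c.flow τ) p
      ((mfderiv c.model I c.diffeo.invFun
        ((c.diffeo p).1, (c.diffeo p).2.1 + τ, (c.diffeo p).2.2)).comp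
        (mfderiv I c.model c.diffeo.toFun p)) := by
  have h1 := (mdifferentiableAt_diffeo hp).hasMFDerivAt
  have h2 := hasMFDerivAt_shift (c := c) τ (c.diffeo p)
  have h3 := (mdifferentiableAt_diffeo_symm (c.mem_diffeo_target
    (b := (c.diffeo p).1) (x := (c.diffeo p).2.2).2 h)).hasMFDerivAt
  exact HasMFDerivAt.comp p h3 (h2.comp p h1)

theorem mfderiv_symm_apply_mfderiv {p : S.reg} (hp : p ∈ c.diffeo.source)
    (v : TangentSpace I p) :
    mfderiv c.model I c.diffeo.invFun (c.diffeo p) (mfderiv I c.model c.diffeo.toFun p v) = v := by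
  have h1 := (mdifferentiableAt_diffeo hp).hasMFDerivAt
  have h3 := (mdifferentiableAt_diffeo_symm (c.diffeo.map_source hp)).hasMFDerivAt
  have h4 := HasMFDerivAt.comp p h3 h1
  have h5 : HasMFDerivAt I I (c.diffeo.invFun ∘ c.diffeo.toFun) p
      (ContinuousLinearMap.id ℝ (TangentSpace I p)) := by
    refine (hasMFDerivAt_id p).congr_of_eventuallyEq ?_
    filter_upwards [c.diffeo.open_source.mem_nhds hp] with q hq
    exact c.diffeo.left_inv hq
  have h6 := hasMFDerivAt_unique h4 h5
  exact congrArg (fun T => T v) h6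

theorem pullback_mfderiv (g : RiemMetric I S.reg) {p : S.reg} (hp : p ∈ c.diffeo.source)
    (v : TangentSpace I p) :
    c.pullback g (c.diffeo p).1 (c.diffeo p).2.1 (c.diffeo p).2.2
      (mfderiv I c.model c.diffeo.toFun p v) = g.inner p v v := by
  have h1 := mfderiv_symm_apply_mfderiv hp v
  have h2 : c.diffeo.invFun (c.diffeo p) = p := c.diffeo.left_inv hp
  have h3 : ∀ (q : S.reg) (w : EuclideanSpace ℝ (Fin n)), q = p → w = v →
      g.inner q w w = g.inner p v v := by
    rintro q w rfl rfl; rfl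
  exact h3 _ _ h2 h1

theorem injOn_flow {τ : ℝ} : InjOn (c.flow τ)
    {p | p ∈ c.diffeo.source ∧ (c.diffeo p).2.1 + τ ∈ Ioo 0 c.ε} := by
  rintro p ⟨hp, hp'⟩ q ⟨hq, hq'⟩ h
  have h1 := diffeo_flow hp'
  rw [h, diffeo_flow hq'] at h1
  refine c.diffeo.injOn hp hq ?_
  simp only [Prod.mk.injEq, add_left_inj] at h1
  exact (Prod.ext h1.1 (Prod.ext h1.2.1 h1.2.2)).symm

/-- Moving outward replaces the link coefficient `r²` by the larger `(r + τ)²` and leaves the rest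
of the model metric unchanged. The constants of comparison with the model cost the factor `c₁ / C₁`.
-/
theorem div_mul_le_of_quadratic_bounds {c₁ C₁ X s r τ Y G G' : ℝ} (hc₁ : 0 < c₁) (hC₁ : 0 < C₁)
    (hY : 0 ≤ Y) (hr : 0 < r) (hτ : 0 ≤ τ) (h₁ : G ≤ C₁ * (X + s ^ 2 + r ^ 2 * Y))
    (h₂ : c₁ * (X + s ^ 2 + (r + τ) ^ 2 * Y) ≤ G') : c₁ / C₁ * G ≤ G' := by
  have h : r ^ 2 * Y ≤ (r + τ) ^ 2 * Y := by
    gcongr; linarith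
  calc c₁ / C₁ * G ≤ c₁ / C₁ * (C₁ * (X + s ^ 2 + r ^ 2 * Y)) := by gcongr
    _ = c₁ * (X + s ^ 2 + r ^ 2 * Y) := by field_simp
    _ ≤ _ := le_trans (by gcongr) h₂

/-- The radial flow is expanding up to a constant. -/
theorem exists_flow_expanding (g : RiemMetric I S.reg) (gB : c.BaseMetric)
    (gL : EuclideanSpace ℝ (Fin c.h) → RiemMetric (𝓡 c.l) c.L.reg)
    (h : c.IsAsymptoticallyConical g gB gL)
    {K : Set (EuclideanSpace ℝ (Fin c.h))} (hK : IsCompact K) (hne : K.Nonempty) :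
    ∃ δ > 0, δ ≤ c.ε ∧ ∃ C > 0, ∃ κ > 0,
      (∀ b ∈ K, ∀ r ∈ Ioo 0 δ, ∀ x, c.pullback g b r x (0, 1, 0) ≤ C) ∧
      ∀ p ∈ c.diffeo.source, (c.diffeo p).1 ∈ K → ∀ τ, 0 ≤ τ → (c.diffeo p).2.1 + τ < δ →
        ∀ v : TangentSpace I p, κ * g.inner p v v ≤
          g.inner (c.flow τ p) (mfderiv I I (c.flow τ) p v) (mfderiv I I (c.flow τ) p v) := by
  obtain ⟨δ, hδ, hδε, c₁, hc₁, C₁, hC₁, hb⟩ := c.exists_metric_bounds g gB gL h hK hne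
  refine ⟨δ, hδ, hδε, C₁, hC₁, c₁ / C₁, div_pos hc₁ hC₁, fun b hbK r hr x => ?_,
    fun p hp hpK τ hτ hpτ v => ?_⟩
  · refine ((hb b hbK r hr x (0, 1, 0)).2).trans_eq ?_
    have h1 : gB.inner b (0 : EuclideanSpace ℝ (Fin c.h)) (0 : EuclideanSpace ℝ (Fin c.h)) = 0 :=
      (gB.inner b 0).map_zero
    have h2 : (gL b).inner x (0 : EuclideanSpace ℝ (Fin c.l)) (0 : EuclideanSpace ℝ (Fin c.l)) =
        0 := ((gL b).inner x 0).map_zero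
    simp [h1, h2]
  · have hr := (c.radius_mem hp).1
    have hmem : (c.diffeo p).2.1 + τ ∈ Ioo 0 c.ε := ⟨by linarith, hpτ.trans_le hδε⟩
    set u := mfderiv I c.model c.diffeo.toFun p v with hu
    have e1 : g.inner (c.flow τ p) (mfderiv I I (c.flow τ) p v) (mfderiv I I (c.flow τ) p v) =
        c.pullback g (c.diffeo p).1 ((c.diffeo p).2.1 + τ) (c.diffeo p).2.2 u := by
      rw [(hasMFDerivAt_flow hp hmem).mfderiv]
      rfl
    have h1 := (hb _ hpK _ ⟨hr, by linarith⟩ (c.diffeo p).2.2 u).2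
    have h2 := (hb _ hpK _ ⟨by linarith, hpτ⟩ (c.diffeo p).2.2 u).1
    rw [pullback_mfderiv g hp v] at h1
    rw [e1]
    exact div_mul_le_of_quadratic_bounds hc₁ hC₁ (metric_nonneg (gL (c.diffeo p).1) _ _) hr hτ h1 h2

end Flow

end ConicalChart

/-! ### The estimate along a single radius -/

/-- For every `t` in the segment, `F r ≤ F t + ∫ |F'| ≤ h t + C ∫ h`; integrate over `t`. It is used
with `F` the function `‖φ‖ ^ 2` and `h` the energy density along a radius. -/
theorem mul_le_integral_of_deriv_le {F F' h : ℝ → ℝ} {r ρ C : ℝ} (hρ : 0 < ρ) (hC : 0 ≤ C)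
    (hd : ∀ t ∈ Icc r (r + ρ), HasDerivAt F (F' t) t) (hF' : ∀ t ∈ Icc r (r + ρ), |F' t| ≤ C * h t)
    (hh : ContinuousOn h (Icc r (r + ρ))) (h0 : ∀ t ∈ Icc r (r + ρ), 0 ≤ h t)
    (hle : ∀ t ∈ Icc r (r + ρ), F t ≤ h t) :
    ρ * F r ≤ (1 + C * ρ) * ∫ t in r..(r + ρ), h t := by
  have hrρ : r ≤ r + ρ := by linarith
  have hint : IntervalIntegrable h volume r (r + ρ) := by
    refine ContinuousOn.intervalIntegrable ?_
    rwa [uIcc_of_le hrρ]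
  set J := ∫ t in r..(r + ρ), h t with hJ
  have h1 : ∀ t ∈ Icc r (r + ρ), F r - C * J ≤ h t := by
    intro t ht
    have hsub : Icc r t ⊆ Icc r (r + ρ) := Icc_subset_Icc_right ht.2
    have h2 := intervalIntegral.sub_le_integral_of_hasDeriv_right_of_le (g := fun t => -F t)
      (g' := fun t => -F' t) (φ := fun t => C * h t) ht.1
      (fun s hs => (hd s (hsub hs)).continuousAt.neg.continuousWithinAt)
      (fun s hs => ((hd s (hsub (Ioo_subset_Icc_self hs))).neg).hasDerivWithinAt)
      ((continuousOn_const.mul (hh.mono hsub)).integrableOn_Icc)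
      (fun s hs => (neg_le_abs _).trans (hF' s (hsub (Ioo_subset_Icc_self hs))))
    rw [intervalIntegral.integral_const_mul] at h2
    have h3 : ∫ s in r..t, h s ≤ J := by
      refine intervalIntegral.integral_mono_interval le_rfl ht.1 ht.2 ?_ hint
      filter_upwards [ae_restrict_mem measurableSet_Ioc] with s hs
      exact h0 s (Ioc_subset_Icc_self hs)
    have h4 := mul_le_mul_of_nonneg_left h3 hC
    linarith [hle t ht]
  have h5 : ∫ _ in r..(r + ρ), (F r - C * J) ≤ J :=
    intervalIntegral.integral_mono_on hrρ (by simp) hint h1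
  rw [intervalIntegral.integral_const, smul_eq_mul] at h5
  linarith

theorem ofReal_le_lintegral_of_deriv_le {F F' h : ℝ → ℝ} {r ρ C : ℝ} (hρ : 0 < ρ) (hC : 0 ≤ C)
    (hd : ∀ t ∈ Icc r (r + ρ), HasDerivAt F (F' t) t) (hF' : ∀ t ∈ Icc r (r + ρ), |F' t| ≤ C * h t)
    (hh : ContinuousOn h (Icc r (r + ρ))) (h0 : ∀ t ∈ Icc r (r + ρ), 0 ≤ h t)
    (hle : ∀ t ∈ Icc r (r + ρ), F t ≤ h t) :
    ENNReal.ofReal (F r) ≤ ENNReal.ofReal ((1 + C * ρ) / ρ) *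
      ∫⁻ τ in Ioc 0 ρ, ENNReal.ofReal (h (r + τ)) := by
  have h1 := mul_le_integral_of_deriv_le hρ hC hd hF' hh h0 hle
  have hcont : ContinuousOn (fun τ => h (r + τ)) (Icc 0 ρ) :=
    hh.comp (by fun_prop) fun τ hτ => ⟨by linarith [hτ.1], by linarith [hτ.2]⟩
  have h2 : ∫ t in r..(r + ρ), h t = ∫ τ in Ioc 0 ρ, h (r + τ) := by
    rw [← intervalIntegral.integral_of_le hρ.le, intervalIntegral.integral_comp_add_left]
    simp
  rw [← ofReal_integral_eq_lintegral_ofReal (hcont.integrableOn_Icc.mono_set Ioc_subset_Icc_self)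
    (by
      filter_upwards [ae_restrict_mem measurableSet_Ioc] with τ hτ
      exact h0 _ ⟨by linarith [hτ.1], by linarith [hτ.2]⟩), ← h2,
    ← ENNReal.ofReal_mul (by positivity)]
  refine ENNReal.ofReal_le_ofReal ?_
  rw [div_mul_eq_mul_div, le_div_iff₀ hρ]
  linarith

/-! ### Radial derivative of the squared norm of a section -/

namespace ConicalChart

section RadialEstimate

attribute [local instance] InnerProductSpace.complexToReal

variable {n : ℕ} {H : Type} [TopologicalSpace H]
  {I : ModelWithCorners ℝ (EuclideanSpace ℝ (Fin n)) H} {S : SingularSpace.{u} I}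
  {F : Type*} [NormedAddCommGroup F] [NormedSpace ℂ F] [FiniteDimensional ℂ F]
  {E : S.reg → Type*} [TopologicalSpace (TotalSpace F E)] [∀ p, NormedAddCommGroup (E p)]
  [∀ p, InnerProductSpace ℂ (E p)] [FiberBundle F E] [IsHermitianBundle I F E]
  {c : ConicalChart S} (g : RiemMetric I S.reg) (D : HermitianConnection I F E)

theorem hasMFDerivAt_radial (b : EuclideanSpace ℝ (Fin c.h)) {r : ℝ} (hr : r ∈ Ioo 0 c.ε)
    (x : c.L.reg) : HasMFDerivAt 𝓘(ℝ, ℝ) I (fun r => c.diffeo.invFun (b, r, x)) r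
      ((mfderiv c.model I c.diffeo.invFun (b, r, x)).comp
        ((0 : ℝ →L[ℝ] EuclideanSpace ℝ (Fin c.h)).prod
          ((ContinuousLinearMap.id ℝ ℝ).prod (0 : ℝ →L[ℝ] EuclideanSpace ℝ (Fin c.l))))) := by
  have h3 := (mdifferentiableAt_diffeo_symm (c.mem_diffeo_target
    (b := b) (x := x).2 hr)).hasMFDerivAt
  have h4 := (hasMFDerivAt_const (I := 𝓘(ℝ, ℝ)) (I' := 𝓘(ℝ, EuclideanSpace ℝ (Fin c.h))) b r).prodMk
    ((hasMFDerivAt_id (I := 𝓘(ℝ, ℝ)) r).prodMk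
      (hasMFDerivAt_const (I := 𝓘(ℝ, ℝ)) (I' := 𝓡 c.l) x r))
  exact HasMFDerivAt.comp r h3 h4

/-- The case `e = φ` of `norm_mfderiv_inner_le`, with `C` bounding the squared length of the radial
field; both energy factors are then the same and the square root can be taken. -/
theorem hasDerivAt_norm_sq_radial (φ : CcSection I F E) (b : EuclideanSpace ℝ (Fin c.h)) {r : ℝ}
    (hr : r ∈ Ioo 0 c.ε) (x : c.L.reg) {C : ℝ} (hC : c.pullback g b r x (0, 1, 0) ≤ C) :
    ∃ d, HasDerivAt (fun r => ‖(φ : ∀ p, E p) (c.diffeo.invFun (b, r, x))‖ ^ 2) d r ∧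
      |d| ≤ 2 * √C * energyDensity g D φ (c.diffeo.invFun (b, r, x)) := by
  set γ := fun r => c.diffeo.invFun (b, r, x)
  have h1 := hasMFDerivAt_radial b hr x
  have h2 : HasMFDerivAt I 𝓘(ℝ, ℂ)
      (fun q => (inner ℂ ((φ : ∀ p, E p) q) ((φ : ∀ p, E p) q) : ℂ)) (γ r) _ :=
    ((CcSection.contMDiff_inner φ φ (γ r)).mdifferentiableAt (by simp)).hasMFDerivAt
  obtain ⟨T, hT, h3⟩ : ∃ T : ℝ →L[ℝ] ℂ, T 1 = mfderiv I 𝓘(ℝ, ℂ)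
      (fun q => (inner ℂ ((φ : ∀ p, E p) q) ((φ : ∀ p, E p) q) : ℂ)) (γ r)
      (mfderiv c.model I c.diffeo.invFun (b, r, x) (0, 1, 0)) ∧
      HasFDerivAt (fun r => (inner ℂ ((φ : ∀ p, E p) (γ r)) ((φ : ∀ p, E p) (γ r)) : ℂ)) T r :=
    ⟨_, rfl, (HasMFDerivAt.comp r h2 h1).hasFDerivAt⟩
  set d : ℂ := mfderiv I 𝓘(ℝ, ℂ)
      (fun q => (inner ℂ ((φ : ∀ p, E p) q) ((φ : ∀ p, E p) q) : ℂ)) (γ r)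
      (mfderiv c.model I c.diffeo.invFun (b, r, x) (0, 1, 0)) with hd
  have h4 : HasDerivAt (fun r => (inner ℂ ((φ : ∀ p, E p) (γ r)) ((φ : ∀ p, E p) (γ r)) : ℂ)) d r :=
    hT ▸ h3.hasDerivAt
  have h5 : HasDerivAt (fun r => ‖(φ : ∀ p, E p) (γ r)‖ ^ 2) d.re r := by
    have h6 := Complex.reCLM.hasFDerivAt.comp_hasDerivAt r h4
    refine h6.congr_of_eventuallyEq (Eventually.of_forall fun t => ?_)
    exact (inner_self_eq_norm_sq (𝕜 := ℂ) ((φ : ∀ p, E p) (γ t))).symm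
  refine ⟨d.re, h5, ?_⟩
  have h7 := norm_mfderiv_inner_le g D φ φ (γ r) _ hd.symm
  have he := energyDensity_nonneg g D φ (γ r)
  change ‖d‖ ^ 2 ≤ 4 * c.pullback g b r x (0, 1, 0) * _ * _ at h7
  have hC0 : 0 ≤ C := le_trans (metric_nonneg g _ _) hC
  have h8 : ‖d‖ ^ 2 ≤ (2 * √C * energyDensity g D φ (γ r)) ^ 2 := by
    refine h7.trans ?_
    rw [mul_pow, mul_pow, Real.sq_sqrt hC0, sq (energyDensity g D φ (γ r)), ← mul_assoc]
    norm_num only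
    gcongr
  exact (Complex.abs_re_le_norm d).trans
    ((pow_le_pow_iff_left₀ (norm_nonneg d) (by positivity) two_ne_zero).1 h8)

end RadialEstimate

end ConicalChart

/-! ### Smallness of the mass near the vertices -/

namespace ConicalChart

section TubeMeasurability

variable {n : ℕ} {H : Type} [TopologicalSpace H]
  {I : ModelWithCorners ℝ (EuclideanSpace ℝ (Fin n)) H} {S : SingularSpace.{u} I}
  {c : ConicalChart S}

theorem continuousOn_diffeo : ContinuousOn c.diffeo.toFun c.diffeo.source :=
  c.diffeo.contMDiffOn_toFun.continuousOn

theorem continuousOn_radius : ContinuousOn (fun p => (c.diffeo p).2.1) c.diffeo.source :=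
  continuous_fst.comp_continuousOn (continuous_snd.comp_continuousOn continuousOn_diffeo)

/-- The slice at time `τ` contains the image of the tube of radius `δ` under the flow. Openness in
both variables gives the joint measurability needed to exchange the integrals. -/
theorem isOpen_shell (δ : ℝ) : IsOpen {z : ℝ × S.reg | z.2 ∈ c.diffeo.source ∧
    z.1 < (c.diffeo z.2).2.1 ∧ (c.diffeo z.2).2.1 < z.1 + δ} := by
  have h1 : ContinuousOn (fun z : ℝ × S.reg => (c.diffeo z.2).2.1 - z.1)
      (Prod.snd ⁻¹' c.diffeo.source) :=
    (continuousOn_radius.comp continuousOn_snd fun z hz => hz).sub continuousOn_fst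
  convert h1.isOpen_inter_preimage (c.diffeo.open_source.preimage continuous_snd)
    (isOpen_Ioo (a := 0) (b := δ)) using 1
  ext z
  simp only [mem_ofPred_eq, mem_inter_iff, mem_preimage, mem_Ioo, sub_pos, sub_lt_iff_lt_add']

theorem continuousOn_flow : ContinuousOn (fun z : S.reg × ℝ => c.flow z.2 z.1)
    {z | z.1 ∈ c.diffeo.source ∧ (c.diffeo z.1).2.1 + z.2 ∈ Ioo 0 c.ε} := by
  have h1 : ContinuousOn (fun z : S.reg × ℝ => c.diffeo z.1)
      {z | z.1 ∈ c.diffeo.source ∧ (c.diffeo z.1).2.1 + z.2 ∈ Ioo 0 c.ε} :=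
    continuousOn_diffeo.comp continuousOn_fst fun z hz => hz.1
  have h2 : ContinuousOn (fun z : S.reg × ℝ =>
      ((c.diffeo z.1).1, (c.diffeo z.1).2.1 + z.2, (c.diffeo z.1).2.2))
      {z | z.1 ∈ c.diffeo.source ∧ (c.diffeo z.1).2.1 + z.2 ∈ Ioo 0 c.ε} :=
    (continuous_fst.comp_continuousOn h1).prodMk
      (((continuous_fst.comp_continuousOn (continuous_snd.comp_continuousOn h1)).add
        continuousOn_snd).prodMk
        (continuous_snd.comp_continuousOn (continuous_snd.comp_continuousOn h1)))
  exact c.diffeo.contMDiffOn_invFun.continuousOn.comp h2 fun z hz => c.mem_diffeo_target.2 hz.2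

variable [MeasurableSpace S.reg] [BorelSpace S.reg]

theorem measurableSet_tube {K : Set (EuclideanSpace ℝ (Fin c.h))} (hK : IsCompact K) (δ : ℝ) :
    MeasurableSet (c.tube K δ) := by
  have h0 := c.diffeo.open_source.measurableSet
  have h1 := measurableSet_inter_preimage_of_continuousOn h0
    (continuous_fst.comp_continuousOn (continuousOn_diffeo (c := c))) hK.measurableSet
  have h2 := measurableSet_inter_preimage_of_continuousOn h0
    (continuousOn_radius (c := c)) (measurableSet_Iio (a := δ))
  convert h1.inter h2 using 1
  ext p
  simp only [tube, mem_ofPred_eq, mem_inter_iff, mem_preimage, mem_Iio, Function.comp_apply]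
  tauto

end TubeMeasurability

section TubeEstimate

attribute [local instance] InnerProductSpace.complexToReal

variable {n : ℕ} {H : Type} [TopologicalSpace H]
  {I : ModelWithCorners ℝ (EuclideanSpace ℝ (Fin n)) H} {S : SingularSpace.{u} I}
  {F : Type*} [NormedAddCommGroup F] [NormedSpace ℂ F] [FiniteDimensional ℂ F]
  {E : S.reg → Type*} [TopologicalSpace (TotalSpace F E)] [∀ p, NormedAddCommGroup (E p)]
  [∀ p, InnerProductSpace ℂ (E p)] [FiberBundle F E] [IsHermitianBundle I F E]
  {c : ConicalChart S} (g : RiemMetric I S.reg) (D : HermitianConnection I F E)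

/-- The radial segment starting at `p` has length `ρ`, which is independent of how close `p` is to
the vertex; hence the constant stays bounded as the tube shrinks. -/
theorem enorm_sq_le_lintegral_flow (φ : CcSection I F E) {δ ρ C : ℝ} (hρ : 0 < ρ) (hδε : δ ≤ c.ε)
    {p : S.reg} (hp : p ∈ c.diffeo.source) (hpδ : (c.diffeo p).2.1 + ρ < δ)
    (hC : ∀ r ∈ Ioo 0 δ, c.pullback g (c.diffeo p).1 r (c.diffeo p).2.2 (0, 1, 0) ≤ C) :
    ‖(φ : ∀ p, E p) p‖ₑ ^ 2 ≤ ENNReal.ofReal ((1 + 2 * √C * ρ) / ρ) *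
      ∫⁻ τ in Ioc 0 ρ, ENNReal.ofReal (energyDensity g D φ (c.flow τ p)) := by
  obtain ⟨r, hr⟩ : ∃ r, r = (c.diffeo p).2.1 := ⟨_, rfl⟩
  have hr0 : 0 < r := hr ▸ (c.radius_mem hp).1
  rw [← hr] at hpδ
  have hmem : ∀ t ∈ Icc r (r + ρ), t ∈ Ioo 0 δ := fun t ht =>
    ⟨hr0.trans_le ht.1, ht.2.trans_lt hpδ⟩
  have hmem' : ∀ t ∈ Icc r (r + ρ), t ∈ Ioo 0 c.ε := fun t ht =>
    ⟨(hmem t ht).1, (hmem t ht).2.trans_le hδε⟩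
  have hder := fun t ht => hasDerivAt_norm_sq_radial g D φ (c.diffeo p).1 (hmem' t ht)
    (c.diffeo p).2.2 (hC t (hmem t ht))
  have h1 := ofReal_le_lintegral_of_deriv_le
    (F := fun r => ‖(φ : ∀ p, E p) (c.diffeo.invFun ((c.diffeo p).1, r, (c.diffeo p).2.2))‖ ^ 2)
    (F' := deriv
      fun r => ‖(φ : ∀ p, E p) (c.diffeo.invFun ((c.diffeo p).1, r, (c.diffeo p).2.2))‖ ^ 2)
    (h := fun r => energyDensity g D φ
      (c.diffeo.invFun ((c.diffeo p).1, r, (c.diffeo p).2.2))) (C := 2 * √C) hρ (by positivity)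
    (fun t ht => by
      obtain ⟨d, hd, -⟩ := hder t ht
      rwa [hd.deriv])
    (fun t ht => by
      obtain ⟨d, hd, hd'⟩ := hder t ht
      rwa [hd.deriv])
    ((continuous_energyDensity g D φ).comp_continuousOn fun t ht =>
      (hasMFDerivAt_radial (c.diffeo p).1 (hmem' t ht)
        (c.diffeo p).2.2).continuousAt.continuousWithinAt)
    (fun t _ => energyDensity_nonneg g D φ _) (fun t _ => norm_sq_le_energyDensity g D φ _)
  have h2 : c.diffeo.invFun ((c.diffeo p).1, r, (c.diffeo p).2.2) = p := by
    rw [hr]; exact c.diffeo.left_inv hp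
  have h3 : ‖(φ : ∀ p, E p) p‖ₑ ^ 2 = ENNReal.ofReal
      (‖(φ : ∀ p, E p) (c.diffeo.invFun ((c.diffeo p).1, r, (c.diffeo p).2.2))‖ ^ 2) := by
    rw [ENNReal.ofReal_pow (norm_nonneg _), ofReal_norm, h2]
  rw [h3]
  refine h1.trans_eq ?_
  rw [hr]
  rfl

variable [MeasurableSpace S.reg] [BorelSpace S.reg]

/-- At each time the change of variables moves the integral to the image of the tube, which lies in
the shell of radii between `τ` and `τ + δ`. A fixed point belongs to these shells only for `τ` in an
interval of length `δ`, and integrating over `τ` first produces the small factor. -/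
theorem lintegral_flow_le [SecondCountableTopology S.reg] {f : S.reg → ENNReal} (hf : Continuous f)
    {K : Set (EuclideanSpace ℝ (Fin c.h))} (hK : IsCompact K) {δ₀ δ ρ κ : ℝ}
    (hδε : δ₀ ≤ c.ε) (hδρ : δ + ρ ≤ δ₀) (hκ : 0 < κ)
    (hexp : ∀ p ∈ c.diffeo.source, (c.diffeo p).1 ∈ K → ∀ τ, 0 ≤ τ → (c.diffeo p).2.1 + τ < δ₀ →
        ∀ v : TangentSpace I p, κ * g.inner p v v ≤
          g.inner (c.flow τ p) (mfderiv I I (c.flow τ) p v) (mfderiv I I (c.flow τ) p v)) :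
    ENNReal.ofReal √(κ ^ n) *
      ∫⁻ p in c.tube K δ, ∫⁻ τ in Ioc 0 ρ, f (c.flow τ p) ∂volume ∂(riemVolume g) ≤
      ENNReal.ofReal δ * ∫⁻ p, f p ∂(riemVolume g) := by
  have hmem : ∀ p ∈ c.tube K δ, ∀ τ ∈ Ioc 0 ρ, (c.diffeo p).2.1 + τ < δ₀ := fun p hp τ hτ => by
    linarith [hp.2.2, hτ.2]
  have hmem' : ∀ p ∈ c.tube K δ, ∀ τ ∈ Ioc 0 ρ, (c.diffeo p).2.1 + τ ∈ Ioo 0 c.ε :=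
    fun p hp τ hτ => ⟨by linarith [(c.radius_mem hp.1).1, hτ.1], (hmem p hp τ hτ).trans_le hδε⟩
  have hT := measurableSet_tube (c := c) hK δ
  have hae : AEMeasurable (Function.uncurry fun p τ => f (c.flow τ p))
      (((riemVolume g).restrict (c.tube K δ)).prod (volume.restrict (Ioc 0 ρ))) := by
    rw [Measure.prod_restrict]
    refine ContinuousOn.aemeasurable ?_ (hT.prod measurableSet_Ioc)
    exact hf.comp_continuousOn (continuousOn_flow.mono fun z hz =>
      ⟨hz.1.1, hmem' _ hz.1 _ hz.2⟩)
  rw [lintegral_lintegral_swap hae, ← lintegral_const_mul' _ _ ENNReal.ofReal_ne_top]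
  set W := {z : ℝ × S.reg | z.2 ∈ c.diffeo.source ∧
    z.1 < (c.diffeo z.2).2.1 ∧ (c.diffeo z.2).2.1 < z.1 + δ} with hW
  have hWm : MeasurableSet W := (isOpen_shell δ).measurableSet
  calc ∫⁻ τ in Ioc 0 ρ, ENNReal.ofReal √(κ ^ n) *
        ∫⁻ p in c.tube K δ, f (c.flow τ p) ∂(riemVolume g)
      ≤ ∫⁻ τ in Ioc 0 ρ, ∫⁻ q, W.indicator (fun z => f z.2) (τ, q) ∂(riemVolume g) := by
        refine setLIntegral_mono' measurableSet_Ioc fun τ hτ => ?_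
        have hsub : c.tube K δ ⊆ {p | p ∈ c.diffeo.source ∧ (c.diffeo p).2.1 + τ ∈ Ioo 0 c.ε} :=
          fun p hp => ⟨hp.1, hmem' p hp τ hτ⟩
        have hinj : InjOn (c.flow τ) (c.tube K δ) := injOn_flow.mono hsub
        have h1 := setLIntegral_comp_le_of_expanding (g := g) hT
          hinj
          (fun p hp => (hasMFDerivAt_flow hp.1 (hmem' p hp τ hτ)).mdifferentiableAt) hκ
          (fun p hp => hexp p hp.1 hp.2.1 τ hτ.1.le (hmem p hp τ hτ)) hf.measurable
        refine h1.trans ?_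
        have h2 : MeasurableSet (Prod.mk τ ⁻¹' W) := measurable_prodMk_left hWm
        have h3 : c.flow τ '' c.tube K δ ⊆ Prod.mk τ ⁻¹' W := by
          rintro _ ⟨p, hp, rfl⟩
          refine ⟨flow_mem_source (hmem' p hp τ hτ), ?_⟩
          rw [diffeo_flow (hmem' p hp τ hτ)]
          exact ⟨by simpa using (c.radius_mem hp.1).1, by simpa [add_comm τ] using hp.2.2⟩
        refine (lintegral_mono_set h3).trans_eq ?_
        rw [← lintegral_indicator h2]
        rfl
    _ = ∫⁻ q, (∫⁻ τ in Ioc 0 ρ, W.indicator (fun z => f z.2) (τ, q)) ∂(riemVolume g) := by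
        refine lintegral_lintegral_swap ?_
        exact ((hf.measurable.comp measurable_snd).indicator hWm).aemeasurable
    _ ≤ ∫⁻ q, ENNReal.ofReal δ * f q ∂(riemVolume g) := by
        refine lintegral_mono fun q => ?_
        calc ∫⁻ τ in Ioc 0 ρ, W.indicator (fun z => f z.2) (τ, q)
            ≤ ∫⁻ τ, W.indicator (fun z => f z.2) (τ, q) := setLIntegral_le_lintegral _ _
          _ ≤ ∫⁻ τ, (Ioo ((c.diffeo q).2.1 - δ) (c.diffeo q).2.1).indicator (fun _ => f q) τ := by
              refine lintegral_mono fun τ => ?_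
              by_cases h : (τ, q) ∈ W
              · rw [indicator_of_mem h, indicator_of_mem]
                exact ⟨by linarith [h.2.2], h.2.1⟩
              · rw [indicator_of_notMem h]; exact zero_le
          _ = ENNReal.ofReal δ * f q := by
              rw [lintegral_indicator measurableSet_Ioo, setLIntegral_const, Real.volume_Ioo,
                mul_comm, sub_sub_cancel]
    _ = _ := lintegral_const_mul _ hf.measurable

/-- Sections of bounded `H¹`-norm have little mass near the vertices of a conical chart. -/
theorem exists_tube_bound [SecondCountableTopology S.reg] {gB : c.BaseMetric}
    {gL : EuclideanSpace ℝ (Fin c.h) → RiemMetric (𝓡 c.l) c.L.reg}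
    (h : c.IsAsymptoticallyConical g gB gL)
    {K : Set (EuclideanSpace ℝ (Fin c.h))} (hK : IsCompact K) (hne : K.Nonempty) {η : ℝ}
    (hη : 0 < η) :
    ∃ δ > 0, ∀ φ : H1Pre g D,
      ∫⁻ p in c.tube K δ, ‖(show CcSection I F E from φ : ∀ p, E p) p‖ₑ ^ 2 ∂(riemVolume g) ≤
        ENNReal.ofReal (η * ‖φ‖ ^ 2) := by
  obtain ⟨δ₀, hδ₀, hδε, C, hC, κ, hκ, hpull, hexp⟩ := exists_flow_expanding g gB gL h hK hne
  -- Since `δ ≤ ρ`, points of the tube stay within radius `2 * δ₀ / 3` along the flow, where the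
  -- metric bounds hold. The other bound on `δ` gives `A / k * δ ≤ η`.
  set ρ := δ₀ / 3 with hρ
  have hρ0 : 0 < ρ := by positivity
  set A := (1 + 2 * √C * ρ) / ρ with hA
  have hA0 : 0 < A := by positivity
  set k := √(κ ^ n) with hk
  have hk0 : 0 < k := by positivity
  refine ⟨min ρ (η * k / A), by positivity, fun φ => ?_⟩
  set δ := min ρ (η * k / A) with hδ
  have hδ0 : 0 < δ := by positivity
  have hδρ : δ ≤ ρ := min_le_left _ _
  have hδη : δ ≤ η * k / A := min_le_right _ _
  have hT := measurableSet_tube (c := c) hK δ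
  have h1 := lintegral_flow_le g (f := fun p => ENNReal.ofReal
    (energyDensity g D (show CcSection I F E from φ) p))
    (ENNReal.continuous_ofReal.comp (continuous_energyDensity g D φ)) hK hδε
    (δ := δ) (ρ := ρ) (by linarith) hκ hexp
  rw [lintegral_energyDensity] at h1
  have h2 : ∫⁻ p in c.tube K δ, ‖(show CcSection I F E from φ : ∀ p, E p) p‖ₑ ^ 2 ∂(riemVolume g) ≤
      ENNReal.ofReal A * ∫⁻ p in c.tube K δ, ∫⁻ τ in Ioc 0 ρ, ENNReal.ofReal
        (energyDensity g D (show CcSection I F E from φ) (c.flow τ p)) ∂volume ∂(riemVolume g) := by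
    rw [← lintegral_const_mul' _ _ ENNReal.ofReal_ne_top]
    refine setLIntegral_mono' hT fun p hp => ?_
    exact enorm_sq_le_lintegral_flow g D φ hρ0 hδε hp.1 (by linarith [hp.2.2])
      fun r hr => hpull _ hp.2.1 r hr _
  have h3 := mul_le_mul_right h1 (ENNReal.ofReal (A / k))
  refine h2.trans (le_trans (le_of_eq ?_) (h3.trans ?_))
  · rw [← mul_assoc, ← ENNReal.ofReal_mul (by positivity), div_mul_cancel₀ _ hk0.ne']
  · rw [← mul_assoc, ← ENNReal.ofReal_mul (by positivity), ← ENNReal.ofReal_mul (by positivity)]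
    refine ENNReal.ofReal_le_ofReal (mul_le_mul_of_nonneg_right ?_ (sq_nonneg _))
    rw [le_div_iff₀ hA0] at hδη
    rw [div_mul_eq_mul_div, div_le_iff₀ hk0]
    linarith

end TubeEstimate

end ConicalChart

/-! ### Radius function and topology of conical charts -/

/-- The distance from the vertex of a cone. -/
def Cone.radius {ε : ℝ} {L : Type u} : Cone ε L → ℝ :=
  Quotient.lift (fun p => (p.1 : ℝ)) (by
    rintro p q (h | h)
    · rw [h]
    · exact h.1.trans h.2.symm)

theorem Cone.radius_mk {ε : ℝ} {L : Type u} (r : Ico (0 : ℝ) ε) (x : L) :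
    (Cone.mk r x).radius = r :=
  rfl

theorem Cone.continuous_radius {ε : ℝ} {L : Type u} [TopologicalSpace L] :
    Continuous (Cone.radius : Cone ε L → ℝ) :=
  Continuous.quotient_lift (continuous_subtype_val.comp continuous_fst) _

theorem Cone.continuous_mk {ε : ℝ} {L : Type u} [TopologicalSpace L] :
    Continuous fun p : Ico (0 : ℝ) ε × L => Cone.mk p.1 p.2 :=
  continuous_quotient_mk'

theorem Cone.exists_mk_eq {ε : ℝ} {L : Type u} (z : Cone ε L) : ∃ r x, z = Cone.mk r x := by
  obtain ⟨⟨r, x⟩, rfl⟩ := Quotient.exists_rep z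
  exact ⟨r, x, rfl⟩

namespace ConicalChart

variable {E : Type} [NormedAddCommGroup E] [NormedSpace ℝ E] {H : Type}
    [TopologicalSpace H] {I : ModelWithCorners ℝ E H} {S : SingularSpace.{u} I}
    (c : ConicalChart S)

theorem continuous_point : Continuous
    fun q : (EuclideanSpace ℝ (Fin c.h) × Ico (0 : ℝ) c.ε) × c.L.pts => c.point q.1.1 q.1.2 q.2 := by
  have h1 : Continuous c.homeo.symm := by
    have := c.homeo.continuousOn_symm
    rwa [c.homeo_target, continuousOn_univ] at this
  exact h1.comp ((continuous_fst.comp continuous_fst).prodMk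
    (Cone.continuous_mk.comp ((continuous_snd.comp continuous_fst).prodMk continuous_snd)))

variable {c}

theorem point_mem_source (b : EuclideanSpace ℝ (Fin c.h)) (r : Ico (0 : ℝ) c.ε) (x : c.L.pts) :
    c.point b r x ∈ c.homeo.source :=
  c.homeo.map_target (by rw [c.homeo_target]; exact mem_univ _)

theorem homeo_point (b : EuclideanSpace ℝ (Fin c.h)) (r : Ico (0 : ℝ) c.ε) (x : c.L.pts) :
    c.homeo (c.point b r x) = (b, Cone.mk r x) :=
  c.homeo.right_inv (by rw [c.homeo_target]; exact mem_univ _)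

theorem vertex_eq (b : EuclideanSpace ℝ (Fin c.h)) (x y : c.L.pts) : c.vertex b x = c.vertex b y :=
  congrArg (fun z => c.homeo.symm (b, z)) (Quotient.sound (Or.inr ⟨rfl, rfl⟩))

theorem exists_point_eq {p : S.pts} (hp : p ∈ c.homeo.source) : ∃ b r x, p = c.point b r x := by
  obtain ⟨r, x, h⟩ := (c.homeo p).2.exists_mk_eq
  refine ⟨(c.homeo p).1, r, x, ?_⟩
  rw [point, ← h]
  exact (c.homeo.left_inv hp).symm

theorem radius_vertex (b : EuclideanSpace ℝ (Fin c.h)) (x : c.L.pts) :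
    (c.homeo (c.vertex b x)).2.radius = 0 := by
  rw [vertex, homeo_point, Cone.radius_mk]

theorem homeo_incl {p : S.reg} (hp : p ∈ c.diffeo.source) :
    ((c.homeo (S.incl p)).1 = (c.diffeo p).1) ∧
      (c.homeo (S.incl p)).2.radius = (c.diffeo p).2.1 := by
  have hr : (c.diffeo p).2.1 ∈ Ioo 0 c.ε := by
    have h := c.diffeo.map_source hp
    rw [c.diffeo_target] at h
    exact h.2.1
  have h1 := c.compat (c.diffeo p).1 (c.diffeo p).2.1 hr (c.diffeo p).2.2
  have h2 : c.diffeo.invFun ((c.diffeo p).1, (c.diffeo p).2.1, (c.diffeo p).2.2) = p :=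
    c.diffeo.left_inv hp
  rw [h2] at h1
  have h3 := homeo_point (c := c) (c.diffeo p).1 ⟨(c.diffeo p).2.1, hr.1.le, hr.2⟩
    (c.L.incl (c.diffeo p).2.2)
  rw [point, ← h1] at h3
  rw [h3]
  exact ⟨rfl, rfl⟩

theorem continuousOn_homeo_radius :
    ContinuousOn (fun p => (c.homeo p).2.radius) c.homeo.source :=
  Cone.continuous_radius.comp_continuousOn (continuous_snd.comp_continuousOn c.homeo.continuousOn)

/-- A conical transition maps vertices to vertices. -/
theorem HasConicalTransition.radius_eq_zero {c c' : ConicalChart S} {gB : c.BaseMetric}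
    {gB' : c'.BaseMetric} (h : c.HasConicalTransition c' gB gB') {b : EuclideanSpace ℝ (Fin c.h)}
    {x : c.L.pts} (hb : c.vertex b x ∈ c'.homeo.source) :
    (c'.homeo (c.vertex b x)).2.radius = 0 := by
  obtain ⟨ψ, φ, f, a, h1, -, -, h2⟩ := h
  obtain ⟨ha, h3, -⟩ := h2 b ⟨x, hb⟩
  obtain ⟨δ, hδ, h4⟩ := h3 1 one_pos
  have hγ : Continuous fun r : Ico (0 : ℝ) c.ε => c.point b r x :=
    c.continuous_point.comp (f := fun r => ((b, r), x)) (by fun_prop)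
  set z : Ico (0 : ℝ) c.ε := ⟨0, le_rfl, c.ε_pos⟩
  -- The asymptotics of `φ` say nothing at `r = 0`, so the vertex is approached through positive
  -- radii at fixed `b` and `x`. There the radius in the second chart is at most `(a b + 1) * r`,
  -- which tends to `0`.
  set l : Filter (Ico (0 : ℝ) c.ε) := comap Subtype.val (𝓝[>] 0) with hl
  have : NeBot l := NeBot.comap_of_range_mem inferInstance (by
    rw [Subtype.range_coe]
    exact mem_of_superset (Ioo_mem_nhdsGT c.ε_pos) Ioo_subset_Ico_self)
  have hlz : l ≤ 𝓝 z :=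
    (comap_mono nhdsWithin_le_nhds).trans_eq (nhds_induced Subtype.val z).symm
  have hlim : Tendsto (fun r : Ico (0 : ℝ) c.ε => |(c'.homeo (c.point b r x)).2.radius|) l
      (𝓝 |(c'.homeo (c.vertex b x)).2.radius|) :=
    ((continuousOn_homeo_radius.continuousAt (c'.homeo.open_source.mem_nhds hb)).tendsto.comp
      (hγ.continuousAt.tendsto.mono_left hlz)).abs
  have hlim' : Tendsto (fun r : Ico (0 : ℝ) c.ε => (a b + 1) * (r : ℝ)) l (𝓝 ((a b + 1) * 0)) :=
    ((continuous_subtype_val.tendsto z).mono_left hlz).const_mul _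
  have hev : ∀ᶠ r : Ico (0 : ℝ) c.ε in l, c.point b r x ∈ c'.homeo.source :=
    hlz (hγ.continuousAt.eventually (c'.homeo.open_source.mem_nhds hb))
  have hev' : ∀ᶠ r : Ico (0 : ℝ) c.ε in l, (r : ℝ) ∈ Ioo 0 δ :=
    tendsto_comap.eventually (Ioo_mem_nhdsGT hδ)
  have hle := le_of_tendsto_of_tendsto hlim hlim' (by
    filter_upwards [hev, hev'] with r hr hrδ
    obtain ⟨hφ, h5⟩ := h1 b r x hr
    have h6 := h4 b rfl r hrδ 0 (by norm_num)
    simp only [pow_zero, iteratedDeriv_zero, one_mul, pow_one, Pi.one_apply, mul_one] at h6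
    rw [h5, homeo_point, Cone.radius_mk]
    change |φ b r| ≤ _
    have h7 : |a b * r| = a b * r := abs_of_nonneg (mul_nonneg ha.le hrδ.1.le)
    have h8 := abs_add_le (φ b r - a b * r) (a b * r)
    rw [sub_add_cancel, h7] at h8
    linarith)
  rw [mul_zero] at hle
  exact abs_eq_zero.1 (le_antisymm hle (abs_nonneg _))

end ConicalChart

/-- The charts of an IACS manifold. -/
theorem IsIACS.exists_charts {E : Type} [NormedAddCommGroup E] [NormedSpace ℝ E] {H : Type}
    [TopologicalSpace H] {I : ModelWithCorners ℝ E H} {d m : ℕ} {S : SingularSpace.{u} I}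
    {g : RiemMetric I S.reg} (hS : IsIACS d m S g) :
    ∃ (ι : Type u) (c : ι → ConicalChart S) (k : ι → ℕ) (gB : ∀ i, (c i).BaseMetric)
      (gL : ∀ i, EuclideanSpace ℝ (Fin (c i).h) → RiemMetric (𝓡 (c i).l) (c i).L.reg),
      (∀ p ∉ range S.incl, ∃ i b x, p = (c i).vertex b x) ∧
      (∀ i, CompactSpace (c i).L.pts) ∧
      (∀ i j, k i = k j → (c i).h = (c j).h →
        (c i).HasConicalTransition (c j) (gB i) (gB j)) ∧
      ∀ i, (c i).IsAsymptoticallyConical g (gB i) (gL i) := by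
  cases hS with
  | mk _ _ _ c k _ cover _ link_compact gB transition _ _ gL _ _ _ metric =>
    exact ⟨_, c, k, gB, gL, cover, link_compact, transition, metric⟩

/-! ### From local to global: vertices and Baire's theorem -/

section Rellich

attribute [local instance] InnerProductSpace.complexToReal

variable {n : ℕ} {H : Type} [TopologicalSpace H]
  {I : ModelWithCorners ℝ (EuclideanSpace ℝ (Fin n)) H} {S : SingularSpace.{u} I}
  {F : Type*} [NormedAddCommGroup F] [NormedSpace ℂ F] [FiniteDimensional ℂ F]
  {E : S.reg → Type*} [TopologicalSpace (TotalSpace F E)] [∀ p, NormedAddCommGroup (E p)]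
  [∀ p, InnerProductSpace ℂ (E p)] [FiberBundle F E] [IsHermitianBundle I F E]
  [MeasurableSpace S.reg] [BorelSpace S.reg]
  (g : RiemMetric I S.reg) (D : HermitianConnection I F E)

/-- The Rellich property of the regular part of some neighborhood of a point. -/
def IsRellichAt (p : S.pts) : Prop :=
  ∃ U ∈ 𝓝 p, IsRellichSet g D (S.incl ⁻¹' U)

variable {g D}

theorem isRellichAt_incl (p : S.reg) : IsRellichAt g D (S.incl p) := by
  have := S.isOpenEmbedding_incl.isEmbedding.t2Space
  obtain ⟨W, hW, hW'⟩ := exists_isRellichSet_nhds (g := g) (D := D) p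
  refine ⟨S.incl '' W, S.isOpenEmbedding_incl.isOpenMap.image_mem_nhds hW, ?_⟩
  rwa [preimage_image_eq _ S.isOpenEmbedding_incl.injective]

variable (g D) in
theorem isOpen_isRellichAt : IsOpen {p | IsRellichAt g D p} := by
  refine isOpen_iff_mem_nhds.2 fun p ⟨U, hU, hU'⟩ => ?_
  filter_upwards [eventually_mem_nhds_iff.2 hU] with q hq
  exact ⟨U, hq, hU'⟩

theorem IsCompact.isRellichSet {K : Set S.pts} (hK : IsCompact K)
    (h : ∀ p ∈ K, IsRellichAt g D p) : IsRellichSet g D (S.incl ⁻¹' K) := by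
  refine hK.induction_on (p := fun s => IsRellichSet g D (S.incl ⁻¹' s)) isRellichSet_empty
    (fun s t hst ht => ht.mono (preimage_mono hst)) (fun s t hs ht => hs.union ht) fun p hp => ?_
  obtain ⟨U, hU, hU'⟩ := h p hp
  exact ⟨U, mem_nhdsWithin_of_mem_nhds hU, hU'⟩

/-- A vertex of a conical chart has the Rellich property if, close to it, all points that are not
vertices do. -/
theorem isRellichAt_vertex {c : ConicalChart S} [CompactSpace c.L.pts] {gB : c.BaseMetric}
    {gL : EuclideanSpace ℝ (Fin c.h) → RiemMetric (𝓡 c.l) c.L.reg}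
    (hc : c.IsAsymptoticallyConical g gB gL) {b₀ : EuclideanSpace ℝ (Fin c.h)} {x₀ : c.L.pts}
    {U₀ : Set S.pts} (hU₀ : U₀ ∈ 𝓝 (c.vertex b₀ x₀))
    (h : ∀ p ∈ U₀ ∩ c.homeo.source, (c.homeo p).2.radius ≠ 0 → IsRellichAt g D p) :
    IsRellichAt g D (c.vertex b₀ x₀) := by
  have := S.isOpenEmbedding_incl.isEmbedding.secondCountableTopology
  set z : Ico (0 : ℝ) c.ε := ⟨0, le_rfl, c.ε_pos⟩ with hz
  -- The tube lemma: all directions give the same vertex and the link is compact, so `U₀` contains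
  -- every chart point with base near `b₀` and small radius, uniformly in the direction.
  obtain ⟨s, hs, δ₁, hδ₁, hδε, hsub⟩ : ∃ s > 0, ∃ δ₁ > 0, δ₁ < c.ε ∧
      ∀ b ∈ Metric.closedBall b₀ s, ∀ r : Ico (0 : ℝ) c.ε, (r : ℝ) ≤ δ₁ → ∀ x,
        c.point b r x ∈ U₀ := by
    have h1 : ∀ᶠ q in 𝓝 (b₀, z), ∀ x : c.L.pts, c.point q.1 q.2 x ∈ U₀ := by
      have h2 : ∀ᶠ q in 𝓝 (b₀, z), ∀ x ∈ (univ : Set c.L.pts), c.point q.1 q.2 x ∈ U₀ := by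
        refine isCompact_univ.eventually_forall_of_forall_eventually fun x _ => ?_
        have h3 := c.continuous_point.tendsto ((b₀, z), x)
        have h4 : c.point b₀ z x = c.vertex b₀ x₀ := ConicalChart.vertex_eq b₀ x x₀
        rw [h4] at h3
        exact h3.eventually hU₀
      filter_upwards [h2] with q hq x using hq x (mem_univ x)
    rw [nhds_prod_eq] at h1
    obtain ⟨A, hA, A', hA', hAA⟩ := eventually_prod_iff.1 h1
    obtain ⟨s, hs, hsA⟩ := Metric.nhds_basis_closedBall.mem_iff.1 hA
    obtain ⟨t, ht, htA⟩ := Metric.nhds_basis_closedBall.mem_iff.1 hA'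
    refine ⟨s, hs, min t (c.ε / 2), lt_min ht (half_pos c.ε_pos),
      (min_le_right _ _).trans_lt (half_lt_self c.ε_pos), fun b hb r hr x => ?_⟩
    refine hAA (hsA hb) (htA ?_) x
    rw [Metric.mem_closedBall, Subtype.dist_eq, Real.dist_eq, hz]
    simpa [abs_of_nonneg r.2.1] using hr.trans (min_le_left _ _)
  set K := Metric.closedBall b₀ s
  have hK : IsCompact K := isCompact_closedBall b₀ s
  refine ⟨c.homeo.source ∩ (fun p => ((c.homeo p).1, (c.homeo p).2.radius)) ⁻¹'
    (Metric.ball b₀ s ×ˢ Iio δ₁), IsOpen.mem_nhds ?_ ⟨ConicalChart.point_mem_source _ _ _, ?_⟩, ?_⟩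
  · exact ((continuous_fst.comp_continuousOn c.homeo.continuousOn).prodMk
      ConicalChart.continuousOn_homeo_radius).isOpen_inter_preimage c.homeo.open_source
      (Metric.isOpen_ball.prod isOpen_Iio)
  · refine ⟨?_, ?_⟩
    · change (c.homeo (c.vertex b₀ x₀)).1 ∈ _
      rw [ConicalChart.vertex, ConicalChart.homeo_point]
      exact Metric.mem_ball_self hs
    · change (c.homeo (c.vertex b₀ x₀)).2.radius < δ₁
      rw [ConicalChart.radius_vertex]
      exact hδ₁
  · refine FinitelyControlled.of_forall_small fun η hη => ?_
    obtain ⟨δ, hδ, hδ'⟩ := ConicalChart.exists_tube_bound g D hc hK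
      (Metric.nonempty_closedBall.2 hs.le) hη
    -- Outside the thin tube the neighborhood lies in this compact set of points with radius in `[δ,
    -- δ₁]`. It contains no vertex, so all its points are good by hypothesis. Both `δ` and `Z`
    -- depend on `η`.
    set Z : Set S.pts := (fun q : (EuclideanSpace ℝ (Fin c.h) × Ico (0 : ℝ) c.ε) × c.L.pts =>
      c.point q.1.1 q.1.2 q.2) '' ((K ×ˢ (Subtype.val ⁻¹' Icc δ δ₁)) ×ˢ univ) with hZ
    have hZc : IsCompact Z := by
      refine IsCompact.image ((hK.prod ?_).prod isCompact_univ) c.continuous_point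
      have hsub : Icc δ δ₁ ⊆ Ico 0 c.ε := fun r hr => ⟨hδ.le.trans hr.1, hr.2.trans_lt hδε⟩
      rw [Subtype.isCompact_iff, Subtype.image_preimage_coe, inter_eq_right.2 hsub]
      exact isCompact_Icc
    have hZr : IsRellichSet g D (S.incl ⁻¹' Z) := by
      refine IsCompact.isRellichSet hZc ?_
      rintro _ ⟨⟨⟨b, r⟩, x⟩, ⟨⟨hb, hr⟩, -⟩, rfl⟩
      refine h _ ⟨hsub b hb r hr.2 x, ConicalChart.point_mem_source _ _ _⟩ ?_
      change (c.homeo (c.point b r x)).2.radius ≠ 0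
      rw [ConicalChart.homeo_point, Cone.radius_mk]
      exact (hδ.trans_le hr.1).ne'
    refine ⟨_, hZr, fun φ => ?_⟩
    refine (lintegral_mono_set (t := c.tube K δ ∪ S.incl ⁻¹' Z) ?_).trans
      ((lintegral_union_le _ _ _).trans (add_le_add_left (hδ' φ) _))
    rintro p ⟨hp, hp1, hp2⟩
    have hps : p ∈ c.diffeo.source := by rw [c.diffeo_source]; exact hp
    obtain ⟨h1, h2⟩ := ConicalChart.homeo_incl hps
    by_cases hpδ : (c.diffeo p).2.1 < δ
    · exact Or.inl ⟨hps, h1 ▸ Metric.ball_subset_closedBall hp1, hpδ⟩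
    · right
      obtain ⟨b, r, x, hq⟩ := ConicalChart.exists_point_eq hp
      rw [← h2] at hpδ
      change (c.homeo (S.incl p)).2.radius < δ₁ at hp2
      change (c.homeo (S.incl p)).1 ∈ _ at hp1
      rw [hq, ConicalChart.homeo_point] at hp1 hp2 hpδ
      rw [Cone.radius_mk] at hp2 hpδ
      exact ⟨((b, r), x), ⟨⟨Metric.ball_subset_closedBall hp1, not_lt.1 hpδ, hp2.le⟩, mem_univ _⟩,
        hq.symm⟩

/-- Baire's theorem in the compact set of bad points isolates a place where a single type of chart,
given by label and base dimension, dominates. Only charts of the same type are related by conical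
transition maps. -/
theorem isRellichSet_univ_of_isIACS [CompactSpace S.pts] {d m : ℕ} (hS : IsIACS d m S g) :
    IsRellichSet g D (univ : Set S.reg) := by
  obtain ⟨ι, c, k, gB, gL, cover, link_compact, transition, metric⟩ := hS.exists_charts
  set B := {p | IsRellichAt g D p}ᶜ with hB
  have hBc : IsClosed B := (isOpen_isRellichAt g D).isClosed_compl
  suffices hB0 : B = ∅ by
    have h := IsCompact.isRellichSet (g := g) (D := D) isCompact_univ fun p _ => by
      by_contra hp
      exact (hB0 ▸ (show p ∈ B from hp) : p ∈ (∅ : Set S.pts))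
    exact h
  by_contra hne
  have : Nonempty B := (nonempty_iff_ne_empty.2 hne).to_subtype
  have : CompactSpace B := isCompact_iff_compactSpace.1 hBc.isCompact
  -- There may be uncountably many charts, but only countably many types, which is what Baire's
  -- theorem requires.
  set T : ℕ × ℕ → Set S.pts := fun t =>
    {p | p ∈ B ∧ ∃ i b x, k i = t.1 ∧ (c i).h = t.2 ∧ p = (c i).vertex b x} with hT
  have hU : ⋃ t, (Subtype.val ⁻¹' closure (T t) : Set B) = univ := by
    refine eq_univ_of_forall fun ⟨p, hp⟩ => ?_
    have hp' : p ∉ range S.incl := by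
      rintro ⟨q, rfl⟩
      exact hp (isRellichAt_incl q)
    obtain ⟨i, b, x, h⟩ := cover p hp'
    exact mem_iUnion.2 ⟨(k i, (c i).h), subset_closure ⟨hp, i, b, x, rfl, rfl, h⟩⟩
  obtain ⟨t, ⟨y, hy⟩, hyt⟩ := nonempty_interior_of_iUnion_of_closed
    (fun t => isClosed_closure.preimage continuous_subtype_val) hU
  obtain ⟨O, hO, hyO, hOt⟩ : ∃ O, IsOpen O ∧ y ∈ O ∧ ∀ p ∈ B, p ∈ O → p ∈ closure (T t) := by
    obtain ⟨O, hO, hO'⟩ := isOpen_induced_iff.1 (isOpen_interior (s := Subtype.val ⁻¹' closure (T t)))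
    refine ⟨O, hO, (hO'.symm ▸ hyt : (⟨y, hy⟩ : B) ∈ Subtype.val ⁻¹' O), fun p hp hpO => ?_⟩
    have h1 : (⟨p, hp⟩ : B) ∈ Subtype.val ⁻¹' O := hpO
    rw [hO'] at h1
    exact (interior_subset h1 : (⟨p, hp⟩ : B) ∈ Subtype.val ⁻¹' closure (T t))
  -- The point obtained from Baire's theorem is only in the closure of `T t`; it is replaced by a
  -- nearby element, which is a vertex of a chart of the right type.
  obtain ⟨q, hqO, hqB, i, b, x, hki, hhi, rfl⟩ := mem_closure_iff.1 (hOt y hy hyO) O hO hyO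
  have := link_compact i
  refine hqB (isRellichAt_vertex (metric i) (hO.mem_nhds hqO) fun p ⟨hpO, hps⟩ hpr => ?_)
  by_contra hpB
  have hp : p ∈ closure (T t) := hOt p hpB hpO
  have hopen : IsOpen ((c i).homeo.source ∩ (fun p => ((c i).homeo p).2.radius) ⁻¹' {0}ᶜ) :=
    ConicalChart.continuousOn_homeo_radius.isOpen_inter_preimage (c i).homeo.open_source
      isOpen_compl_singleton
  -- A bad point off the vertex set would be approximated by vertices of charts of the same type
  -- lying at nonzero radius in chart `i`, against the invariance of vertices under transition maps.
  obtain ⟨p', ⟨hp's, hp'r⟩, hp'B, j, b', x', hkj, hhj, rfl⟩ := mem_closure_iff.1 hp _ hopen ⟨hps, hpr⟩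
  exact hp'r ((transition j i (hkj.trans hki.symm) (hhj.trans hhi.symm)).radius_eq_zero hp's)

end Rellich

end

theorem mainTheorem4 (n : ℕ) [NeZero n] (m : ℕ)
    (M : SingularSpace.{u} (𝓡∂ n)) [CompactSpace M.pts] [MeasurableSpace M.reg] [BorelSpace M.reg]
    (g : RiemMetric (𝓡∂ n) M.reg) (hM : IsIACS 2 m M g)
    {F : Type*} [NormedAddCommGroup F] [NormedSpace ℂ F] [FiniteDimensional ℂ F]
    {E : M.reg → Type*} [TopologicalSpace (TotalSpace F E)]
    [∀ p, NormedAddCommGroup (E p)] [∀ p, InnerProductSpace ℂ (E p)] [FiberBundle F E]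
    [IsHermitianBundle (𝓡∂ n) F E] (D : HermitianConnection (𝓡∂ n) F E) :
    IsCompactOperator (sobolevInclusion g D) :=
  IsRellichSet.isCompactOperator (isRellichSet_univ_of_isIACS hM)
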